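/- **Linear type theory.** Fix a signature: base types, function symbols $f:A\to B$ and predicate symbols $R$ of arity $A$, where $A,B$ range over the types generated from the base types by $I$, $\otimes$, $\multimap$ and finite products $1$, $\times$. Terms-in-context $x_1:A_1,\dots,x_n:A_n\vdash t:B$ are those of the linear $\lambda$-calculus: variables; function symbols; $\star$ and $\mathsf{let}\ \star=s\ \mathsf{in}\ t$; $s\otimes t$ and $\mathsf{let}\ x\otimes y=s\ \mathsf{in}\ t$; $\lambda x.t$ and application; and, for $1,\times$, the empty tuple, pairing (sharing the context) and projections. All other formers split the context among their premises. Provable equality of terms is the congruence generated by the $\beta$- and $\eta$-equations (with commuting conversions). **Formulas.** Formulas in a linear context $X$ are built from literals $R(t),R(t)^\perp$ with $\top,\bot,\wedge,\vee,\forall,\exists$. The body of $\forall x{:}A.\varphi$ or $\exists x{:}A.\varphi$ in context $X=(x_1:A_1,\dots,x_n:A_n)$ is a formula $\varphi$ over the cartesian product $A\times\bigotimes X$, where $\bigotimes X=A_1\otimes(\cdots\otimes(A_n\otimes I))$. Negation $\varphi^\perp$ is the involution given by De Morgan duality. **The calculus $\mathrm{LFS}^q$.** Sequents $\Gamma\vdash\Delta\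 [X]$ consist of finite multisets of formulas in context $X$. The rules are $\varphi\vdash\varphi$; weakening and contraction on both sides; the cuts $$\frac{\Gamma\vdash\varphi\quad \varphi,\Gamma'\vdash\Delta}{\Gamma,\Gamma'\vdash\Delta}\qquad\frac{\Gamma\vdash\varphi,\Delta'\quad\varphi\vdash\Delta}{\Gamma\vdash\Delta,\Delta'};$$ the usual additive left and right rules for $\top,\bot,\wedge,\vee,\forall,\exists$, in which the active formulas stand without a context on their own side (instances in quantifier rules are taken at terms $X\vdash t:A$, and the rules $\forall R$, $\exists L$ have their premise over $A\times\bigotimes X$); substitution of terms for variables; replacement of a term by a provably equal one in a predicate; duality $\Gamma\vdash\Delta\,/\,\Delta^\perp\vdash\Gamma^\perp$; and, for orthologic, the two transfer rules $\Gamma\vdash\Delta\,/\,\Gamma,\Delta^\perp\vdash$ and $\Gamma\vdash\Delta\,/\,\vdash\Gamma^\perp,\Delta$. Without transfer one has the calculus over basic orthologic (paraconsistent quantum logic), with transfer the one over orthologic. **Models.** $\mathbf{QL}$ is the category of algebras of the propositional logic: bounded lattices with an order-reversing involution, for orthologic moreover with $a\wedge a^\perp=\bot$, and the maps preserving all operations.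 A (quantified) $\mathbf{QL}$-hyperdoctrine over a symmetric monoidal closed category $\mathbf C$ with finite products is a functor $P:\mathbf C^{\rm op}\to\mathbf{QL}$ such that, for every projection $\pi:X\times Y\to Y$, $P(\pi)$ has a right adjoint $\forall_\pi$ and a left adjoint $\exists_\pi$, and the Beck–Chevalley conditions $P(f)\circ\forall_\pi=\forall_{\pi'}\circ P(X\times f)$ and $P(f)\circ\exists_\pi=\exists_{\pi'}\circ P(X\times f)$ hold for all $f:Z\to Y$, with $\pi':X\times Z\to Z$ (Frobenius reciprocity is not assumed). An interpretation sends base types to objects, function symbols to arrows, and a predicate symbol of arity $A$ to an element of $P([\![A]\!])$; it extends to types, to terms (arrows from the tensor product of the context), and to formulas in context $X$ (elements of $P([\![X]\!])$, with $\forall,\exists$ read as the adjoints). It satisfies $\Gamma\vdash\Delta\ [X]$ if $\bigwedge[\![\Gamma]\!]\le\bigvee[\![\Delta]\!]$ in $P([\![X]\!])$. **Theorem.** For each of the two logics, every signature, every set $T$ of sequents and every sequent $\sigma$: $\sigma$ is derivable in $\mathrm{LFS}^q$ from the axioms $T$ if and only if $\sigma$ is satisfied by every interpretation satisfying $T$ in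 every $\mathbf{QL}$-hyperdoctrine over a symmetric monoidal closed category with finite products. (With $T=\emptyset$: $\sigma$ is provable if and only if it is valid in all such hyperdoctrines. Soundness holds for base categories and fibres of any size; for completeness, small ones of the size of the signature suffice.) -/

import Mathlib

open CategoryTheory Limits MonoidalCategory Opposite

universe u v w z

namespace LFSq

/-! ## Linear type theory -/

/-- Types over a set of base types: the type formers of symmetric monoidal closed
categories (unit, tensor, linear function type) and of finite products. -/
inductive Ty (B : Type u) : Type u
  | base : B → Ty B
  | unit : Ty B
  | tensor : Ty B → Ty B → Ty B
  | lolli : Ty B → Ty B → Ty B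
  | one : Ty B
  | prod : Ty B → Ty B → Ty B

/-- A signature: base types, typed function symbols, typed predicate symbols. Symbols of
several arguments are those whose domain is a tensor product or a cartesian product. -/
structure Signature where
  Base : Type u
  Fn : Type u
  Pred : Type u
  dom : Fn → Ty Base
  cod : Fn → Ty Base
  arity : Pred → Ty Base

/-- Linear contexts: variables are positions in the list. -/
abbrev Ctx (S : Signature.{u}) : Type u := List (Ty S.Base)

/-- The tensor product of all types of a context. -/
def Ctx.tensor {S : Signature.{u}} : Ctx S → Ty S.Base
  | [] => Ty.unit
  | A :: X => Ty.tensor A (Ctx.tensor X)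

/-- `Split X Y Z`: a way of distributing the variables of `X` into two disjoint
subcontexts `Y` and `Z` (an unshuffle of `X`). -/
inductive Split {S : Signature.{u}} : Ctx S → Ctx S → Ctx S → Type u
  | nil : Split [] [] []
  | left {A : Ty S.Base} {X Y Z : Ctx S} : Split X Y Z → Split (A :: X) (A :: Y) Z
  | right {A : Ty S.Base} {X Y Z : Ctx S} : Split X Y Z → Split (A :: X) Y (A :: Z)

namespace Split

variable {S : Signature.{u}}

def allLeft : (X : Ctx S) → Split X X []
  | [] => nil
  | _ :: X => left (allLeft X)

def allRight : (X : Ctx S) → Split X [] X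
  | [] => nil
  | _ :: X => right (allRight X)

def symm : {X Y Z : Ctx S} → Split X Y Z → Split X Z Y
  | _, _, _, nil => nil
  | _, _, _, left p => right (symm p)
  | _, _, _, right p => left (symm p)

/-- Reassociation: from `X = (U, V), Z` to `X = U, (V, Z)`. -/
def assoc : {X Y Z U V : Ctx S} → Split X Y Z → Split Y U V →
    (W : Ctx S) × Split X U W × Split W V Z
  | _, _, _, _, _, nil, nil => ⟨[], nil, nil⟩
  | _, _, _, _, _, left p, left q =>
      let r := assoc p q
      ⟨r.1, left r.2.1, r.2.2⟩
  | _, _, _, _, _, left p, right q =>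
      let r := assoc p q
      ⟨_ :: r.1, right r.2.1, left r.2.2⟩
  | _, _, _, _, _, right p, q =>
      let r := assoc p q
      ⟨_ :: r.1, right r.2.1, right r.2.2⟩

/-- Reassociation: from `X = U, (V, W)` to `X = (U, V), W`. -/
def unassoc {X U R V W : Ctx S} (p : Split X U R) (q : Split R V W) :
    (Y : Ctx S) × Split X Y W × Split Y U V :=
  let r := assoc p.symm q.symm
  ⟨r.1, r.2.1.symm, r.2.2.symm⟩

theorem eq_of_nil_right : {X Y : Ctx S} → Split X Y [] → X = Y
  | _, _, nil => rfl
  | _, _, left p => congrArg (List.cons _) (eq_of_nil_right p)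

/-- Given a variable of `D` (the split `p`, with remaining variables `R`) and a splitting of
`D` into `Y` and `Z`, the variable lies either in `Y` or in `Z`. -/
def locate {A : Ty S.Base} : {D R Y Z : Ctx S} → Split D [A] R → Split D Y Z →
    ((Q : Ctx S) × Split Y [A] Q × Split R Q Z) ⊕ ((Q : Ctx S) × Split Z [A] Q × Split R Y Q)
  | _, _, _, _, left p, left q => Sum.inl
      ⟨_, left (allRight _), by
        have e : _ = _ := eq_of_nil_right p.symm
        exact e ▸ q⟩
  | _, _, _, _, left p, right q => Sum.inr
      ⟨_, left (allRight _), by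
        have e : _ = _ := eq_of_nil_right p.symm
        exact e ▸ q⟩
  | _, _, _, _, right p, left q =>
      match locate p q with
      | Sum.inl r => Sum.inl ⟨_ :: r.1, right r.2.1, left r.2.2⟩
      | Sum.inr r => Sum.inr ⟨r.1, r.2.1, left r.2.2⟩
  | _, _, _, _, right p, right q =>
      match locate p q with
      | Sum.inl r => Sum.inl ⟨r.1, r.2.1, right r.2.2⟩
      | Sum.inr r => Sum.inr ⟨_ :: r.1, right r.2.1, right r.2.2⟩

end Split

/-- Terms of linear type theory in context: `Tm X A` are the terms `X ⊢ t : A`. The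
multiplicative formers distribute the variables of the context over their premises; the
formers of cartesian products are additive. -/
inductive Tm {S : Signature.{u}} : Ctx S → Ty S.Base → Type u
  | var {A : Ty S.Base} : Tm [A] A
  | op {X : Ctx S} (f : S.Fn) : Tm X (S.dom f) → Tm X (S.cod f)
  | star : Tm [] Ty.unit
  /-- `let ⋆ = s in t` -/
  | letStar {X Y Z : Ctx S} {C : Ty S.Base} :
      Split X Y Z → Tm Y Ty.unit → Tm Z C → Tm X C
  | tens {X Y Z : Ctx S} {A B : Ty S.Base} :
      Split X Y Z → Tm Y A → Tm Z B → Tm X (Ty.tensor A B)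
  /-- `let x ⊗ y = s in t` -/
  | letTens {X Y Z : Ctx S} {A B C : Ty S.Base} :
      Split X Y Z → Tm Y (Ty.tensor A B) → Tm (A :: B :: Z) C → Tm X C
  | lam {X : Ctx S} {A B : Ty S.Base} : Tm (A :: X) B → Tm X (Ty.lolli A B)
  | app {X Y Z : Ctx S} {A B : Ty S.Base} :
      Split X Y Z → Tm Y (Ty.lolli A B) → Tm Z A → Tm X B
  | triv {X : Ctx S} : Tm X Ty.one
  | pair {X : Ctx S} {A B : Ty S.Base} : Tm X A → Tm X B → Tm X (Ty.prod A B)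
  | fst {X : Ctx S} {A B : Ty S.Base} : Tm X (Ty.prod A B) → Tm X A
  | snd {X : Ctx S} {A B : Ty S.Base} : Tm X (Ty.prod A B) → Tm X B

namespace Tm

variable {S : Signature.{u}}

/-- Substitution of `s` for a variable of `t`, at any position. Since the calculus is linear,
`s` is never weakened. -/
def substAt {A : Ty S.Base} {Y : Ctx S} (s : Tm Y A) :
    {D : Ctx S} → {C : Ty S.Base} → Tm D C →
    {R X : Ctx S} → Split D [A] R → Split X Y R → Tm X C
  | _, _, var, _, _, Split.left Split.nil, q => (Split.eq_of_nil_right q).symm ▸ s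
  | _, _, op f t, _, _, p, q => op f (substAt s t p q)
  | _, _, letStar m t t', _, _, p, q =>
      match Split.locate p m with
      | Sum.inl r =>
          let k := Split.unassoc q r.2.2
          letStar k.2.1 (substAt s t r.2.1 k.2.2) t'
      | Sum.inr r =>
          let k := Split.unassoc q r.2.2.symm
          letStar k.2.1.symm t (substAt s t' r.2.1 k.2.2)
  | _, _, tens m t t', _, _, p, q =>
      match Split.locate p m with
      | Sum.inl r =>
          let k := Split.unassoc q r.2.2
          tens k.2.1 (substAt s t r.2.1 k.2.2) t'
      | Sum.inr r =>
          let k := Split.unassoc q r.2.2.symm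
          tens k.2.1.symm t (substAt s t' r.2.1 k.2.2)
  | _, _, letTens m t t', _, _, p, q =>
      match Split.locate p m with
      | Sum.inl r =>
          let k := Split.unassoc q r.2.2
          letTens k.2.1 (substAt s t r.2.1 k.2.2) t'
      | Sum.inr r =>
          let k := Split.unassoc q r.2.2.symm
          letTens k.2.1.symm t
            (substAt s t' (Split.right (Split.right r.2.1)) (Split.right (Split.right k.2.2)))
  | _, _, lam t, _, _, p, q => lam (substAt s t (Split.right p) (Split.right q))
  | _, _, app m t t', _, _, p, q =>
      match Split.locate p m with
      | Sum.inl r =>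
          let k := Split.unassoc q r.2.2
          app k.2.1 (substAt s t r.2.1 k.2.2) t'
      | Sum.inr r =>
          let k := Split.unassoc q r.2.2.symm
          app k.2.1.symm t (substAt s t' r.2.1 k.2.2)
  | _, _, triv, _, _, _, _ => triv
  | _, _, pair t t', _, _, p, q => pair (substAt s t p q) (substAt s t' p q)
  | _, _, fst t, _, _, p, q => fst (substAt s t p q)
  | _, _, snd t, _, _, p, q => snd (substAt s t p q)

/-- Substitution `t[s/x]` for the first variable of `t`. -/
def subst {X Y Z : Ctx S} {A C : Ty S.Base} (p : Split X Y Z) (s : Tm Y A)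
    (t : Tm (A :: Z) C) : Tm X C :=
  substAt s t (Split.left (Split.allRight Z)) p

/-- The tensor `x₁ ⊗ (x₂ ⊗ (… ⊗ ⋆))` of all variables of a context. -/
def tuple : (X : Ctx S) → Tm X X.tensor
  | [] => star
  | _ :: X => tens (Split.left (Split.allRight X)) var (tuple X)

/-- `let x₁ ⊗ … ⊗ xₙ ⊗ ⋆ = z in t`, as a term in the single variable `z`. Variables are
brought into position by abstraction and application. -/
def untuple : (X : Ctx S) → {C : Ty S.Base} → Tm X C → Tm [X.tensor] C
  | [], _, t => letStar (Split.left Split.nil) var t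
  | _ :: X, _, t =>
      letTens (Split.left Split.nil) var
        (app (Split.right (Split.left Split.nil)) (untuple X (lam t)) var)

/-- `let x₁ ⊗ … ⊗ xₙ ⊗ ⋆ = s in t`. -/
def letIn {X Y : Ctx S} {C : Ty S.Base} (s : Tm Y X.tensor) (t : Tm X C) : Tm Y C :=
  subst (Split.allLeft Y) s (untuple X t)

/-- The one-component tuple `t ⊗ ⋆`. -/
def single {X : Ctx S} {A : Ty S.Base} (t : Tm X A) : Tm X (Ctx.tensor [A]) :=
  tens (Split.allLeft X) t star

end Tm

open Split Tm in
/-- Provable equality of terms: the congruence generated by the `β`- and `η`-equations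
(the `η`-equations for `⋆` and `⊗` are stated for an arbitrary term in the eliminated
variable, and so contain the commuting conversions). -/
inductive TmEq {S : Signature.{u}} : {X : Ctx S} → {A : Ty S.Base} → Tm X A → Tm X A → Prop
  | refl {X : Ctx S} {A : Ty S.Base} (t : Tm X A) : TmEq t t
  | symm {X : Ctx S} {A : Ty S.Base} {t t' : Tm X A} : TmEq t t' → TmEq t' t
  | trans {X : Ctx S} {A : Ty S.Base} {t t' t'' : Tm X A} :
      TmEq t t' → TmEq t' t'' → TmEq t t''
  | op {X : Ctx S} (f : S.Fn) {t t' : Tm X (S.dom f)} :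
      TmEq t t' → TmEq (op f t) (op f t')
  | letStar {X Y Z : Ctx S} {C : Ty S.Base} (p : Split X Y Z) {s s' : Tm Y Ty.unit}
      {t t' : Tm Z C} : TmEq s s' → TmEq t t' → TmEq (letStar p s t) (letStar p s' t')
  | tens {X Y Z : Ctx S} {A B : Ty S.Base} (p : Split X Y Z) {s s' : Tm Y A}
      {t t' : Tm Z B} : TmEq s s' → TmEq t t' → TmEq (tens p s t) (tens p s' t')
  | letTens {X Y Z : Ctx S} {A B C : Ty S.Base} (p : Split X Y Z)
      {s s' : Tm Y (Ty.tensor A B)} {t t' : Tm (A :: B :: Z) C} :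
      TmEq s s' → TmEq t t' → TmEq (letTens p s t) (letTens p s' t')
  | lam {X : Ctx S} {A B : Ty S.Base} {t t' : Tm (A :: X) B} :
      TmEq t t' → TmEq (lam t) (lam t')
  | app {X Y Z : Ctx S} {A B : Ty S.Base} (p : Split X Y Z) {s s' : Tm Y (Ty.lolli A B)}
      {t t' : Tm Z A} : TmEq s s' → TmEq t t' → TmEq (app p s t) (app p s' t')
  | pair {X : Ctx S} {A B : Ty S.Base} {s s' : Tm X A} {t t' : Tm X B} :
      TmEq s s' → TmEq t t' → TmEq (pair s t) (pair s' t')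
  | fst {X : Ctx S} {A B : Ty S.Base} {t t' : Tm X (Ty.prod A B)} :
      TmEq t t' → TmEq (fst t) (fst t')
  | snd {X : Ctx S} {A B : Ty S.Base} {t t' : Tm X (Ty.prod A B)} :
      TmEq t t' → TmEq (snd t) (snd t')
  | star_beta {X : Ctx S} {C : Ty S.Base} (t : Tm X C) :
      TmEq (Tm.letStar (allRight X) star t) t
  | star_eta {X Y Z : Ctx S} {C : Ty S.Base} (p : Split X Y Z) (s : Tm Y Ty.unit)
      (t : Tm (Ty.unit :: Z) C) :
      TmEq (Tm.letStar p s (subst (allRight Z) star t)) (subst p s t)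
  | tens_beta {X Y Z U V : Ctx S} {A B C : Ty S.Base} (p : Split X Y Z) (q : Split Y U V)
      (a : Tm U A) (b : Tm V B) (t : Tm (A :: B :: Z) C) :
      TmEq (Tm.letTens p (Tm.tens q a b) t)
        (subst (assoc p q.symm).2.1 b
          (substAt a t (left (allRight (B :: Z))) (right (assoc p q.symm).2.2)))
  | tens_eta {X Y Z : Ctx S} {A B C : Ty S.Base} (p : Split X Y Z)
      (s : Tm Y (Ty.tensor A B)) (t : Tm (Ty.tensor A B :: Z) C) :
      TmEq (Tm.letTens p s
          (subst (left (left (allRight Z))) (Tm.tens (left (right nil)) var var) t))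
        (subst p s t)
  | lam_beta {X Y Z : Ctx S} {A B : Ty S.Base} (p : Split X Y Z) (t : Tm (A :: Y) B)
      (s : Tm Z A) : TmEq (Tm.app p (Tm.lam t) s) (subst p.symm s t)
  | lam_eta {X : Ctx S} {A B : Ty S.Base} (t : Tm X (Ty.lolli A B)) :
      TmEq (Tm.lam (Tm.app (right (allLeft X)) t var)) t
  | triv_eta {X : Ctx S} (t : Tm X Ty.one) : TmEq t triv
  | fst_beta {X : Ctx S} {A B : Ty S.Base} (s : Tm X A) (t : Tm X B) :
      TmEq (Tm.fst (Tm.pair s t)) s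
  | snd_beta {X : Ctx S} {A B : Ty S.Base} (s : Tm X A) (t : Tm X B) :
      TmEq (Tm.snd (Tm.pair s t)) t
  | pair_eta {X : Ctx S} {A B : Ty S.Base} (t : Tm X (Ty.prod A B)) :
      TmEq (Tm.pair (Tm.fst t) (Tm.snd t)) t

/-! ## Formulas and the sequent calculus -/

/-- Formulas in a linear context. Negation is Girard's: literals come in dual pairs. The body
of a quantifier over `A` in context `X` has one variable of type `A × (⊗ X)`: the quantified
variable is adjoined by a cartesian product. -/
inductive Formula {S : Signature.{u}} : Ctx S → Type u
  | atom {X : Ctx S} (R : S.Pred) : Tm X (S.arity R) → Formula X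
  | natom {X : Ctx S} (R : S.Pred) : Tm X (S.arity R) → Formula X
  | top {X : Ctx S} : Formula X
  | bot {X : Ctx S} : Formula X
  | and {X : Ctx S} : Formula X → Formula X → Formula X
  | or {X : Ctx S} : Formula X → Formula X → Formula X
  | all {X : Ctx S} (A : Ty S.Base) : Formula [Ty.prod A X.tensor] → Formula X
  | ex {X : Ctx S} (A : Ty S.Base) : Formula [Ty.prod A X.tensor] → Formula X

namespace Formula

variable {S : Signature.{u}}

/-- The involutive negation, by De Morgan duality. -/
def neg : {X : Ctx S} → Formula X → Formula X
  | _, atom R t => natom R t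
  | _, natom R t => atom R t
  | _, top => bot
  | _, bot => top
  | _, and φ ψ => or (neg φ) (neg ψ)
  | _, or φ ψ => and (neg φ) (neg ψ)
  | _, all A φ => ex A (neg φ)
  | _, ex A φ => all A (neg φ)

/-- The substitution acting under a quantifier: `⟨z.1, let x₁ ⊗ … ⊗ xₙ ⊗ ⋆ = z.2 in s⟩`. -/
def lift {X Y : Ctx S} (A : Ty S.Base) (s : Tm Y X.tensor) :
    Tm [Ty.prod A Y.tensor] (Ctx.tensor [Ty.prod A X.tensor]) :=
  Tm.single (Tm.pair (Tm.fst Tm.var) (Tm.letIn (Tm.snd Tm.var) s))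

/-- Substitution `let x₁ ⊗ … ⊗ xₙ ⊗ ⋆ = s in φ`. -/
def subst : {X Y : Ctx S} → Tm Y X.tensor → Formula X → Formula Y
  | _, _, s, atom R t => atom R (Tm.letIn s t)
  | _, _, s, natom R t => natom R (Tm.letIn s t)
  | _, _, _, top => top
  | _, _, _, bot => bot
  | _, _, s, and φ ψ => and (subst s φ) (subst s ψ)
  | _, _, s, or φ ψ => or (subst s φ) (subst s ψ)
  | _, _, s, all A φ => all A (subst (lift A s) φ)
  | _, _, s, ex A φ => ex A (subst (lift A s) φ)

/-- Adjoining a fresh variable of type `A`. -/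
def weaken {X : Ctx S} (A : Ty S.Base) (φ : Formula X) : Formula [Ty.prod A X.tensor] :=
  subst (Tm.snd Tm.var) φ

/-- Instantiating the adjoined variable by a term. -/
def inst {X : Ctx S} {A : Ty S.Base} (φ : Formula [Ty.prod A X.tensor]) (t : Tm X A) :
    Formula X :=
  subst (Tm.single (Tm.pair t (Tm.tuple X))) φ

end Formula

/-- A sequent-in-context `Γ ⊢ Δ [X]`. -/
structure Sequent (S : Signature.{u}) where
  ctx : Ctx S
  ant : Multiset (Formula ctx)
  suc : Multiset (Formula ctx)

/-- The two propositional quantum logics of Faggian and Sambin: basic orthologic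
(paraconsistent quantum logic) and orthologic. -/
inductive QuantumLogic
  | basic
  | ortho

/-- Derivability in the linearly typed quantum sequent calculus from a set `T` of axioms.
Active formulas are visible: on their side of a sequent they stand without a context. -/
inductive Derivable {S : Signature.{u}} (L : QuantumLogic) (T : Set (Sequent S)) :
    (X : Ctx S) → Multiset (Formula X) → Multiset (Formula X) → Prop
  | hyp {s : Sequent S} : s ∈ T → Derivable L T s.ctx s.ant s.suc
  | ax {X : Ctx S} (φ : Formula X) : Derivable L T X {φ} {φ}
  | cutL {X : Ctx S} {Γ Γ' Δ : Multiset (Formula X)} {φ : Formula X} :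
      Derivable L T X Γ {φ} → Derivable L T X (φ ::ₘ Γ') Δ → Derivable L T X (Γ + Γ') Δ
  | cutR {X : Ctx S} {Γ Δ Δ' : Multiset (Formula X)} {φ : Formula X} :
      Derivable L T X Γ (φ ::ₘ Δ') → Derivable L T X {φ} Δ → Derivable L T X Γ (Δ + Δ')
  | weakL {X : Ctx S} {Γ Δ : Multiset (Formula X)} (φ : Formula X) :
      Derivable L T X Γ Δ → Derivable L T X (φ ::ₘ Γ) Δ
  | weakR {X : Ctx S} {Γ Δ : Multiset (Formula X)} (φ : Formula X) :
      Derivable L T X Γ Δ → Derivable L T X Γ (φ ::ₘ Δ)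
  | contrL {X : Ctx S} {Γ Δ : Multiset (Formula X)} {φ : Formula X} :
      Derivable L T X (φ ::ₘ φ ::ₘ Γ) Δ → Derivable L T X (φ ::ₘ Γ) Δ
  | contrR {X : Ctx S} {Γ Δ : Multiset (Formula X)} {φ : Formula X} :
      Derivable L T X Γ (φ ::ₘ φ ::ₘ Δ) → Derivable L T X Γ (φ ::ₘ Δ)
  | topR {X : Ctx S} (Γ : Multiset (Formula X)) : Derivable L T X Γ {Formula.top}
  | botL {X : Ctx S} (Δ : Multiset (Formula X)) : Derivable L T X {Formula.bot} Δ
  | andL₁ {X : Ctx S} {Δ : Multiset (Formula X)} {φ ψ : Formula X} :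
      Derivable L T X {φ} Δ → Derivable L T X {Formula.and φ ψ} Δ
  | andL₂ {X : Ctx S} {Δ : Multiset (Formula X)} {φ ψ : Formula X} :
      Derivable L T X {ψ} Δ → Derivable L T X {Formula.and φ ψ} Δ
  | andR {X : Ctx S} {Γ : Multiset (Formula X)} {φ ψ : Formula X} :
      Derivable L T X Γ {φ} → Derivable L T X Γ {ψ} → Derivable L T X Γ {Formula.and φ ψ}
  | orL {X : Ctx S} {Δ : Multiset (Formula X)} {φ ψ : Formula X} :
      Derivable L T X {φ} Δ → Derivable L T X {ψ} Δ → Derivable L T X {Formula.or φ ψ} Δ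
  | orR₁ {X : Ctx S} {Γ : Multiset (Formula X)} {φ ψ : Formula X} :
      Derivable L T X Γ {φ} → Derivable L T X Γ {Formula.or φ ψ}
  | orR₂ {X : Ctx S} {Γ : Multiset (Formula X)} {φ ψ : Formula X} :
      Derivable L T X Γ {ψ} → Derivable L T X Γ {Formula.or φ ψ}
  | allL {X : Ctx S} {Δ : Multiset (Formula X)} {A : Ty S.Base}
      {φ : Formula [Ty.prod A X.tensor]} (t : Tm X A) :
      Derivable L T X {φ.inst t} Δ → Derivable L T X {Formula.all A φ} Δ
  | allR {X : Ctx S} {Γ : Multiset (Formula X)} {A : Ty S.Base}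
      {φ : Formula [Ty.prod A X.tensor]} :
      Derivable L T [Ty.prod A X.tensor] (Γ.map (Formula.weaken A)) {φ} →
      Derivable L T X Γ {Formula.all A φ}
  | exL {X : Ctx S} {Δ : Multiset (Formula X)} {A : Ty S.Base}
      {φ : Formula [Ty.prod A X.tensor]} :
      Derivable L T [Ty.prod A X.tensor] {φ} (Δ.map (Formula.weaken A)) →
      Derivable L T X {Formula.ex A φ} Δ
  | exR {X : Ctx S} {Γ : Multiset (Formula X)} {A : Ty S.Base}
      {φ : Formula [Ty.prod A X.tensor]} (t : Tm X A) :
      Derivable L T X Γ {φ.inst t} → Derivable L T X Γ {Formula.ex A φ}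
  /-- Duality. This is admissible when there are no axioms. -/
  | dual {X : Ctx S} {Γ Δ : Multiset (Formula X)} :
      Derivable L T X Γ Δ → Derivable L T X (Δ.map Formula.neg) (Γ.map Formula.neg)
  /-- Transfer to the left, for orthologic only. -/
  | transL {X : Ctx S} {Γ Δ : Multiset (Formula X)} : L = QuantumLogic.ortho →
      Derivable L T X Γ Δ → Derivable L T X (Γ + Δ.map Formula.neg) 0
  /-- Transfer to the right, for orthologic only. -/
  | transR {X : Ctx S} {Γ Δ : Multiset (Formula X)} : L = QuantumLogic.ortho →
      Derivable L T X Γ Δ → Derivable L T X 0 (Γ.map Formula.neg + Δ)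
  /-- Substitution of terms for variables. -/
  | subst {X Y : Ctx S} {Γ Δ : Multiset (Formula X)} (s : Tm Y X.tensor) :
      Derivable L T X Γ Δ →
      Derivable L T Y (Γ.map (Formula.subst s)) (Δ.map (Formula.subst s))
  /-- Replacement of a term by a provably equal one. -/
  | eq {X : Ctx S} (R : S.Pred) {s t : Tm X (S.arity R)} :
      TmEq s t → Derivable L T X {Formula.atom R s} {Formula.atom R t}

/-! ## Algebras of quantum logic -/

/-- Algebras of the propositional quantum logic: bounded lattices with an antitone involution,
which is an orthocomplementation in the case of orthologic. -/
class QLAlgebra (L : QuantumLogic) (α : Type z) extends Lattice α, BoundedOrder α, Compl α where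
  compl_involutive (a : α) : aᶜᶜ = a
  compl_antitone (a b : α) : a ≤ b → bᶜ ≤ aᶜ
  inf_compl_le (a : α) : L = QuantumLogic.ortho → a ⊓ aᶜ ≤ ⊥

/-- Homomorphisms of algebras preserve all operations. -/
@[ext]
structure QLHom (L : QuantumLogic) (α β : Type z) [QLAlgebra L α] [QLAlgebra L β] where
  toFun : α → β
  map_inf (a b : α) : toFun (a ⊓ b) = toFun a ⊓ toFun b
  map_sup (a b : α) : toFun (a ⊔ b) = toFun a ⊔ toFun b
  map_top : toFun ⊤ = ⊤
  map_bot : toFun ⊥ = ⊥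
  map_compl (a : α) : toFun aᶜ = (toFun a)ᶜ

/-- The category of algebras of the quantum logic. -/
structure QL (L : QuantumLogic) : Type (z + 1) where
  carrier : Type z
  [str : QLAlgebra L carrier]

attribute [instance] QL.str

instance (L : QuantumLogic) : Category (QL.{z} L) where
  Hom A B := QLHom L A.carrier B.carrier
  id A :=
    { toFun := fun a => a
      map_inf := fun _ _ => rfl
      map_sup := fun _ _ => rfl
      map_top := rfl
      map_bot := rfl
      map_compl := fun _ => rfl }
  comp f g :=
    { toFun := fun a => g.toFun (f.toFun a)
      map_inf := fun a b => by rw [f.map_inf, g.map_inf]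
      map_sup := fun a b => by rw [f.map_sup, g.map_sup]
      map_top := by rw [f.map_top, g.map_top]
      map_bot := by rw [f.map_bot, g.map_bot]
      map_compl := fun a => by rw [f.map_compl, g.map_compl] }

/-! ## Hyperdoctrines -/

/-- A choice of finite products in a category (next to a possibly different monoidal
structure). -/
class FiniteProducts (C : Type v) [Category.{w} C] where
  terminalCone : LimitCone (Functor.empty.{0} C)
  binaryCone (X Y : C) : LimitCone (pair X Y)

namespace FiniteProducts

variable {C : Type v} [Category.{w} C] [FiniteProducts C]

variable (C) in
def one : C := (terminalCone (C := C)).cone.pt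

def toOne (X : C) : X ⟶ one C :=
  (terminalCone (C := C)).isLimit.lift (asEmptyCone X)

def prod (X Y : C) : C := (binaryCone X Y).cone.pt

def fst (X Y : C) : prod X Y ⟶ X := BinaryFan.fst (binaryCone X Y).cone

def snd (X Y : C) : prod X Y ⟶ Y := BinaryFan.snd (binaryCone X Y).cone

def lift {X Y Z : C} (f : Z ⟶ X) (g : Z ⟶ Y) : Z ⟶ prod X Y :=
  (binaryCone X Y).isLimit.lift (BinaryFan.mk f g)

/-- The arrow `X × f`. -/
def mapRight (X : C) {Y Z : C} (f : Z ⟶ Y) : prod X Z ⟶ prod X Y :=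
  lift (fst X Z) (snd X Z ≫ f)

end FiniteProducts

/-- Quantified hyperdoctrines with values in algebras of the quantum logic: pullback along
each projection has both adjoints, and these satisfy the Beck-Chevalley condition. -/
structure Hyperdoctrine (L : QuantumLogic) (C : Type v) [Category.{w} C]
    [FiniteProducts C] where
  P : Cᵒᵖ ⥤ QL.{z} L
  all (X Y : C) : (P.obj (op (FiniteProducts.prod X Y))).carrier → (P.obj (op Y)).carrier
  ex (X Y : C) : (P.obj (op (FiniteProducts.prod X Y))).carrier → (P.obj (op Y)).carrier
  all_adjoint (X Y : C) :
    GaloisConnection (P.map (FiniteProducts.snd X Y).op).toFun (all X Y)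
  ex_adjoint (X Y : C) :
    GaloisConnection (ex X Y) (P.map (FiniteProducts.snd X Y).op).toFun
  all_beckChevalley (X : C) {Y Z : C} (f : Z ⟶ Y)
    (a : (P.obj (op (FiniteProducts.prod X Y))).carrier) :
    (P.map f.op).toFun (all X Y a) =
      all X Z ((P.map (FiniteProducts.mapRight X f).op).toFun a)
  ex_beckChevalley (X : C) {Y Z : C} (f : Z ⟶ Y)
    (a : (P.obj (op (FiniteProducts.prod X Y))).carrier) :
    (P.map f.op).toFun (ex X Y a) =
      ex X Z ((P.map (FiniteProducts.mapRight X f).op).toFun a)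

/-! ## Interpretation -/

section Interpretation

variable {C : Type v} [Category.{w} C] [MonoidalCategory C] [SymmetricCategory C]
  [MonoidalClosed C] [FiniteProducts C]

/-- The object interpreting a type, given an interpretation of the base types. -/
def Ty.obj {B : Type u} (b : B → C) : Ty B → C
  | .base a => b a
  | .unit => 𝟙_ C
  | .tensor A A' => Ty.obj b A ⊗ Ty.obj b A'
  | .lolli A A' => (ihom (Ty.obj b A)).obj (Ty.obj b A')
  | .one => FiniteProducts.one C
  | .prod A A' => FiniteProducts.prod (Ty.obj b A) (Ty.obj b A')

/-- An interpretation of a signature in a hyperdoctrine. -/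
structure Interpretation (S : Signature.{u}) {L : QuantumLogic}
    (H : Hyperdoctrine.{v, w, z} L C) where
  base : S.Base → C
  fn (f : S.Fn) : (S.dom f).obj base ⟶ (S.cod f).obj base
  pred (R : S.Pred) : (H.P.obj (op ((S.arity R).obj base))).carrier

namespace Interpretation

variable {S : Signature.{u}} {L : QuantumLogic} {H : Hyperdoctrine.{v, w, z} L C}
  (M : Interpretation S H)

/-- A linear context is interpreted by the tensor product of its types. -/
def ctx (X : Ctx S) : C := X.tensor.obj M.base

/-- A splitting of a context is interpreted by the canonical symmetry. -/
def split : {X Y Z : Ctx S} → Split X Y Z → (M.ctx X ⟶ M.ctx Y ⊗ M.ctx Z)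
  | _, _, _, .nil => (λ_ (𝟙_ C)).inv
  | _, _, _, .left (A := A) (Y := Y) (Z := Z) p =>
      A.obj M.base ◁ split p ≫ (α_ (A.obj M.base) (M.ctx Y) (M.ctx Z)).inv
  | _, _, _, .right (A := A) (Y := Y) (Z := Z) p =>
      A.obj M.base ◁ split p ≫ (α_ (A.obj M.base) (M.ctx Y) (M.ctx Z)).inv ≫
        (β_ (A.obj M.base) (M.ctx Y)).hom ▷ M.ctx Z ≫
          (α_ (M.ctx Y) (A.obj M.base) (M.ctx Z)).hom

def tm : {X : Ctx S} → {A : Ty S.Base} → Tm X A → (M.ctx X ⟶ A.obj M.base)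
  | _, _, .var (A := A) => (ρ_ (A.obj M.base)).hom
  | _, _, .op f t => tm t ≫ M.fn f
  | _, _, .star => 𝟙 (𝟙_ C)
  | _, _, .letStar (Z := Z) p s t =>
      M.split p ≫ tm s ▷ M.ctx Z ≫ (λ_ (M.ctx Z)).hom ≫ tm t
  | _, _, .tens p s t => M.split p ≫ (tm s ⊗ₘ tm t)
  | _, _, .letTens (Z := Z) (A := A) (B := B) p s t =>
      M.split p ≫ tm s ▷ M.ctx Z ≫
        (α_ (A.obj M.base) (B.obj M.base) (M.ctx Z)).hom ≫ tm t
  | X, _, .lam (A := A) t =>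
      MonoidalClosed.curry (A := A.obj M.base) (Y := M.ctx X) (tm t)
  | _, _, .app (A := A) (B := B) p s t =>
      M.split p ≫ (tm s ⊗ₘ tm t) ≫
        (β_ ((ihom (A.obj M.base)).obj (B.obj M.base)) (A.obj M.base)).hom ≫
          (ihom.ev (A.obj M.base)).app (B.obj M.base)
  | X, _, .triv => FiniteProducts.toOne (M.ctx X)
  | _, _, .pair s t => FiniteProducts.lift (tm s) (tm t)
  | _, _, .fst (A := A) (B := B) t =>
      tm t ≫ FiniteProducts.fst (A.obj M.base) (B.obj M.base)
  | _, _, .snd (A := A) (B := B) t =>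
      tm t ≫ FiniteProducts.snd (A.obj M.base) (B.obj M.base)

/-- Formulas in context `X` are interpreted in the fibre over the interpretation of `X`. The
right unitor identifies the interpretations of the type `A` and of the context `[A]`. -/
def formula : {X : Ctx S} → Formula X → (H.P.obj (op (M.ctx X))).carrier
  | _, .atom R t => (H.P.map (M.tm t).op).toFun (M.pred R)
  | _, .natom R t => ((H.P.map (M.tm t).op).toFun (M.pred R))ᶜ
  | _, .top => ⊤
  | _, .bot => ⊥
  | _, .and φ ψ => formula φ ⊓ formula ψ
  | _, .or φ ψ => formula φ ⊔ formula ψ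
  | X, .all A φ =>
      H.all (A.obj M.base) (M.ctx X)
        ((H.P.map (ρ_ (FiniteProducts.prod (A.obj M.base) (M.ctx X))).inv.op).toFun
          (formula φ))
  | X, .ex A φ =>
      H.ex (A.obj M.base) (M.ctx X)
        ((H.P.map (ρ_ (FiniteProducts.prod (A.obj M.base) (M.ctx X))).inv.op).toFun
          (formula φ))

/-- A sequent holds when the meet of its left side is below the join of its right side. -/
def Satisfies (s : Sequent S) : Prop :=
  (s.ant.map M.formula).inf ≤ (s.suc.map M.formula).sup

end Interpretation

end Interpretation

end LFSq

/-! Soundness is an induction on derivations, and its substance is that substitution is composition.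
A splitting of a context denotes a coherence isomorphism of the symmetric monoidal category
(`split_isIso`), and the combinatorial reassociation of splittings denotes the associator
(`split_assoc`). Hence substituting `s` for one variable denotes precomposition with an arrow built
from `s` (`tm_substAt`). This gives the β- and η-equations (`tm_eq_of_tmEq`) and shows that
simultaneous substitution is plain composition (`tm_letIn`). For formulas, Beck–Chevalley carries
reindexing through the quantifiers (`formula_subst`). The involution exchanges the two adjoints, so
De Morgan negation is the complement (`formula_neg`). The quantifier rules are then the adjunctions.

Completeness uses a term model. Objects of `SynCat` are types, and arrows `A ⟶ B` are closed terms
of type `A ⊸ B` up to provable equality. The η-equations make such a function determined by its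
value on generic variables or tensors, iterated to any nesting. On such tensors the structural maps
merely permute a splitting, so every coherence law becomes an identity between explicit splittings.
The fibre over `A` is the Lindenbaum algebra of formulas in one variable of type `A`. The quantifier
rules give adjoints to weakening, and Beck–Chevalley holds because substitution commutes with
quantifiers by definition.

Two mismatches have to be bridged. The calculus works in contexts of any length and with multisets.
A context is replaced by its tensor product (`closure` for terms, `contract` for formulas), and a
sequent by a single inequality between a conjunction and a disjunction (`derivable_iff`), using cuts
because active formulas must stand alone. Secondly, a type interprets itself in the term model only
up to a propositional equality proved by induction, so the final comparison is made with
heterogeneous equality (`tm_heq`, `formula_heq`). The canonical interpretation then satisfies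
exactly the sequents derivable from `T` (`satisfies_iff`). It is in particular a model of `T`, and
completeness is read off from it. -/

namespace LFSq

/-! ### Combinatorics of context splittings -/

namespace Split

variable {S : Signature.{u}}

@[simp]
theorem symm_symm : {X Y Z : Ctx S} → (p : Split X Y Z) → p.symm.symm = p
  | _, _, _, nil => rfl
  | _, _, _, left p => by simp only [symm, symm_symm p]
  | _, _, _, right p => by simp only [symm, symm_symm p]

@[simp]
theorem symm_allLeft : (X : Ctx S) → (allLeft X).symm = allRight X
  | [] => rfl
  | _ :: X => by simp only [symm, allLeft, allRight, symm_allLeft X]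

@[simp]
theorem symm_allRight : (X : Ctx S) → (allRight X).symm = allLeft X
  | [] => rfl
  | _ :: X => by simp only [symm, allLeft, allRight, symm_allRight X]

theorem eq_allLeft {X : Ctx S} : (p : Split X X []) → p = allLeft X := by
  -- The repeated index blocks case analysis on `p`; it is separated into two contexts joined by an
  -- equation.
  suffices h : ∀ {X Y : Ctx S} (p : Split X Y []) (e : X = Y), e ▸ p = allLeft Y from
    fun p => h p rfl
  intro X
  induction X with
  | nil => intro Y p e; subst e; cases p; rfl
  | cons A X ih =>
    intro Y p e
    subst e
    cases p with
    | left p => simp only [allLeft]; rw [← ih p rfl]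

theorem assoc_allLeft : {X U V : Ctx S} → (q : Split X U V) →
    assoc (allLeft X) q = ⟨V, q, allLeft V⟩
  | _, _, _, nil => rfl
  | _, _, _, left q => by simp only [assoc, allLeft]; rw [assoc_allLeft q]
  | _, _, _, right q => by simp only [assoc, allLeft]; rw [assoc_allLeft q]

theorem assoc_allLeft_right : {X Y Z : Ctx S} → (p : Split X Y Z) →
    assoc p (allLeft Y) = ⟨Z, p, allRight Z⟩
  | _, _, _, nil => rfl
  | _, _, _, left p => by simp only [assoc, allLeft]; rw [assoc_allLeft_right p]
  | _, _, _, right p => by simp only [assoc, allRight]; rw [assoc_allLeft_right p]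

theorem assoc_allRight_right : {X Y Z : Ctx S} → (p : Split X Y Z) →
    assoc p (allRight Y) = ⟨X, allRight X, p⟩
  | _, _, _, nil => rfl
  | _, _, _, left p => by simp only [assoc, allRight]; rw [assoc_allRight_right p]
  | _, _, _, right p => by simp only [assoc, allRight]; rw [assoc_allRight_right p]

theorem unassoc_symm {X U R V W : Ctx S} (p : Split X R U) (q : Split R W V) :
    unassoc p.symm q.symm = ⟨(assoc p q).1, (assoc p q).2.1.symm, (assoc p q).2.2.symm⟩ := by
  rw [unassoc, symm_symm, symm_symm]

theorem unassoc_eq {X U R V W : Ctx S} (p : Split X U R) (q : Split R V W) :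
    unassoc p q = ⟨(assoc p.symm q.symm).1, (assoc p.symm q.symm).2.1.symm,
      (assoc p.symm q.symm).2.2.symm⟩ := rfl

@[simp]
theorem unassoc_allLeft {X V W : Ctx S} (p : Split X V W) :
    unassoc p (allLeft W) = ⟨X, allLeft X, p⟩ := by
  rw [unassoc_eq, symm_allLeft, assoc_allRight_right, symm_allRight, symm_symm]

@[simp]
theorem unassoc_allRight {X V W : Ctx S} (p : Split X V W) :
    unassoc p (allRight W) = ⟨V, p, allLeft V⟩ := by
  rw [unassoc_eq, symm_allRight, assoc_allLeft_right, symm_allRight, symm_symm]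

@[simp]
theorem unassoc_allRight_left {X V W : Ctx S} (p : Split X V W) :
    unassoc (allRight X) p = ⟨V, p, allRight V⟩ := by
  rw [unassoc_eq, symm_allRight, assoc_allLeft, symm_allLeft, symm_symm]

theorem unassoc_nil (X : Ctx S) : unassoc (allLeft X) nil = ⟨X, allLeft X, allLeft X⟩ :=
  unassoc_allRight (allLeft X)

@[simp]
theorem unassoc_left {X U R V W : Ctx S} {A : Ty S.Base} (p : Split X U R)
    (q : Split R V W) : unassoc (left (A := A) p) q =
      ⟨A :: (unassoc p q).1, left (unassoc p q).2.1, left (unassoc p q).2.2⟩ := rfl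

@[simp]
theorem unassoc_right_left {X U R V W : Ctx S} {A : Ty S.Base} (p : Split X U R)
    (q : Split R V W) : unassoc (right (A := A) p) (left q) =
      ⟨A :: (unassoc p q).1, left (unassoc p q).2.1, right (unassoc p q).2.2⟩ := rfl

@[simp]
theorem unassoc_right_right {X U R V W : Ctx S} {A : Ty S.Base} (p : Split X U R)
    (q : Split R V W) : unassoc (right (A := A) p) (right q) =
      ⟨(unassoc p q).1, right (unassoc p q).2.1, (unassoc p q).2.2⟩ := rfl

theorem unassoc_assoc : {X Y Z U V : Ctx S} → (p : Split X Y Z) → (q : Split Y U V) →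
    unassoc (assoc p q).2.1 (assoc p q).2.2 = ⟨Y, p, q⟩
  | _, _, _, _, _, nil, nil => rfl
  | _, _, _, _, _, left p, left q => by
      change unassoc (left (assoc p q).2.1) (assoc p q).2.2 = _
      rw [unassoc_left, unassoc_assoc p q]
  | _, _, _, _, _, left p, right q => by
      change unassoc (right (assoc p q).2.1) (left (assoc p q).2.2) = _
      rw [unassoc_right_left, unassoc_assoc p q]
  | _, _, _, _, _, right p, q => by simp only [assoc, unassoc_right_right]; rw [unassoc_assoc p q]

/-- The specification of `locate`: refining `m` by the position found in one half, and
reassociating, gives back the original position `p` together with the induced splitting of the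
remaining variables. Every case of substitution into a former that splits its context rests on this.
For the right half the splitting is first mirrored by `symm`. -/
theorem locate_spec {A : Ty S.Base} : {D R Y Z : Ctx S} → (p : Split D [A] R) →
    (m : Split D Y Z) →
    (match locate p m with
      | Sum.inl r => assoc m r.2.1 = ⟨R, p, r.2.2⟩
      | Sum.inr r => assoc m.symm r.2.1 = ⟨R, p, r.2.2.symm⟩)
  | _, _, _, _, left p, left q => by
      obtain rfl := eq_of_nil_right p.symm
      obtain rfl : p = allRight _ := by
        rw [← symm_symm p, eq_allLeft p.symm, symm_allLeft]
      simp only [locate, assoc]; rw [assoc_allRight_right]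
  | _, _, _, _, left p, right q => by
      obtain rfl := eq_of_nil_right p.symm
      obtain rfl : p = allRight _ := by
        rw [← symm_symm p, eq_allLeft p.symm, symm_allLeft]
      simp only [locate, assoc, symm]; rw [assoc_allRight_right]
  | _, _, _, _, right p, left q => by
      have h := locate_spec p q
      simp only [locate]
      cases e : locate p q with
      | inl r => rw [e] at h; simp only at h ⊢; simp only [assoc]; rw [h]
      | inr r => rw [e] at h; simp only at h ⊢; simp only [assoc, symm]; rw [h]
  | _, _, _, _, right p, right q => by
      have h := locate_spec p q
      simp only [locate]
      cases e : locate p q with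
      | inl r => rw [e] at h; simp only at h ⊢; simp only [assoc]; rw [h]
      | inr r => rw [e] at h; simp only at h ⊢; simp only [assoc, symm]; rw [h]

theorem assoc_of_locate_inl {A : Ty S.Base} {D R Y Z : Ctx S} {p : Split D [A] R}
    {m : Split D Y Z} {r} (h : locate p m = Sum.inl r) :
    assoc m r.2.1 = ⟨R, p, r.2.2⟩ := by
  have := locate_spec p m
  rwa [h] at this

theorem assoc_of_locate_inr {A : Ty S.Base} {D R Y Z : Ctx S} {p : Split D [A] R}
    {m : Split D Y Z} {r} (h : locate p m = Sum.inr r) :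
    assoc m.symm r.2.1 = ⟨R, p, r.2.2.symm⟩ := by
  have := locate_spec p m
  rwa [h] at this

@[simp]
theorem locate_left_left {A : Ty S.Base} {X Y Z : Ctx S} (q : Split X Y Z) :
    locate (left (A := A) (allRight X)) (left q) = Sum.inl ⟨_, left (allRight _), q⟩ := by
  simp only [locate]

@[simp]
theorem locate_left_right {A : Ty S.Base} {X Y Z : Ctx S} (q : Split X Y Z) :
    locate (left (A := A) (allRight X)) (right q) = Sum.inr ⟨_, left (allRight _), q⟩ := by
  simp only [locate]

@[simp]
theorem locate_allRight {A : Ty S.Base} : {D R : Ctx S} → (p : Split D [A] R) →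
    locate p (allRight D) = Sum.inr ⟨R, p, allRight R⟩
  | _, _, left p => by
      obtain rfl := eq_of_nil_right p.symm
      obtain rfl : p = allRight _ := by
        rw [← symm_symm p, eq_allLeft p.symm, symm_allLeft]
      simp only [locate, allRight]
  | _, _, right p => by simp only [locate, allRight]; rw [locate_allRight p]

/-- With `unassoc_assoc`, this makes reassociation a bijection, so splittings can be regrouped in
either direction without loss. -/
theorem assoc_unassoc : {X U R V W : Ctx S} → (p : Split X U R) → (q : Split R V W) →
    assoc (unassoc p q).2.1 (unassoc p q).2.2 = ⟨R, p, q⟩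
  | _, _, _, _, _, nil, nil => rfl
  | _, _, _, _, _, left p, q => by
      change assoc (left (unassoc p q).2.1) (left (unassoc p q).2.2) = _
      simp only [assoc]; rw [assoc_unassoc p q]
  | _, _, _, _, _, right p, left q => by
      change assoc (left (unassoc p q).2.1) (right (unassoc p q).2.2) = _
      simp only [assoc]; rw [assoc_unassoc p q]
  | _, _, _, _, _, right p, right q => by
      change assoc (right (unassoc p q).2.1) (unassoc p q).2.2 = _
      simp only [assoc]; rw [assoc_unassoc p q]

end Split

end LFSq

namespace LFSq

/-! ### Splittings as coherence isomorphisms -/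

section Shuffle

variable {C : Type v} [Category.{w} C] [MonoidalCategory C]

/-- Adjoining a tensor factor to the left part of a splitting. -/
def consLeft (A : C) {X Y Z : C} (p : X ⟶ Y ⊗ Z) : A ⊗ X ⟶ (A ⊗ Y) ⊗ Z :=
  A ◁ p ≫ (α_ A Y Z).inv

/-- This lemma, `consLeft_consRight` and `consRight_left` are the inductive steps of `split_assoc`,
one for each recursive clause of `Split.assoc`, according to which of the three parts receives the
new variable. -/
theorem consLeft_consLeft {A X Y Z U V W : C} {p : X ⟶ Y ⊗ Z} {q : Y ⟶ U ⊗ V}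
    {r : X ⟶ U ⊗ W} {s : W ⟶ V ⊗ Z} (h : p ≫ q ▷ Z ≫ (α_ U V Z).hom = r ≫ U ◁ s) :
    consLeft A p ≫ consLeft A q ▷ Z ≫ (α_ (A ⊗ U) V Z).hom = consLeft A r ≫ (A ⊗ U) ◁ s := by
  trans A ◁ (r ≫ U ◁ s) ≫ (α_ A U (V ⊗ Z)).inv
  · rw [← h, consLeft, consLeft]; monoidal
  · rw [consLeft]; monoidal

theorem consLeft_isIso {A X Y Z : C} (p : X ⟶ Y ⊗ Z) [IsIso p] : IsIso (consLeft A p) := by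
  unfold consLeft; infer_instance

/-- Substituting for a variable and then splitting is the same as splitting and then substituting in
the half that contains the variable. Solving `h` for `m` cancels `p`; the interchange law moves `f`
past `r`; `k` then regroups the source. -/
theorem shuffle_subst {D Y Q R X Y' D₁ D₂ A : C} {q : X ⟶ Y ⊗ R} {p : D ⟶ A ⊗ R} [IsIso p]
    {m : D ⟶ D₁ ⊗ D₂} {p' : D₁ ⟶ A ⊗ Q} [IsIso p'] {r : R ⟶ Q ⊗ D₂} {k₁ : X ⟶ Y' ⊗ D₂}
    {k₂ : Y' ⟶ Y ⊗ Q} (f : Y ⟶ A)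
    (h : m ≫ p' ▷ D₂ ≫ (α_ A Q D₂).hom = p ≫ A ◁ r)
    (k : k₁ ≫ k₂ ▷ D₂ ≫ (α_ Y Q D₂).hom = q ≫ Y ◁ r) :
    (q ≫ f ▷ R ≫ inv p) ≫ m = k₁ ≫ (k₂ ≫ f ▷ Q ≫ inv p') ▷ D₂ := by
  have h' : m = p ≫ A ◁ r ≫ (α_ A Q D₂).inv ≫ inv p' ▷ D₂ := by
    rw [← reassoc_of% h]; simp
  have k' : q ≫ Y ◁ r ≫ (α_ Y Q D₂).inv = k₁ ≫ k₂ ▷ D₂ := by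
    rw [← reassoc_of% k]; simp
  rw [h']
  simp only [Category.assoc, IsIso.inv_hom_id_assoc, ← whisker_exchange_assoc,
    comp_whiskerRight]
  rw [← reassoc_of% k']
  simp

variable [SymmetricCategory C]

/-- Adjoining a tensor factor to the right part of a splitting. -/
def consRight (A : C) {X Y Z : C} (p : X ⟶ Y ⊗ Z) : A ⊗ X ⟶ Y ⊗ (A ⊗ Z) :=
  A ◁ p ≫ (α_ A Y Z).inv ≫ (β_ A Y).hom ▷ Z ≫ (α_ Y A Z).hom

variable {A X Y Z U V W : C}

theorem consLeft_symm (p : X ⟶ Y ⊗ Z) :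
    consRight A (p ≫ (β_ Y Z).hom) = consLeft A p ≫ (β_ (A ⊗ Y) Z).hom := by
  rw [BraidedCategory.braiding_tensor_left_hom]
  simp [consLeft, consRight]

theorem consRight_symm (p : X ⟶ Y ⊗ Z) :
    consLeft A (p ≫ (β_ Y Z).hom) = consRight A p ≫ (β_ Y (A ⊗ Z)).hom := by
  rw [BraidedCategory.braiding_tensor_right_hom]
  simp only [consLeft, consRight, Category.assoc, Iso.hom_inv_id_assoc]
  rw [← comp_whiskerRight_assoc, SymmetricCategory.symmetry]
  simp

theorem consLeft_consRight {p : X ⟶ Y ⊗ Z} {q : Y ⟶ U ⊗ V} {r : X ⟶ U ⊗ W} {s : W ⟶ V ⊗ Z}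
    (h : p ≫ q ▷ Z ≫ (α_ U V Z).hom = r ≫ U ◁ s) :
    consLeft A p ≫ consRight A q ▷ Z ≫ (α_ U (A ⊗ V) Z).hom =
      consRight A r ≫ U ◁ consLeft A s := by
  trans A ◁ (r ≫ U ◁ s) ≫ (α_ A U (V ⊗ Z)).inv ≫ (β_ A U).hom ▷ (V ⊗ Z) ≫
    (α_ U A (V ⊗ Z)).hom ≫ U ◁ (α_ A V Z).inv
  · rw [← h, consLeft, consRight]; monoidal
  · trans A ◁ r ≫ (α_ _ _ _).inv ≫ ((β_ A U).hom ▷ W ≫ (U ⊗ A) ◁ s) ≫ (α_ _ _ _).hom ≫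
      U ◁ (α_ A V Z).inv
    · rw [← whisker_exchange]; monoidal
    · rw [consLeft, consRight]; monoidal

/-- Here the new variable must pass the whole left part, which is itself split by `q`. Naturality of
the braiding moves it past `q`, and the hexagon decomposes the passage past `U ⊗ V`. -/
theorem consRight_left {p : X ⟶ Y ⊗ Z} {q : Y ⟶ U ⊗ V} {r : X ⟶ U ⊗ W} {s : W ⟶ V ⊗ Z}
    (h : p ≫ q ▷ Z ≫ (α_ U V Z).hom = r ≫ U ◁ s) :
    consRight A p ≫ q ▷ (A ⊗ Z) ≫ (α_ U V (A ⊗ Z)).hom =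
      consRight A r ≫ U ◁ consRight A s := by
  trans A ◁ (r ≫ U ◁ s) ≫ (α_ A U (V ⊗ Z)).inv ≫ (β_ A U).hom ▷ (V ⊗ Z) ≫
    (α_ U A (V ⊗ Z)).hom ≫ U ◁ ((α_ A V Z).inv ≫ (β_ A V).hom ▷ Z ≫ (α_ V A Z).hom)
  · rw [← h, consRight]
    trans A ◁ p ≫ (α_ _ _ _).inv ≫ ((β_ A Y).hom ≫ q ▷ A) ▷ Z ≫
      (α_ _ _ _).hom ≫ (α_ _ _ _).hom
    · monoidal
    · rw [← BraidedCategory.braiding_naturality_right,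
        BraidedCategory.braiding_tensor_right_hom]
      monoidal
  · trans A ◁ r ≫ (α_ _ _ _).inv ≫ ((β_ A U).hom ▷ W ≫ (U ⊗ A) ◁ s) ≫ (α_ _ _ _).hom ≫
      U ◁ ((α_ A V Z).inv ≫ (β_ A V).hom ▷ Z ≫ (α_ V A Z).hom)
    · rw [← whisker_exchange]; monoidal
    · rw [consRight, consRight]; monoidal

theorem consRight_isIso (p : X ⟶ Y ⊗ Z) [IsIso p] : IsIso (consRight A p) := by
  unfold consRight; infer_instance

/-- A bound variable `A` stays outside the position being filled, so substitution under a binder is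
whiskering by `A`: both braidings across `A` cancel by naturality. -/
theorem inv_consRight_naturality (q : U ⟶ Y ⊗ Z) [IsIso q] {V : C}
    (r : X ⟶ V ⊗ Z) (f : V ⟶ Y) [IsIso (consRight A q)] :
    consRight A r ≫ f ▷ (A ⊗ Z) ≫ inv (consRight A q) = A ◁ (r ≫ f ▷ Z ≫ inv q) := by
  rw [← Category.assoc, IsIso.comp_inv_eq]
  simp only [consRight, Category.assoc]
  trans A ◁ r ≫ (α_ _ _ _).inv ≫ ((β_ A V).hom ≫ f ▷ A) ▷ Z ≫ (α_ _ _ _).hom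
  · monoidal
  · rw [← BraidedCategory.braiding_naturality_right]
    trans A ◁ (r ≫ f ▷ Z) ≫ (α_ _ _ _).inv ≫ (β_ A Y).hom ▷ Z ≫ (α_ _ _ _).hom
    · monoidal
    · simp

end Shuffle

namespace Interpretation

variable {C : Type v} [Category.{w} C] [MonoidalCategory C] [SymmetricCategory C]
  [MonoidalClosed C] [FiniteProducts C]
variable {S : Signature.{u}} {L : QuantumLogic} {H : Hyperdoctrine.{v, w, z} L C}
  (M : Interpretation S H)

theorem split_left {A : Ty S.Base} {X Y Z : Ctx S} (p : Split X Y Z) :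
    M.split (Split.left (A := A) p) = consLeft (A.obj M.base) (M.split p) := by
  simp only [split]; rfl

theorem split_right {A : Ty S.Base} {X Y Z : Ctx S} (p : Split X Y Z) :
    M.split (Split.right (A := A) p) = consRight (A.obj M.base) (M.split p) := by
  simp only [split]; rfl

theorem split_symm : {X Y Z : Ctx S} → (p : Split X Y Z) →
    M.split p.symm = M.split p ≫ (β_ (M.ctx Y) (M.ctx Z)).hom
  | _, _, _, .nil => by
      simp only [Split.symm, split]
      change _ = (λ_ (𝟙_ C)).inv ≫ (β_ (𝟙_ C) (𝟙_ C)).hom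
      simp [unitors_inv_equal]
  | _, _, _, .left (A := A) (Y := Y) (Z := Z) p => by
      rw [Split.symm, split_right, split_symm p, split_left]
      exact consLeft_symm _
  | _, _, _, .right (A := A) (Y := Y) (Z := Z) p => by
      rw [Split.symm, split_left, split_symm p, split_right]
      exact consRight_symm _

/-- The bridge from combinatorics to coherence: identities between splittings proved for
`Split.assoc` become identities between arrows. -/
theorem split_assoc : {X Y Z U V : Ctx S} → (p : Split X Y Z) → (q : Split Y U V) →
    M.split p ≫ M.split q ▷ M.ctx Z ≫ (α_ (M.ctx U) (M.ctx V) (M.ctx Z)).hom =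
      M.split (Split.assoc p q).2.1 ≫ M.ctx U ◁ M.split (Split.assoc p q).2.2
  | _, _, _, _, _, .nil, .nil => by
      simp only [Split.assoc, split]
      change (λ_ (𝟙_ C)).inv ≫ (λ_ (𝟙_ C)).inv ▷ 𝟙_ C ≫ (α_ (𝟙_ C) (𝟙_ C) (𝟙_ C)).hom =
        (λ_ (𝟙_ C)).inv ≫ 𝟙_ C ◁ (λ_ (𝟙_ C)).inv
      monoidal
  | _, _, _, _, _, .left p, .left q => by
      change _ = M.split (.left (Split.assoc p q).2.1) ≫ M.ctx _ ◁ M.split (Split.assoc p q).2.2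
      rw [split_left, split_left, split_left]
      exact consLeft_consLeft (split_assoc p q)
  | _, _, _, _, _, .left p, .right q => by
      change _ = M.split (.right (Split.assoc p q).2.1) ≫
        M.ctx _ ◁ M.split (.left (Split.assoc p q).2.2)
      rw [split_left, split_left, split_right, split_right]
      exact consLeft_consRight (split_assoc p q)
  | _, _, _, _, _, .right p, q => by
      change _ = M.split (.right (Split.assoc p q).2.1) ≫
        M.ctx _ ◁ M.split (.right (Split.assoc p q).2.2)
      rw [split_right, split_right, split_right]
      exact consRight_left (split_assoc p q)

instance split_isIso {X Y Z : Ctx S} (p : Split X Y Z) : IsIso (M.split p) := by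
  induction p with
  | nil => simp only [split]; change IsIso (λ_ (𝟙_ C)).inv; infer_instance
  | left p ih =>
      rw [split_left]
      exact consLeft_isIso _
  | right p ih =>
      rw [split_right]
      exact consRight_isIso _

theorem split_allRight : (X : Ctx S) → M.split (.allRight X) = (λ_ (M.ctx X)).inv
  | [] => by simp only [Split.allRight, split]; rfl
  | A :: X => by
      rw [Split.allRight, split_right, split_allRight X]
      change consRight _ (λ_ (M.ctx X)).inv = (λ_ (A.obj M.base ⊗ M.ctx X)).inv
      change A.obj M.base ◁ _ ≫ (α_ _ (𝟙_ C) _).inv ≫ (β_ _ (𝟙_ C)).hom ▷ _ ≫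
        (α_ (𝟙_ C) _ _).hom = _
      simp [braiding_tensorUnit_right]

theorem split_allLeft (X : Ctx S) : M.split (.allLeft X) = (ρ_ (M.ctx X)).inv := by
  rw [← Split.symm_allRight, split_symm, split_allRight]
  change _ ≫ (β_ (𝟙_ C) _).hom = _
  simp [braiding_tensorUnit_left]

end Interpretation

end LFSq

namespace LFSq

/-! ### Substitution is composition -/

section Formers

variable {C : Type v} [Category.{w} C] [MonoidalCategory C]
variable {X X' Y Y' Z Z' A B D : C}

/-- Elimination of the monoidal unit. -/
def unitElim (p : X ⟶ Y ⊗ Z) (s : Y ⟶ 𝟙_ C) (t : Z ⟶ D) : X ⟶ D :=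
  p ≫ s ▷ Z ≫ (λ_ Z).hom ≫ t

/-- Elimination of a tensor product. -/
def tensorElim (p : X ⟶ Y ⊗ Z) (s : Y ⟶ A ⊗ B) (t : A ⊗ (B ⊗ Z) ⟶ D) : X ⟶ D :=
  p ≫ s ▷ Z ≫ (α_ A B Z).hom ≫ t

variable {f : X' ⟶ X} {p : X ⟶ Y ⊗ Z}

/-- These naturality lemmas have a left and a right form for each binary former. The hypothesis `h`
says that the substituting arrow `f` acts on one half of the splitting only, as supplied by
`substHom_left` and `substHom_right`. -/
theorem comp_unitElim_left {p' : X' ⟶ Y' ⊗ Z} {g : Y' ⟶ Y} (h : f ≫ p = p' ≫ g ▷ Z)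
    (s : Y ⟶ 𝟙_ C) (t : Z ⟶ D) : unitElim p' (g ≫ s) t = f ≫ unitElim p s t := by
  unfold unitElim; rw [reassoc_of% h]; simp

theorem comp_unitElim_right {p' : X' ⟶ Y ⊗ Z'} {g : Z' ⟶ Z} (h : f ≫ p = p' ≫ Y ◁ g)
    (s : Y ⟶ 𝟙_ C) (t : Z ⟶ D) : unitElim p' s (g ≫ t) = f ≫ unitElim p s t := by
  unfold unitElim; rw [reassoc_of% h, whisker_exchange_assoc]; simp

theorem comp_tensorHom_left {p' : X' ⟶ Y' ⊗ Z} {g : Y' ⟶ Y} (h : f ≫ p = p' ≫ g ▷ Z)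
    (s : Y ⟶ A) (t : Z ⟶ B) : p' ≫ ((g ≫ s) ⊗ₘ t) = f ≫ p ≫ (s ⊗ₘ t) := by
  rw [reassoc_of% h]; simp [MonoidalCategory.tensorHom_def]

theorem comp_tensorHom_right {p' : X' ⟶ Y ⊗ Z'} {g : Z' ⟶ Z} (h : f ≫ p = p' ≫ Y ◁ g)
    (s : Y ⟶ A) (t : Z ⟶ B) : p' ≫ (s ⊗ₘ (g ≫ t)) = f ≫ p ≫ (s ⊗ₘ t) := by
  rw [reassoc_of% h]; simp [MonoidalCategory.tensorHom_def']

theorem comp_tensorElim_left {p' : X' ⟶ Y' ⊗ Z} {g : Y' ⟶ Y} (h : f ≫ p = p' ≫ g ▷ Z)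
    (s : Y ⟶ A ⊗ B) (t : A ⊗ (B ⊗ Z) ⟶ D) :
    tensorElim p' (g ≫ s) t = f ≫ tensorElim p s t := by
  unfold tensorElim; rw [reassoc_of% h]; simp

theorem comp_tensorElim_right {p' : X' ⟶ Y ⊗ Z'} {g : Z' ⟶ Z} (h : f ≫ p = p' ≫ Y ◁ g)
    (s : Y ⟶ A ⊗ B) (t : A ⊗ (B ⊗ Z) ⟶ D) :
    tensorElim p' s (A ◁ B ◁ g ≫ t) = f ≫ tensorElim p s t := by
  unfold tensorElim; rw [reassoc_of% h, whisker_exchange_assoc]; simp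

end Formers

theorem comp_rightUnitor_inv_whiskerRight {C : Type v} [Category.{w} C] [MonoidalCategory C]
    {X A : C} (f : X ⟶ A) (Z : C) :
    (f ≫ (ρ_ A).inv) ▷ Z = f ▷ Z ≫ consLeft A (λ_ Z).inv := by
  simp [consLeft]

namespace FiniteProducts

variable {C : Type v} [Category.{w} C] [FiniteProducts C]

theorem toOne_unique {X : C} (f g : X ⟶ one C) : f = g :=
  (terminalCone (C := C)).isLimit.hom_ext fun j => j.as.elim

@[simp]
theorem lift_fst {X Y Z : C} (f : Z ⟶ X) (g : Z ⟶ Y) : lift f g ≫ fst X Y = f :=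
  (binaryCone X Y).isLimit.fac (BinaryFan.mk f g) ⟨WalkingPair.left⟩

@[simp]
theorem lift_snd {X Y Z : C} (f : Z ⟶ X) (g : Z ⟶ Y) : lift f g ≫ snd X Y = g :=
  (binaryCone X Y).isLimit.fac (BinaryFan.mk f g) ⟨WalkingPair.right⟩

theorem hom_ext {X Y Z : C} {f g : Z ⟶ prod X Y} (h₁ : f ≫ fst X Y = g ≫ fst X Y)
    (h₂ : f ≫ snd X Y = g ≫ snd X Y) : f = g :=
  BinaryFan.IsLimit.hom_ext (binaryCone X Y).isLimit h₁ h₂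

theorem comp_lift {X Y Z W : C} (h : W ⟶ Z) (f : Z ⟶ X) (g : Z ⟶ Y) :
    h ≫ lift f g = lift (h ≫ f) (h ≫ g) := by
  apply hom_ext <;> simp

theorem lift_comp_comp {X Y Z W V : C} (r : V ⟶ prod X Y) (f : Y ⟶ Z) (h : prod X Z ⟶ W) :
    lift (r ≫ fst X Y) ((r ≫ snd X Y) ≫ f) ≫ h = r ≫ mapRight X f ≫ h := by
  rw [mapRight, ← Category.assoc, comp_lift, Category.assoc]

end FiniteProducts

namespace Interpretation

variable {C : Type v} [Category.{w} C] [MonoidalCategory C] [SymmetricCategory C]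
  [MonoidalClosed C] [FiniteProducts C]
variable {S : Signature.{u}} {L : QuantumLogic} {H : Hyperdoctrine.{v, w, z} L C}
  (M : Interpretation S H)

theorem tm_letStar {X Y Z : Ctx S} {A : Ty S.Base} (p : Split X Y Z) (s : Tm Y Ty.unit)
    (t : Tm Z A) : M.tm (.letStar p s t) = unitElim (M.split p) (M.tm s) (M.tm t) := by
  rw [tm]; rfl

theorem tm_tens {X Y Z : Ctx S} {A B : Ty S.Base} (p : Split X Y Z) (s : Tm Y A)
    (t : Tm Z B) : M.tm (.tens p s t) = M.split p ≫ (M.tm s ⊗ₘ M.tm t) := by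
  rw [tm]; rfl

theorem tm_letTens {X Y Z : Ctx S} {A B D : Ty S.Base} (p : Split X Y Z)
    (s : Tm Y (Ty.tensor A B)) (t : Tm (A :: B :: Z) D) :
    M.tm (.letTens p s t) =
      tensorElim (A := A.obj M.base) (B := B.obj M.base) (M.split p) (M.tm s) (M.tm t) := by
  rw [tm]; rfl

theorem tm_app {X Y Z : Ctx S} {A B : Ty S.Base} (p : Split X Y Z)
    (s : Tm Y (Ty.lolli A B)) (t : Tm Z A) : M.tm (.app p s t) =
      (M.split p ≫ (M.tm s ⊗ₘ M.tm t)) ≫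
        (β_ ((ihom (A.obj M.base)).obj (B.obj M.base)) (A.obj M.base)).hom ≫
          (ihom.ev (A.obj M.base)).app (B.obj M.base) := by
  rw [tm, Category.assoc]

/-- The interpretation of a term as an arrow into the interpretation of a one-variable
context. -/
def single {Y : Ctx S} {A : Ty S.Base} (s : Tm Y A) : M.ctx Y ⟶ M.ctx [A] :=
  M.tm s ≫ (ρ_ (A.obj M.base)).inv

/-- The arrow of contexts that substitutes `s` for one variable. -/
noncomputable def substHom {A : Ty S.Base} {D R X Y : Ctx S} (s : Tm Y A)
    (p : Split D [A] R) (q : Split X Y R) : M.ctx X ⟶ M.ctx D :=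
  M.split q ≫ M.single s ▷ M.ctx R ≫ inv (M.split p)

section Subst

variable {A : Ty S.Base} {D R X Y : Ctx S} (s : Tm Y A) {p : Split D [A] R} (q : Split X Y R)

theorem substHom_left {D₁ D₂ : Ctx S} {m : Split D D₁ D₂} {r}
    (h : Split.locate p m = Sum.inl r) :
    M.substHom s p q ≫ M.split m = M.split (Split.unassoc q r.2.2).2.1 ≫
      M.substHom s r.2.1 (Split.unassoc q r.2.2).2.2 ▷ M.ctx D₂ := by
  refine shuffle_subst (r := M.split r.2.2) _ ?_ ?_
  · rw [split_assoc, Split.assoc_of_locate_inl h]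
  · rw [split_assoc, Split.assoc_unassoc]

/-- Mirroring the splitting turns this into the left case; naturality of the braiding and its
symmetry undo the mirroring. -/
theorem substHom_right {D₁ D₂ : Ctx S} {m : Split D D₁ D₂} {r}
    (h : Split.locate p m = Sum.inr r) :
    M.substHom s p q ≫ M.split m = M.split (Split.unassoc q r.2.2.symm).2.1.symm ≫
      M.ctx D₁ ◁ M.substHom s r.2.1 (Split.unassoc q r.2.2.symm).2.2 := by
  have : M.substHom s p q ≫ M.split m.symm = M.split (Split.unassoc q r.2.2.symm).2.1 ≫
      M.substHom s r.2.1 (Split.unassoc q r.2.2.symm).2.2 ▷ M.ctx D₁ := by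
    refine shuffle_subst (r := M.split r.2.2.symm) _ ?_ ?_
    · rw [split_assoc, Split.assoc_of_locate_inr h]
    · rw [split_assoc, Split.assoc_unassoc]
  rw [split_symm] at this ⊢
  rw [Category.assoc, ← BraidedCategory.braiding_naturality_left, ← reassoc_of% this]
  simp

theorem substHom_cons {B : Ty S.Base} :
    M.substHom s (Split.right (A := B) p) (Split.right q) =
      B.obj M.base ◁ M.substHom s p q := by
  have : IsIso (consRight (B.obj M.base) (M.split p)) := consRight_isIso _
  have h := inv_consRight_naturality (A := B.obj M.base) (M.split p) (M.split q) (M.single s)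
  unfold substHom
  rw [← h]
  simp only [split_right]
  rfl

theorem substHom_var : M.substHom s (Split.left Split.nil) (Split.allLeft Y) = M.single s := by
  unfold substHom
  rw [← Category.assoc, IsIso.comp_inv_eq, split_allLeft]
  have h := M.split_allLeft [A]
  rw [Split.allLeft, Split.allLeft] at h
  rw [h]
  exact (rightUnitor_inv_naturality (M.single s)).symm

/-- The semantic substitution lemma. Quantifying over the position `p` and the splitting `q` is
needed in the induction: both change when passing to a subterm or under a binder. -/
theorem tm_substAt {B : Ty S.Base} (t : Tm D B) :
    ∀ {R X : Ctx S} (p : Split D [A] R) (q : Split X Y R),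
      M.tm (Tm.substAt s t p q) = M.substHom s p q ≫ M.tm t := by
  induction t with
  | var =>
    intro R X p q
    cases p with
    | right p => cases p
    | left p =>
      cases p
      obtain rfl := Split.eq_of_nil_right q
      obtain rfl := Split.eq_allLeft q
      rw [Tm.substAt, substHom_var, tm, single]
      exact (by simp : M.tm s = (M.tm s ≫ (ρ_ (A.obj M.base)).inv) ≫ (ρ_ (A.obj M.base)).hom)
  | op f t ih => intro R X p q; simp only [Tm.substAt, tm, ih, Category.assoc]
  | star => intro R X p; cases p
  | letStar m t t' ih ih' =>
    intro R X p q
    rw [Tm.substAt, tm_letStar]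
    rcases h : Split.locate p m with r | r
    · rw [tm_letStar, ih]; exact comp_unitElim_left (M.substHom_left s q h) _ _
    · rw [tm_letStar, ih']; exact comp_unitElim_right (M.substHom_right s q h) _ _
  | tens m t t' ih ih' =>
    intro R X p q
    rw [Tm.substAt, tm_tens]
    rcases h : Split.locate p m with r | r
    · rw [tm_tens, ih, comp_tensorHom_left (M.substHom_left s q h)]; rfl
    · rw [tm_tens, ih', comp_tensorHom_right (M.substHom_right s q h)]; rfl
  | letTens m t t' ih ih' =>
    intro R X p q
    rw [Tm.substAt, tm_letTens]
    rcases h : Split.locate p m with r | r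
    · rw [tm_letTens, ih]; exact comp_tensorElim_left (M.substHom_left s q h) _ _
    · rw [tm_letTens, ih', substHom_cons, substHom_cons]
      exact comp_tensorElim_right (M.substHom_right s q h) _ _
  | lam t ih =>
    intro R X p q
    rw [Tm.substAt, tm, tm, ih, substHom_cons]
    exact MonoidalClosed.curry_natural_left _ _
  | app m t t' ih ih' =>
    intro R X p q
    rw [Tm.substAt, tm_app, ← Category.assoc]
    rcases h : Split.locate p m with r | r
    · rw [tm_app, ih, comp_tensorHom_left (M.substHom_left s q h)]
    · rw [tm_app, ih', comp_tensorHom_right (M.substHom_right s q h)]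
  | triv => intro R X p q; exact FiniteProducts.toOne_unique _ _
  | pair t t' ih ih' =>
    intro R X p q
    rw [Tm.substAt, tm, tm, ih, ih']
    exact (FiniteProducts.comp_lift _ _ _).symm
  | fst t ih => intro R X p q; simp only [Tm.substAt, tm, ih]; exact Category.assoc _ _ _
  | snd t ih => intro R X p q; simp only [Tm.substAt, tm, ih]; exact Category.assoc _ _ _

end Subst

theorem single_whiskerRight {Y : Ctx S} {A : Ty S.Base} (s : Tm Y A) (Z : Ctx S) :
    M.single s ▷ M.ctx Z ≫ inv (M.split (Split.left (Split.allRight Z))) =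
      M.tm s ▷ M.ctx Z := by
  refine (IsIso.comp_inv_eq (M.split (Split.left (Split.allRight Z)))).2 ?_
  rw [split_left, split_allRight]
  exact comp_rightUnitor_inv_whiskerRight _ _

theorem tm_subst {X Y Z : Ctx S} {A B : Ty S.Base} (p : Split X Y Z) (s : Tm Y A)
    (t : Tm (A :: Z) B) : M.tm (Tm.subst p s t) =
      (M.split p ≫ M.tm s ▷ M.ctx Z : M.ctx X ⟶ A.obj M.base ⊗ M.ctx Z) ≫ M.tm t := by
  rw [Tm.subst, tm_substAt, substHom, single_whiskerRight]
  rfl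

theorem tm_lam {X : Ctx S} {A B : Ty S.Base} (t : Tm (A :: X) B) : M.tm (.lam t) =
    MonoidalClosed.curry (A := A.obj M.base) (Y := M.ctx X) (M.tm t) := by
  rw [tm]

theorem tm_var {A : Ty S.Base} : M.tm (.var (A := A)) = (ρ_ (A.obj M.base)).hom := by
  rw [tm]

theorem tm_star : M.tm (.star (S := S)) = 𝟙 (𝟙_ C) := by
  rw [tm]

theorem tm_tens_var {A B : Ty S.Base} :
    M.tm (.tens (.left (.right .nil)) (.var (A := A)) (.var (A := B))) =
      A.obj M.base ◁ (ρ_ (B.obj M.base)).hom := by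
  rw [tm_tens, split_left, split_right, split, tm_var, tm_var]
  change consLeft (A.obj M.base) (consRight (B.obj M.base) (λ_ (𝟙_ C)).inv) ≫
    ((ρ_ (A.obj M.base)).hom ⊗ₘ (ρ_ (B.obj M.base)).hom) = _
  simp [consLeft, consRight, MonoidalCategory.tensorHom_def, braiding_tensorUnit_right]

end Interpretation

/-! ### Soundness of the equational theory -/

section Formers

variable {C : Type v} [Category.{w} C] [MonoidalCategory C]
variable {X Y Z U V W A B D : C}

theorem unitElim_beta (t : Z ⟶ D) : unitElim (λ_ Z).inv (𝟙 (𝟙_ C)) t = t := by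
  simp [unitElim]

theorem unitElim_eta (p : X ⟶ Y ⊗ Z) (s : Y ⟶ 𝟙_ C) (t : 𝟙_ C ⊗ Z ⟶ D) :
    unitElim p s (((λ_ Z).inv ≫ (𝟙 (𝟙_ C)) ▷ Z) ≫ t) = (p ≫ s ▷ Z) ≫ t := by
  simp [unitElim]

theorem tensorElim_eta (p : X ⟶ Y ⊗ Z) (s : Y ⟶ A ⊗ B) (t : (A ⊗ B) ⊗ Z ⟶ D) :
    tensorElim p s ((consLeft A (consLeft B (λ_ Z).inv) ≫ (A ◁ (ρ_ B).hom) ▷ Z) ≫ t) =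
      (p ≫ s ▷ Z) ≫ t := by
  have : (consLeft A (consLeft B (λ_ Z).inv) ≫ (A ◁ (ρ_ B).hom) ▷ Z) = (α_ A B Z).inv := by
    unfold consLeft; monoidal
  rw [this, tensorElim]; simp

variable [SymmetricCategory C]

/-- The β-rule for `⊗` substitutes one component at a time, taking `b` off the outer splitting,
while the tensor acts on both at once. The interchange law relates the two; the hypothesis `h` uses
the mirrored `q`, and symmetry cancels the resulting braiding. -/
theorem tensorElim_beta {p : X ⟶ Y ⊗ Z} {q : Y ⟶ U ⊗ V} {r : X ⟶ V ⊗ W} {s : W ⟶ U ⊗ Z}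
    (h : p ≫ (q ≫ (β_ U V).hom) ▷ Z ≫ (α_ V U Z).hom = r ≫ V ◁ s) (a : U ⟶ A) (b : V ⟶ B)
    (t : A ⊗ (B ⊗ Z) ⟶ D) : tensorElim p (q ≫ (a ⊗ₘ b)) t =
      (r ≫ b ▷ W) ≫ (consRight B s ≫ a ▷ (B ⊗ Z)) ≫ t := by
  have h' : p ≫ q ▷ Z = r ≫ V ◁ s ≫ (α_ V U Z).inv ≫ (β_ V U).hom ▷ Z := by
    rw [← reassoc_of% h, Iso.hom_inv_id_assoc, ← comp_whiskerRight, Category.assoc,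
      SymmetricCategory.symmetry, Category.comp_id]
  unfold tensorElim consRight
  rw [comp_whiskerRight_assoc, reassoc_of% h']
  simp only [Category.assoc, ← whisker_exchange_assoc]
  congr 2
  trans (α_ _ _ _).inv ≫ ((β_ V U).hom ≫ U ◁ b) ▷ Z ≫ (α_ _ _ _).hom ≫ a ▷ (B ⊗ Z) ≫ t
  · rw [MonoidalCategory.tensorHom_def']; monoidal
  · rw [← BraidedCategory.braiding_naturality_left]; monoidal

variable [MonoidalClosed C]

theorem app_beta (p : X ⟶ Y ⊗ Z) (t : A ⊗ Y ⟶ B) (s : Z ⟶ A) :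
    (p ≫ (MonoidalClosed.curry t ⊗ₘ s)) ≫ (β_ ((ihom A).obj B) A).hom ≫ (ihom.ev A).app B =
      ((p ≫ (β_ Y Z).hom) ≫ s ▷ Y) ≫ t := by
  rw [Category.assoc, BraidedCategory.braiding_naturality_assoc,
    MonoidalCategory.tensorHom_def_assoc, MonoidalClosed.whiskerLeft_curry_ihom_ev_app]
  simp

/-- The two braidings, one from placing the bound variable last and one from evaluation, cancel;
what remains is `curry (uncurry t)`. -/
theorem app_eta (t : X ⟶ (ihom A).obj B) :
    MonoidalClosed.curry ((consRight A (ρ_ X).inv ≫ (t ⊗ₘ (ρ_ A).hom)) ≫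
      (β_ ((ihom A).obj B) A).hom ≫ (ihom.ev A).app B) = t := by
  rw [← MonoidalClosed.uncurry_id_eq_ev]
  have : consRight A (ρ_ X).inv ≫ (t ⊗ₘ (ρ_ A).hom) ≫ (β_ ((ihom A).obj B) A).hom = A ◁ t := by
    simp [consRight, MonoidalCategory.tensorHom_def']
  rw [Category.assoc, reassoc_of% this, ← MonoidalClosed.uncurry_natural_left, Category.comp_id,
    MonoidalClosed.curry_uncurry]

end Formers

namespace Interpretation

variable {C : Type v} [Category.{w} C] [MonoidalCategory C] [SymmetricCategory C]
  [MonoidalClosed C] [FiniteProducts C]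
variable {S : Signature.{u}} {L : QuantumLogic} {H : Hyperdoctrine.{v, w, z} L C}
  (M : Interpretation S H)

theorem tm_eq_of_tmEq {X : Ctx S} {A : Ty S.Base} {t t' : Tm X A} (h : TmEq t t') :
    M.tm t = M.tm t' := by
  induction h with
  | refl => rfl
  | symm _ ih => exact ih.symm
  | trans _ _ ih ih' => exact ih.trans ih'
  | op f _ ih => simp only [tm, ih]
  | letStar p _ _ ih ih' => rw [tm, tm, ih, ih']
  | tens p _ _ ih ih' => rw [tm, tm, ih, ih']
  | letTens p _ _ ih ih' => rw [tm, tm, ih, ih']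
  | lam _ ih => rw [tm, tm, ih]
  | app p _ _ ih ih' => rw [tm, tm, ih, ih']
  | pair _ _ ih ih' => rw [tm, tm, ih, ih']
  | fst _ ih => rw [tm, tm, ih]
  | snd _ ih => rw [tm, tm, ih]
  | star_beta t =>
    rw [tm_letStar, split_allRight, tm_star]
    exact unitElim_beta _
  | star_eta p s t =>
    rw [tm_letStar, tm_subst, tm_subst, split_allRight, tm_star]
    exact unitElim_eta _ _ _
  | tens_beta p q a b t =>
    rw [tm_letTens, tm_subst, tm_tens]
    -- The inner substitution of the β-rule is a `Tm.subst` with remaining context `B :: Z`.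
    have e := M.tm_subst (.right (Split.assoc p q.symm).2.2) a t
    rw [Tm.subst] at e
    rw [e, split_right]
    refine tensorElim_beta ?_ _ _ _
    have h := M.split_assoc p q.symm
    rwa [split_symm] at h
  | tens_eta p s t =>
    rw [tm_letTens, tm_subst, tm_subst, tm_tens_var, split_left, split_left, split_allRight]
    exact tensorElim_eta _ _ _
  | lam_beta p t s =>
    rw [tm_app, tm_subst, tm_lam, split_symm]
    exact app_beta _ _ _
  | lam_eta t =>
    rw [tm_lam, tm_app, tm_var, split_right, split_allLeft]
    exact app_eta _
  | triv_eta t => exact FiniteProducts.toOne_unique _ _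
  | fst_beta s t => rw [tm, tm]; exact FiniteProducts.lift_fst _ _
  | snd_beta s t => rw [tm, tm]; exact FiniteProducts.lift_snd _ _
  | pair_eta t =>
    rw [tm, tm, tm]
    exact FiniteProducts.hom_ext (FiniteProducts.lift_fst _ _) (FiniteProducts.lift_snd _ _)

/-! ### Tuples and simultaneous substitution -/

theorem tm_tuple : (X : Ctx S) → M.tm (Tm.tuple X) = 𝟙 (M.ctx X)
  | [] => M.tm_star
  | A :: X => by
      refine (M.tm_tens (.left (.allRight X)) .var (Tm.tuple X)).trans ?_
      rw [tm_tuple X, tm_var, split_left, split_allRight]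
      change consLeft (A.obj M.base) (λ_ (M.ctx X)).inv ≫
        ((ρ_ (A.obj M.base)).hom ⊗ₘ 𝟙 (M.ctx X)) = 𝟙 (A.obj M.base ⊗ M.ctx X)
      simp [consLeft]

end Interpretation

section Formers

variable {C : Type v} [Category.{w} C] [MonoidalCategory C]

theorem unitElim_rightUnitor {D : C} (t : 𝟙_ C ⟶ D) :
    unitElim (consLeft (𝟙_ C) (λ_ (𝟙_ C)).inv) (ρ_ (𝟙_ C)).hom t = (ρ_ (𝟙_ C)).hom ≫ t := by
  unfold unitElim consLeft
  monoidal

/-- The recursive step of `Tm.untuple`: abstraction and application serve only to reorder variables,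
so after β they leave nothing but the right unitor of the one-variable context. -/
theorem tensorElim_rightUnitor [SymmetricCategory C] [MonoidalClosed C] {A T D : C}
    (t : A ⊗ T ⟶ D) :
    tensorElim (consLeft (A ⊗ T) (λ_ (𝟙_ C)).inv) (ρ_ (A ⊗ T)).hom
      ((consRight A (consLeft T (λ_ (𝟙_ C)).inv) ≫
        (((ρ_ T).hom ≫ MonoidalClosed.curry t) ⊗ₘ (ρ_ A).hom)) ≫
          (β_ ((ihom A).obj D) A).hom ≫ (ihom.ev A).app D) = (ρ_ (A ⊗ T)).hom ≫ t := by
  rw [← MonoidalClosed.curry_natural_left, app_beta, ← consRight_symm]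
  unfold tensorElim consLeft
  simp only [Category.assoc, braiding_tensorUnit_right]
  monoidal

end Formers

namespace Interpretation

variable {C : Type v} [Category.{w} C] [MonoidalCategory C] [SymmetricCategory C]
  [MonoidalClosed C] [FiniteProducts C]
variable {S : Signature.{u}} {L : QuantumLogic} {H : Hyperdoctrine.{v, w, z} L C}
  (M : Interpretation S H)

theorem tm_untuple : (X : Ctx S) → {B : Ty S.Base} → (t : Tm X B) →
    M.tm (Tm.untuple X t) = (ρ_ (M.ctx X)).hom ≫ M.tm t
  | [], _, t => by
      refine (M.tm_letStar (.left .nil) .var t).trans ?_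
      rw [split_left, split, tm_var]
      exact unitElim_rightUnitor _
  | A :: X, _, t => by
      refine (M.tm_letTens (.left .nil) .var _).trans ?_
      rw [tm_app, tm_untuple X (.lam t), split_left, split_right, split_left, split, tm_var,
        tm_var, tm_lam]
      exact tensorElim_rightUnitor _

theorem tm_letIn {X Y : Ctx S} {B : Ty S.Base} (s : Tm Y X.tensor) (t : Tm X B) :
    M.tm (Tm.letIn s t) = M.tm s ≫ M.tm t := by
  rw [Tm.letIn, tm_subst, tm_untuple, split_allLeft]
  change ((ρ_ (M.ctx Y)).inv ≫ M.tm s ▷ 𝟙_ C) ≫ (ρ_ (M.ctx X)).hom ≫ M.tm t = _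
  rw [Category.assoc]
  exact (by simp : ∀ {X Y Z : C} (f : X ⟶ Y) (g : Y ⟶ Z),
    (ρ_ X).inv ≫ f ▷ 𝟙_ C ≫ (ρ_ Y).hom ≫ g = f ≫ g) _ _

theorem tm_single {X : Ctx S} {A : Ty S.Base} (t : Tm X A) :
    M.tm (Tm.single t) = M.tm t ≫ (ρ_ (A.obj M.base)).inv := by
  refine (M.tm_tens (.allLeft X) t .star).trans ?_
  rw [split_allLeft, tm_star]
  change (ρ_ (M.ctx X)).inv ≫ (M.tm t ⊗ₘ 𝟙 (𝟙_ C)) = _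
  simp

theorem tm_fst_var {A B : Ty S.Base} : M.tm (.fst (.var (A := .prod A B))) =
    (ρ_ (FiniteProducts.prod (A.obj M.base) (B.obj M.base))).hom ≫ FiniteProducts.fst _ _ := by
  rw [tm, tm_var]; rfl

theorem tm_snd_var {A B : Ty S.Base} : M.tm (.snd (.var (A := .prod A B))) =
    (ρ_ (FiniteProducts.prod (A.obj M.base) (B.obj M.base))).hom ≫ FiniteProducts.snd _ _ := by
  rw [tm, tm_var]; rfl

/-- Up to unitors, substitution under a quantifier is the arrow `A × f` occurring in the
Beck–Chevalley condition; the definition of `Formula.lift` is made for this. -/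
theorem tm_lift {X Y : Ctx S} (A : Ty S.Base) (s : Tm Y X.tensor) :
    M.tm (Formula.lift A s) = (ρ_ (FiniteProducts.prod (A.obj M.base) (M.ctx Y))).hom ≫
      FiniteProducts.mapRight (A.obj M.base) (M.tm s) ≫
        (ρ_ (FiniteProducts.prod (A.obj M.base) (M.ctx X))).inv := by
  rw [Formula.lift, tm_single, tm, tm_letIn, tm_fst_var, tm_snd_var]
  exact FiniteProducts.lift_comp_comp _ _ _

end Interpretation

end LFSq

namespace LFSq

/-! ### Algebra of the fibres and quantifiers -/

namespace QLAlgebra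

variable {L : QuantumLogic} {α : Type z} [QLAlgebra L α]

theorem compl_le_compl_iff {a b : α} : aᶜ ≤ bᶜ ↔ b ≤ a :=
  ⟨fun h => by
    have := compl_antitone (L := L) _ _ h
    rwa [compl_involutive (L := L), compl_involutive (L := L)] at this, compl_antitone (L := L) _ _⟩

variable (L) in
theorem compl_inf (a b : α) : (a ⊓ b)ᶜ = aᶜ ⊔ bᶜ := by
  apply le_antisymm
  · rw [← compl_le_compl_iff (L := L), compl_involutive (L := L)]
    apply le_inf <;> rw [← compl_le_compl_iff (L := L), compl_involutive (L := L)]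
    exacts [le_sup_left, le_sup_right]
  · exact sup_le (compl_antitone (L := L) _ _ inf_le_left)
      (compl_antitone (L := L) _ _ inf_le_right)

variable (L) in
theorem compl_sup (a b : α) : (a ⊔ b)ᶜ = aᶜ ⊓ bᶜ := by
  rw [← compl_involutive (L := L) (aᶜ ⊓ bᶜ), compl_inf L, compl_involutive (L := L),
    compl_involutive (L := L)]

variable (L) in
theorem compl_top : (⊤ : α)ᶜ = ⊥ := by
  rw [eq_bot_iff, ← compl_le_compl_iff (L := L), compl_involutive (L := L)]
  exact le_top

variable (L) in
theorem compl_bot : (⊥ : α)ᶜ = ⊤ := by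
  rw [← compl_top L, compl_involutive (L := L)]

variable (L) in
theorem inf_map_compl (s : Multiset α) : (s.map (·ᶜ)).inf = s.supᶜ := by
  induction s using Multiset.induction_on with
  | empty => simp [compl_bot L]
  | cons a s ih => simp [ih, compl_sup L]

variable (L) in
theorem sup_map_compl (s : Multiset α) : (s.map (·ᶜ)).sup = s.infᶜ := by
  induction s using Multiset.induction_on with
  | empty => simp [compl_top L]
  | cons a s ih => simp [ih, compl_inf L]

end QLAlgebra

namespace Hyperdoctrine

variable {C : Type v} [Category.{w} C] [FiniteProducts C] {L : QuantumLogic}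
  (H : Hyperdoctrine.{v, w, z} L C)

/-- The fibre over an object. -/
abbrev Fibre (X : C) : Type z := (H.P.obj (op X)).carrier

/-- Reindexing of predicates along an arrow. -/
def reindex {X Y : C} (f : X ⟶ Y) (a : H.Fibre Y) : H.Fibre X :=
  (H.P.map f.op).toFun a

variable {X Y Z : C} (f : X ⟶ Y)

theorem reindex_inf (a b : H.Fibre Y) : H.reindex f (a ⊓ b) = H.reindex f a ⊓ H.reindex f b :=
  (H.P.map f.op).map_inf a b

theorem reindex_sup (a b : H.Fibre Y) : H.reindex f (a ⊔ b) = H.reindex f a ⊔ H.reindex f b :=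
  (H.P.map f.op).map_sup a b

theorem reindex_top : H.reindex f ⊤ = ⊤ := (H.P.map f.op).map_top

theorem reindex_bot : H.reindex f ⊥ = ⊥ := (H.P.map f.op).map_bot

theorem reindex_compl (a : H.Fibre Y) : H.reindex f aᶜ = (H.reindex f a)ᶜ :=
  (H.P.map f.op).map_compl a

theorem reindex_id (a : H.Fibre X) : H.reindex (𝟙 X) a = a := by
  unfold reindex
  rw [op_id, H.P.map_id]
  rfl

theorem reindex_comp (g : Y ⟶ Z) (a : H.Fibre Z) :
    H.reindex (f ≫ g) a = H.reindex f (H.reindex g a) := by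
  unfold reindex
  rw [op_comp, H.P.map_comp]
  rfl

theorem reindex_inv_hom_comp (i : Z ≅ X) (a : H.Fibre Y) :
    H.reindex i.inv (H.reindex (i.hom ≫ f) a) = H.reindex f a := by
  rw [← reindex_comp, Iso.inv_hom_id_assoc]

theorem reindex_mono {a b : H.Fibre Y} (h : a ≤ b) : H.reindex f a ≤ H.reindex f b := by
  rw [← inf_eq_left] at h ⊢
  rw [← reindex_inf, h]

theorem reindex_inf_map {ι : Type*} (g : ι → H.Fibre Y) (s : Multiset ι) :
    H.reindex f (s.map g).inf = (s.map fun i => H.reindex f (g i)).inf := by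
  induction s using Multiset.induction_on with
  | empty => simp [reindex_top]
  | cons a s ih => simp [ih, reindex_inf]

theorem reindex_sup_map {ι : Type*} (g : ι → H.Fibre Y) (s : Multiset ι) :
    H.reindex f (s.map g).sup = (s.map fun i => H.reindex f (g i)).sup := by
  induction s using Multiset.induction_on with
  | empty => simp [reindex_bot]
  | cons a s ih => simp [ih, reindex_sup]

theorem le_all_iff {X Y : C} {a : H.Fibre Y} {b : H.Fibre (FiniteProducts.prod X Y)} :
    a ≤ H.all X Y b ↔ H.reindex (FiniteProducts.snd X Y) a ≤ b :=
  (H.all_adjoint X Y a b).symm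

theorem ex_le_iff {X Y : C} {a : H.Fibre Y} {b : H.Fibre (FiniteProducts.prod X Y)} :
    H.ex X Y b ≤ a ↔ b ≤ H.reindex (FiniteProducts.snd X Y) a :=
  H.ex_adjoint X Y b a

theorem reindex_all (X : C) {Y Z : C} (f : Z ⟶ Y) (a : H.Fibre (FiniteProducts.prod X Y)) :
    H.reindex f (H.all X Y a) = H.all X Z (H.reindex (FiniteProducts.mapRight X f) a) :=
  H.all_beckChevalley X f a

theorem reindex_ex (X : C) {Y Z : C} (f : Z ⟶ Y) (a : H.Fibre (FiniteProducts.prod X Y)) :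
    H.reindex f (H.ex X Y a) = H.ex X Z (H.reindex (FiniteProducts.mapRight X f) a) :=
  H.ex_beckChevalley X f a

/-- Complementation is an order-reversing bijection commuting with reindexing, so it conjugates the
right adjoint of reindexing into the left adjoint. -/
theorem compl_all (X Y : C) (a : H.Fibre (FiniteProducts.prod X Y)) :
    (H.all X Y a)ᶜ = H.ex X Y aᶜ := by
  apply le_antisymm
  · rw [← QLAlgebra.compl_le_compl_iff (L := L), QLAlgebra.compl_involutive (L := L), le_all_iff,
      reindex_compl, ← QLAlgebra.compl_le_compl_iff (L := L),
      QLAlgebra.compl_involutive (L := L), ← ex_le_iff]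
  · rw [ex_le_iff, reindex_compl, QLAlgebra.compl_le_compl_iff (L := L), ← le_all_iff]

theorem compl_ex (X Y : C) (a : H.Fibre (FiniteProducts.prod X Y)) :
    (H.ex X Y a)ᶜ = H.all X Y aᶜ := by
  rw [← QLAlgebra.compl_involutive (L := L) (H.all X Y aᶜ), compl_all,
    QLAlgebra.compl_involutive (L := L)]

/-- Instantiation is the counit of the adjunction, pulled back along the section `⟨t, 1⟩` of the
projection. -/
theorem reindex_lift_all {X Y : C} (t : Y ⟶ X) (a : H.Fibre (FiniteProducts.prod X Y)) :
    H.all X Y a ≤ H.reindex (FiniteProducts.lift t (𝟙 Y)) a := by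
  have h := H.reindex_mono (FiniteProducts.lift t (𝟙 Y)) (H.le_all_iff.1 (le_refl (H.all X Y a)))
  rwa [← H.reindex_comp, FiniteProducts.lift_snd, H.reindex_id] at h

theorem le_reindex_lift_ex {X Y : C} (t : Y ⟶ X) (a : H.Fibre (FiniteProducts.prod X Y)) :
    H.reindex (FiniteProducts.lift t (𝟙 Y)) a ≤ H.ex X Y a := by
  have h := H.reindex_mono (FiniteProducts.lift t (𝟙 Y)) (H.ex_le_iff.1 (le_refl (H.ex X Y a)))
  rwa [← H.reindex_comp, FiniteProducts.lift_snd, H.reindex_id] at h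

end Hyperdoctrine

/-! ### Soundness of the sequent calculus -/

namespace Interpretation

variable {C : Type v} [Category.{w} C] [MonoidalCategory C] [SymmetricCategory C]
  [MonoidalClosed C] [FiniteProducts C]
variable {S : Signature.{u}} {L : QuantumLogic} {H : Hyperdoctrine.{v, w, z} L C}
  (M : Interpretation S H)

theorem formula_all {X : Ctx S} {A : Ty S.Base} (φ : Formula [Ty.prod A X.tensor]) :
    M.formula (.all A φ) = H.all (A.obj M.base) (M.ctx X)
      (H.reindex (ρ_ (FiniteProducts.prod (A.obj M.base) (M.ctx X))).inv (M.formula φ)) := by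
  rw [formula]; rfl

theorem formula_ex {X : Ctx S} {A : Ty S.Base} (φ : Formula [Ty.prod A X.tensor]) :
    M.formula (.ex A φ) = H.ex (A.obj M.base) (M.ctx X)
      (H.reindex (ρ_ (FiniteProducts.prod (A.obj M.base) (M.ctx X))).inv (M.formula φ)) := by
  rw [formula]; rfl

theorem formula_neg {X : Ctx S} (φ : Formula X) : M.formula φ.neg = (M.formula φ)ᶜ := by
  induction φ with
  | atom R t => simp only [Formula.neg, formula]
  | natom R t => simp only [Formula.neg, formula, QLAlgebra.compl_involutive (L := L)]
  | top => simp only [Formula.neg, formula, QLAlgebra.compl_top L]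
  | bot => simp only [Formula.neg, formula, QLAlgebra.compl_bot L]
  | and φ ψ ih ih' => simp only [Formula.neg, formula, QLAlgebra.compl_inf L, ih, ih']
  | or φ ψ ih ih' => simp only [Formula.neg, formula, QLAlgebra.compl_sup L, ih, ih']
  | all A φ ih =>
    rw [Formula.neg, formula_ex, formula_all, H.compl_all, ih]
    exact congrArg (H.ex _ _) (H.reindex_compl _ _)
  | ex A φ ih =>
    rw [Formula.neg, formula_ex, formula_all, H.compl_ex, ih]
    exact congrArg (H.all _ _) (H.reindex_compl _ _)

theorem reindex_lift {X Y : Ctx S} {A : Ty S.Base} (s : Tm Y X.tensor)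
    (a : H.Fibre (M.ctx [Ty.prod A X.tensor])) :
    H.reindex (ρ_ (FiniteProducts.prod (A.obj M.base) (M.ctx Y))).inv
      (H.reindex (M.tm (Formula.lift A s)) a) =
    H.reindex (FiniteProducts.mapRight (A.obj M.base) (M.tm s))
      (H.reindex (ρ_ (FiniteProducts.prod (A.obj M.base) (M.ctx X))).inv a) := by
  rw [tm_lift]
  exact (H.reindex_inv_hom_comp _ _ _).trans (H.reindex_comp _ _ _)

/-- Beck–Chevalley is what makes the quantifier cases work; since the body of a quantifier lives in
another context, the statement is proved for all substitutions at once. -/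
theorem formula_subst {X : Ctx S} (φ : Formula X) : ∀ {Y : Ctx S} (s : Tm Y X.tensor),
    M.formula (φ.subst s) = H.reindex (M.tm s) (M.formula φ) := by
  induction φ with
  | atom R t =>
    intro Y s
    rw [Formula.subst, formula, formula, tm_letIn]
    exact H.reindex_comp _ _ _
  | natom R t =>
    intro Y s
    rw [Formula.subst, formula, formula, tm_letIn]
    refine Eq.trans ?_ (H.reindex_compl _ _).symm
    exact congrArg (·ᶜ) (H.reindex_comp _ _ _)
  | top => intro Y s; rw [Formula.subst, formula, formula]; exact (H.reindex_top _).symm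
  | bot => intro Y s; rw [Formula.subst, formula, formula]; exact (H.reindex_bot _).symm
  | and φ ψ ih ih' =>
    intro Y s
    rw [Formula.subst, formula, formula, ih, ih']
    exact (H.reindex_inf _ _ _).symm
  | or φ ψ ih ih' =>
    intro Y s
    rw [Formula.subst, formula, formula, ih, ih']
    exact (H.reindex_sup _ _ _).symm
  | all A φ ih =>
    intro Y s
    rw [Formula.subst, formula_all, formula_all, ih]
    exact (congrArg (H.all _ _) (M.reindex_lift s _)).trans (H.reindex_all _ _ _).symm
  | ex A φ ih =>
    intro Y s
    rw [Formula.subst, formula_ex, formula_ex, ih]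
    exact (congrArg (H.ex _ _) (M.reindex_lift s _)).trans (H.reindex_ex _ _ _).symm

theorem formula_weaken {X : Ctx S} (A : Ty S.Base) (φ : Formula X) :
    H.reindex (ρ_ (FiniteProducts.prod (A.obj M.base) (M.ctx X))).inv
      (M.formula (φ.weaken A)) =
    H.reindex (FiniteProducts.snd (A.obj M.base) (M.ctx X)) (M.formula φ) := by
  rw [Formula.weaken, formula_subst, tm_snd_var]
  exact H.reindex_inv_hom_comp _ _ _

theorem formula_inst {X : Ctx S} {A : Ty S.Base} (φ : Formula [Ty.prod A X.tensor])
    (t : Tm X A) : M.formula (φ.inst t) = H.reindex (FiniteProducts.lift (M.tm t) (𝟙 (M.ctx X)))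
      (H.reindex (ρ_ (FiniteProducts.prod (A.obj M.base) (M.ctx X))).inv (M.formula φ)) := by
  rw [Formula.inst, formula_subst, tm_single, tm, tm_tuple]
  exact H.reindex_comp _ _ _

/-- In the quantifier rules the side context is weakened to the product, where weakening is
reindexing along the projection; the adjunction then moves between the two fibres. Because the
principal formula stands alone, neither distributivity nor Frobenius reciprocity is called for. -/
theorem soundness {T : Set (Sequent S)} (hT : ∀ a ∈ T, M.Satisfies a) {X : Ctx S}
    {Γ Δ : Multiset (Formula X)} (h : Derivable L T X Γ Δ) :
    (Γ.map M.formula).inf ≤ (Δ.map M.formula).sup := by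
  induction h with
  | hyp h => exact hT _ h
  | ax φ => simp
  | cutL _ _ ih ih' =>
    simp only [Multiset.map_add, Multiset.inf_add, Multiset.map_singleton, Multiset.sup_singleton,
      Multiset.map_cons, Multiset.inf_cons] at ih ih' ⊢
    exact (inf_le_inf_right _ ih).trans ih'
  | cutR _ _ ih ih' =>
    simp only [Multiset.map_add, Multiset.sup_add, Multiset.map_singleton, Multiset.inf_singleton,
      Multiset.map_cons, Multiset.sup_cons] at ih ih' ⊢
    exact ih.trans (sup_le_sup_right ih' _)
  | weakL φ _ ih =>
    simp only [Multiset.map_cons, Multiset.inf_cons]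
    exact inf_le_right.trans ih
  | weakR φ _ ih =>
    simp only [Multiset.map_cons, Multiset.sup_cons]
    exact ih.trans le_sup_right
  | contrL _ ih => simpa using ih
  | contrR _ ih => simpa using ih
  | topR Γ => simp [formula]
  | botL Δ => simp [formula]
  | andL₁ _ ih =>
    simp only [Multiset.map_singleton, Multiset.inf_singleton, formula] at ih ⊢
    exact inf_le_left.trans ih
  | andL₂ _ ih =>
    simp only [Multiset.map_singleton, Multiset.inf_singleton, formula] at ih ⊢
    exact inf_le_right.trans ih
  | andR _ _ ih ih' =>
    simp only [Multiset.map_singleton, Multiset.sup_singleton, formula] at ih ih' ⊢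
    exact le_inf ih ih'
  | orL _ _ ih ih' =>
    simp only [Multiset.map_singleton, Multiset.inf_singleton, formula] at ih ih' ⊢
    exact sup_le ih ih'
  | orR₁ _ ih =>
    simp only [Multiset.map_singleton, Multiset.sup_singleton, formula] at ih ⊢
    exact ih.trans le_sup_left
  | orR₂ _ ih =>
    simp only [Multiset.map_singleton, Multiset.sup_singleton, formula] at ih ⊢
    exact ih.trans le_sup_right
  | allL t _ ih =>
    simp only [Multiset.map_singleton, Multiset.inf_singleton, formula_all, formula_inst] at ih ⊢
    exact (H.reindex_lift_all _ _).trans ih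
  | exR t _ ih =>
    simp only [Multiset.map_singleton, Multiset.sup_singleton, formula_ex, formula_inst] at ih ⊢
    exact ih.trans (H.le_reindex_lift_ex _ _)
  | @allR X Γ A φ _ ih =>
    simp only [Multiset.map_singleton, Multiset.sup_singleton, formula_all,
      Multiset.map_map] at ih ⊢
    rw [H.le_all_iff, H.reindex_inf_map]
    refine Eq.trans_le ?_ (H.reindex_mono
      (ρ_ (FiniteProducts.prod (A.obj M.base) (M.ctx X))).inv ih)
    refine Eq.trans ?_ (H.reindex_inf_map _ _ _).symm
    exact congrArg Multiset.inf (Multiset.map_congr rfl fun φ _ => (M.formula_weaken A φ).symm)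
  | @exL X Δ A φ _ ih =>
    simp only [Multiset.map_singleton, Multiset.inf_singleton, formula_ex,
      Multiset.map_map] at ih ⊢
    rw [H.ex_le_iff, H.reindex_sup_map]
    refine (H.reindex_mono
      (ρ_ (FiniteProducts.prod (A.obj M.base) (M.ctx X))).inv ih).trans_eq ?_
    refine Eq.trans (H.reindex_sup_map _ _ _) ?_
    exact congrArg Multiset.sup (Multiset.map_congr rfl fun φ _ => M.formula_weaken A φ)
  | @dual X Γ Δ _ ih =>
    have e (Γ : Multiset (Formula X)) :
        (Γ.map Formula.neg).map M.formula = (Γ.map M.formula).map (·ᶜ) := by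
      simp only [Multiset.map_map, Function.comp_def, formula_neg]
    rw [e, e, QLAlgebra.inf_map_compl L, QLAlgebra.sup_map_compl L]
    exact QLAlgebra.compl_antitone (L := L) _ _ ih
  | @transL X Γ Δ hL _ ih =>
    have e (Γ : Multiset (Formula X)) :
        (Γ.map Formula.neg).map M.formula = (Γ.map M.formula).map (·ᶜ) := by
      simp only [Multiset.map_map, Function.comp_def, formula_neg]
    rw [Multiset.map_add, Multiset.inf_add, e, QLAlgebra.inf_map_compl L, Multiset.map_zero,
      Multiset.sup_zero]
    exact (inf_le_inf_right _ ih).trans (QLAlgebra.inf_compl_le _ hL)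
  | @transR X Γ Δ hL _ ih =>
    have e (Γ : Multiset (Formula X)) :
        (Γ.map Formula.neg).map M.formula = (Γ.map M.formula).map (·ᶜ) := by
      simp only [Multiset.map_map, Function.comp_def, formula_neg]
    rw [Multiset.map_add, Multiset.sup_add, e, QLAlgebra.sup_map_compl L, Multiset.map_zero,
      Multiset.inf_zero]
    refine le_trans ?_ (sup_le_sup_left ih _)
    -- The law `⊤ ≤ aᶜ ⊔ a` is the complement of the contradiction law.
    rw [← QLAlgebra.compl_le_compl_iff (L := L), QLAlgebra.compl_sup L, QLAlgebra.compl_top L,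
      inf_comm]
    exact QLAlgebra.inf_compl_le _ hL
  | subst s _ ih =>
    rw [Multiset.map_map, Multiset.map_map]
    simp only [Function.comp_def, formula_subst]
    refine Eq.trans_le ?_ ((H.reindex_mono (M.tm s) ih).trans_eq (H.reindex_sup_map _ _ _))
    exact (H.reindex_inf_map _ _ _).symm
  | eq R h =>
    simp only [Multiset.map_singleton, Multiset.inf_singleton, Multiset.sup_singleton, formula,
      M.tm_eq_of_tmEq h, le_refl]

end Interpretation

end LFSq

namespace LFSq

/-! ### Syntactic substitution and terms up to provable equality -/

namespace Tm

variable {S : Signature.{u}}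

section SubstAt

variable {A : Ty S.Base} {Y : Ctx S} (s : Tm Y A) {D D₁ D₂ R X Q W : Ctx S}
  {m : Split D D₁ D₂} {p : Split D [A] R} {q : Split X Y R}

/-- The results of `locate` and `unassoc` are passed as equations, so that the dependent match in
`substAt` reduces by rewriting with any explicitly given splitting. The same form is used for each
former that splits its context. -/
theorem substAt_letStar_left {C : Ty S.Base} {p' : Split D₁ [A] Q} {r : Split R Q D₂}
    {k₁ : Split X W D₂} {k₂ : Split W Y Q} (h : Split.locate p m = Sum.inl ⟨Q, p', r⟩)
    (k : Split.unassoc q r = ⟨W, k₁, k₂⟩) (t : Tm D₁ Ty.unit) (t' : Tm D₂ C) :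
    substAt s (letStar m t t') p q = letStar k₁ (substAt s t p' k₂) t' := by
  rw [substAt, h]; simp only; rw [k]

theorem substAt_letStar_right {C : Ty S.Base} {p' : Split D₂ [A] Q} {r : Split R D₁ Q}
    {k₁ : Split X W D₁} {k₂ : Split W Y Q} (h : Split.locate p m = Sum.inr ⟨Q, p', r⟩)
    (k : Split.unassoc q r.symm = ⟨W, k₁, k₂⟩) (t : Tm D₁ Ty.unit) (t' : Tm D₂ C) :
    substAt s (letStar m t t') p q = letStar k₁.symm t (substAt s t' p' k₂) := by
  rw [substAt, h]; simp only; rw [k]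

theorem substAt_tens_left {B C : Ty S.Base} {p' : Split D₁ [A] Q} {r : Split R Q D₂}
    {k₁ : Split X W D₂} {k₂ : Split W Y Q} (h : Split.locate p m = Sum.inl ⟨Q, p', r⟩)
    (k : Split.unassoc q r = ⟨W, k₁, k₂⟩) (t : Tm D₁ B) (t' : Tm D₂ C) :
    substAt s (tens m t t') p q = tens k₁ (substAt s t p' k₂) t' := by
  rw [substAt, h]; simp only; rw [k]

theorem substAt_tens_right {B C : Ty S.Base} {p' : Split D₂ [A] Q} {r : Split R D₁ Q}
    {k₁ : Split X W D₁} {k₂ : Split W Y Q} (h : Split.locate p m = Sum.inr ⟨Q, p', r⟩)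
    (k : Split.unassoc q r.symm = ⟨W, k₁, k₂⟩) (t : Tm D₁ B) (t' : Tm D₂ C) :
    substAt s (tens m t t') p q = tens k₁.symm t (substAt s t' p' k₂) := by
  rw [substAt, h]; simp only; rw [k]

theorem substAt_letTens_left {B B' C : Ty S.Base} {p' : Split D₁ [A] Q} {r : Split R Q D₂}
    {k₁ : Split X W D₂} {k₂ : Split W Y Q} (h : Split.locate p m = Sum.inl ⟨Q, p', r⟩)
    (k : Split.unassoc q r = ⟨W, k₁, k₂⟩) (t : Tm D₁ (Ty.tensor B B'))
    (t' : Tm (B :: B' :: D₂) C) :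
    substAt s (letTens m t t') p q = letTens k₁ (substAt s t p' k₂) t' := by
  rw [substAt, h]; simp only; rw [k]

theorem substAt_letTens_right {B B' C : Ty S.Base} {p' : Split D₂ [A] Q} {r : Split R D₁ Q}
    {k₁ : Split X W D₁} {k₂ : Split W Y Q} (h : Split.locate p m = Sum.inr ⟨Q, p', r⟩)
    (k : Split.unassoc q r.symm = ⟨W, k₁, k₂⟩) (t : Tm D₁ (Ty.tensor B B'))
    (t' : Tm (B :: B' :: D₂) C) :
    substAt s (letTens m t t') p q =
      letTens k₁.symm t (substAt s t' p'.right.right k₂.right.right) := by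
  rw [substAt, h]; simp only; rw [k]

theorem substAt_app_left {B C : Ty S.Base} {p' : Split D₁ [A] Q} {r : Split R Q D₂}
    {k₁ : Split X W D₂} {k₂ : Split W Y Q} (h : Split.locate p m = Sum.inl ⟨Q, p', r⟩)
    (k : Split.unassoc q r = ⟨W, k₁, k₂⟩) (t : Tm D₁ (Ty.lolli B C)) (t' : Tm D₂ B) :
    substAt s (app m t t') p q = app k₁ (substAt s t p' k₂) t' := by
  rw [substAt, h]; simp only; rw [k]

theorem substAt_app_right {B C : Ty S.Base} {p' : Split D₂ [A] Q} {r : Split R D₁ Q}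
    {k₁ : Split X W D₁} {k₂ : Split W Y Q} (h : Split.locate p m = Sum.inr ⟨Q, p', r⟩)
    (k : Split.unassoc q r.symm = ⟨W, k₁, k₂⟩) (t : Tm D₁ (Ty.lolli B C)) (t' : Tm D₂ B) :
    substAt s (app m t t') p q = app k₁.symm t (substAt s t' p' k₂) := by
  rw [substAt, h]; simp only; rw [k]

end SubstAt

/-- When a variable is substituted for itself, the regrouped splitting is the old one; this makes
`substAt_var` an equality of raw terms. -/
theorem unassoc_of_locate_inl {A : Ty S.Base} {D D₁ D₂ R Q : Ctx S} {m : Split D D₁ D₂}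
    {p : Split D [A] R} {p' : Split D₁ [A] Q} {r : Split R Q D₂}
    (h : Split.locate p m = Sum.inl ⟨Q, p', r⟩) : Split.unassoc p r = ⟨D₁, m, p'⟩ := by
  have := Split.unassoc_assoc m p'
  rwa [Split.assoc_of_locate_inl h] at this

theorem unassoc_of_locate_inr {A : Ty S.Base} {D D₁ D₂ R Q : Ctx S} {m : Split D D₁ D₂}
    {p : Split D [A] R} {p' : Split D₂ [A] Q} {r : Split R D₁ Q}
    (h : Split.locate p m = Sum.inr ⟨Q, p', r⟩) :
    Split.unassoc p r.symm = ⟨D₂, m.symm, p'⟩ := by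
  have := Split.unassoc_assoc m.symm p'
  rwa [Split.assoc_of_locate_inr h] at this

theorem substAt_var {A : Ty S.Base} {D : Ctx S} {B : Ty S.Base} (t : Tm D B) :
    ∀ {R : Ctx S} (p : Split D [A] R), substAt var t p p = t := by
  induction t with
  | var =>
    intro R p
    cases p with
    | right p => cases p
    | left p => cases p; rw [substAt]
  | op f t ih => intro R p; rw [substAt, ih]
  | star => intro R p; cases p
  | letStar m t t' ih ih' =>
    intro R p
    rcases h : Split.locate p m with ⟨Q, p', r⟩ | ⟨Q, p', r⟩
    · rw [substAt_letStar_left _ h (unassoc_of_locate_inl h), ih]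
    · rw [substAt_letStar_right _ h (unassoc_of_locate_inr h), ih', Split.symm_symm]
  | tens m t t' ih ih' =>
    intro R p
    rcases h : Split.locate p m with ⟨Q, p', r⟩ | ⟨Q, p', r⟩
    · rw [substAt_tens_left _ h (unassoc_of_locate_inl h), ih]
    · rw [substAt_tens_right _ h (unassoc_of_locate_inr h), ih', Split.symm_symm]
  | letTens m t t' ih ih' =>
    intro R p
    rcases h : Split.locate p m with ⟨Q, p', r⟩ | ⟨Q, p', r⟩
    · rw [substAt_letTens_left _ h (unassoc_of_locate_inl h), ih]
    · rw [substAt_letTens_right _ h (unassoc_of_locate_inr h), ih', Split.symm_symm]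
  | lam t ih => intro R p; rw [substAt, ih]
  | app m t t' ih ih' =>
    intro R p
    rcases h : Split.locate p m with ⟨Q, p', r⟩ | ⟨Q, p', r⟩
    · rw [substAt_app_left _ h (unassoc_of_locate_inl h), ih]
    · rw [substAt_app_right _ h (unassoc_of_locate_inr h), ih', Split.symm_symm]
  | triv => intro R p; rw [substAt]
  | pair t t' ih ih' => intro R p; rw [substAt, ih, ih']
  | fst t ih => intro R p; rw [substAt, ih]
  | snd t ih => intro R p; rw [substAt, ih]

theorem substAt_var_allLeft {X : Ctx S} {A : Ty S.Base} (s : Tm X A) :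
    substAt s var (Split.left Split.nil) (Split.allLeft X) = s := by
  rw [substAt]

theorem substAt_app_closed {X Y D R : Ctx S} {A B C : Ty S.Base} (s : Tm Y A)
    (F : Tm [] (Ty.lolli B C)) (t : Tm D B) (p : Split D [A] R) (q : Split X Y R) :
    substAt s (app (Split.allRight D) F t) p q =
      app (Split.allRight X) F (substAt s t p q) := by
  rw [substAt_app_right s (Split.locate_allRight p) (k₁ := Split.allLeft X) (k₂ := q),
    Split.symm_allLeft]
  rw [Split.symm_allRight, Split.unassoc_allLeft]

end Tm

/-- Terms in context up to provable equality. -/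
def tmSetoid {S : Signature.{u}} (X : Ctx S) (A : Ty S.Base) : Setoid (Tm X A) where
  r := TmEq
  iseqv := ⟨TmEq.refl, TmEq.symm, TmEq.trans⟩

/-- Terms in context up to provable equality. -/
def El {S : Signature.{u}} (X : Ctx S) (A : Ty S.Base) : Type u := Quotient (tmSetoid X A)

namespace El

variable {S : Signature.{u}} {X Y Z U V W : Ctx S} {A B C D : Ty S.Base}

def mk (t : Tm X A) : El X A := Quotient.mk (tmSetoid X A) t

theorem mk_eq_mk {t t' : Tm X A} : mk t = mk t' ↔ TmEq t t' :=
  ⟨fun h => Quotient.exact (s := tmSetoid X A) h, fun h => Quotient.sound (s := tmSetoid X A) h⟩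

theorem sound {t t' : Tm X A} (h : TmEq t t') : mk t = mk t' := mk_eq_mk.2 h

@[elab_as_elim]
theorem ind {P : El X A → Prop} (h : ∀ t, P (mk t)) (t : El X A) : P t :=
  Quotient.ind (s := tmSetoid X A) h t

def var : El (S := S) [A] A := mk .var

def star : El (S := S) [] .unit := mk .star

def triv : El X .one := mk .triv

def op (f : S.Fn) : El X (S.dom f) → El X (S.cod f) :=
  Quotient.map (.op f) fun _ _ h => TmEq.op f h

def letStar (p : Split X Y Z) : El Y .unit → El Z C → El X C :=
  Quotient.map₂ (.letStar p) fun _ _ h _ _ h' => TmEq.letStar p h h'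

def tens (p : Split X Y Z) : El Y A → El Z B → El X (.tensor A B) :=
  Quotient.map₂ (.tens p) fun _ _ h _ _ h' => TmEq.tens p h h'

def letTens (p : Split X Y Z) : El Y (.tensor A B) → El (A :: B :: Z) C → El X C :=
  Quotient.map₂ (.letTens p) fun _ _ h _ _ h' => TmEq.letTens p h h'

def lam : El (A :: X) B → El X (.lolli A B) :=
  Quotient.map .lam fun _ _ h => TmEq.lam h

def app (p : Split X Y Z) : El Y (.lolli A B) → El Z A → El X B :=
  Quotient.map₂ (.app p) fun _ _ h _ _ h' => TmEq.app p h h'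

def pair : El X A → El X B → El X (.prod A B) :=
  Quotient.map₂ .pair fun _ _ h _ _ h' => TmEq.pair h h'

def fst : El X (.prod A B) → El X A :=
  Quotient.map .fst fun _ _ h => TmEq.fst h

def snd : El X (.prod A B) → El X B :=
  Quotient.map .snd fun _ _ h => TmEq.snd h

/-- Substitution for the first variable. -/
def subst (p : Split X Y Z) (s : El Y A) (t : El (A :: Z) C) : El X C :=
  app p.symm (lam t) s

/-- Defining substitution on classes as a β-redex gives compatibility with provable equality at no
cost; the β-equation identifies it with substitution of raw terms. -/
theorem subst_mk (p : Split X Y Z) (s : Tm Y A) (t : Tm (A :: Z) C) :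
    subst p (mk s) (mk t) = mk (Tm.subst p s t) := by
  refine (sound (TmEq.lam_beta p.symm t s)).trans ?_
  rw [Split.symm_symm]

theorem app_lam (p : Split X Y Z) (t : El (A :: Y) B) (s : El Z A) :
    app p (lam t) s = subst p.symm s t := by
  rw [subst, Split.symm_symm]

theorem lam_app_var (t : El X (.lolli A B)) :
    lam (app (.right (.allLeft X)) t var) = t := by
  induction t using ind with
  | h t => exact sound (TmEq.lam_eta t)

theorem subst_left_allRight_var (t : El (A :: Z) B) :
    subst (.left (.allRight Z)) var t = t := by
  induction t using ind with
  | h t => exact (subst_mk _ _ _).trans (congrArg mk (Tm.substAt_var t _))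

theorem app_lam_var (t : El (A :: X) B) : app (.right (.allLeft X)) (lam t) var = t := by
  rw [app_lam, Split.symm, Split.symm_allLeft, subst_left_allRight_var]

@[simp]
theorem subst_var (s : El X A) : subst (.allLeft X) s var = s := by
  induction s using ind with
  | h s => exact (subst_mk _ _ _).trans (congrArg mk (Tm.substAt_var_allLeft s))

theorem subst_tens_left {m : Split Z U V} {q : Split X Y Z} {k₁ : Split X W V}
    {k₂ : Split W Y U} (k : Split.unassoc q m = ⟨W, k₁, k₂⟩) (s : El Y A)
    (a : El (A :: U) B) (b : El V C) :
    subst q s (tens (.left m) a b) = tens k₁ (subst k₂ s a) b := by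
  induction s using ind with | h s
  induction a using ind with | h a
  induction b using ind with | h b
  rw [subst_mk]
  refine (subst_mk q s (.tens (.left m) a b)).trans (congrArg mk ?_)
  exact Tm.substAt_tens_left s (Split.locate_left_left m) k a b

theorem subst_tens_right {m : Split Z U V} {q : Split X Y Z} {k₁ : Split X W U}
    {k₂ : Split W Y V} (k : Split.unassoc q m.symm = ⟨W, k₁, k₂⟩) (s : El Y A)
    (a : El U B) (b : El (A :: V) C) :
    subst q s (tens (.right m) a b) = tens k₁.symm a (subst k₂ s b) := by
  induction s using ind with | h s
  induction a using ind with | h a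
  induction b using ind with | h b
  rw [subst_mk]
  refine (subst_mk q s (.tens (.right m) a b)).trans (congrArg mk ?_)
  exact Tm.substAt_tens_right s (Split.locate_left_right m) k a b

theorem subst_app_left {m : Split Z U V} {q : Split X Y Z} {k₁ : Split X W V}
    {k₂ : Split W Y U} (k : Split.unassoc q m = ⟨W, k₁, k₂⟩) (s : El Y A)
    (a : El (A :: U) (.lolli B C)) (b : El V B) :
    subst q s (app (.left m) a b) = app k₁ (subst k₂ s a) b := by
  induction s using ind with | h s
  induction a using ind with | h a
  induction b using ind with | h b
  rw [subst_mk]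
  refine (subst_mk q s (.app (.left m) a b)).trans (congrArg mk ?_)
  exact Tm.substAt_app_left s (Split.locate_left_left m) k a b

theorem subst_app_right {m : Split Z U V} {q : Split X Y Z} {k₁ : Split X W U}
    {k₂ : Split W Y V} (k : Split.unassoc q m.symm = ⟨W, k₁, k₂⟩) (s : El Y A)
    (a : El U (.lolli B C)) (b : El (A :: V) B) :
    subst q s (app (.right m) a b) = app k₁.symm a (subst k₂ s b) := by
  induction s using ind with | h s
  induction a using ind with | h a
  induction b using ind with | h b
  rw [subst_mk]
  refine (subst_mk q s (.app (.right m) a b)).trans (congrArg mk ?_)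
  exact Tm.substAt_app_right s (Split.locate_left_right m) k a b

theorem subst_letStar_left {m : Split Z U V} {q : Split X Y Z} {k₁ : Split X W V}
    {k₂ : Split W Y U} (k : Split.unassoc q m = ⟨W, k₁, k₂⟩) (s : El Y A)
    (a : El (A :: U) .unit) (b : El V C) :
    subst q s (letStar (.left m) a b) = letStar k₁ (subst k₂ s a) b := by
  induction s using ind with | h s
  induction a using ind with | h a
  induction b using ind with | h b
  rw [subst_mk]
  refine (subst_mk q s (.letStar (.left m) a b)).trans (congrArg mk ?_)
  exact Tm.substAt_letStar_left s (Split.locate_left_left m) k a b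

theorem subst_op (q : Split X Y Z) (s : El Y A) (f : S.Fn) (t : El (A :: Z) (S.dom f)) :
    subst q s (op f t) = op f (subst q s t) := by
  induction s using ind with | h s
  induction t using ind with | h t
  rw [subst_mk]
  exact (subst_mk q s (.op f t)).trans (congrArg mk (by rw [Tm.subst, Tm.substAt]; rfl))

theorem subst_pair (q : Split X Y Z) (s : El Y A) (a : El (A :: Z) B) (b : El (A :: Z) C) :
    subst q s (pair a b) = pair (subst q s a) (subst q s b) := by
  induction s using ind with | h s
  induction a using ind with | h a
  induction b using ind with | h b
  rw [subst_mk, subst_mk]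
  exact (subst_mk q s (.pair a b)).trans (congrArg mk (by rw [Tm.subst, Tm.substAt]; rfl))

theorem subst_fst (q : Split X Y Z) (s : El Y A) (t : El (A :: Z) (.prod B C)) :
    subst q s (fst t) = fst (subst q s t) := by
  induction s using ind with | h s
  induction t using ind with | h t
  rw [subst_mk]
  exact (subst_mk q s (.fst t)).trans (congrArg mk (by rw [Tm.subst, Tm.substAt]; rfl))

theorem subst_snd (q : Split X Y Z) (s : El Y A) (t : El (A :: Z) (.prod B C)) :
    subst q s (snd t) = snd (subst q s t) := by
  induction s using ind with | h s
  induction t using ind with | h t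
  rw [subst_mk]
  exact (subst_mk q s (.snd t)).trans (congrArg mk (by rw [Tm.subst, Tm.substAt]; rfl))

theorem eq_triv (t : El X .one) : t = triv := by
  induction t using ind with | h t
  exact sound (TmEq.triv_eta t)

@[simp]
theorem fst_pair (a : El X A) (b : El X B) : fst (pair a b) = a := by
  induction a using ind with | h a
  induction b using ind with | h b
  exact sound (TmEq.fst_beta a b)

@[simp]
theorem snd_pair (a : El X A) (b : El X B) : snd (pair a b) = b := by
  induction a using ind with | h a
  induction b using ind with | h b
  exact sound (TmEq.snd_beta a b)

theorem pair_fst_snd (t : El X (.prod A B)) : pair (fst t) (snd t) = t := by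
  induction t using ind with | h t
  exact sound (TmEq.pair_eta t)

theorem letStar_star (t : El X A) : letStar (.allRight X) star t = t := by
  induction t using ind with | h t
  exact sound (TmEq.star_beta t)

theorem letStar_subst (p : Split X Y Z) (s : El Y .unit) (t : El (.unit :: Z) C) :
    letStar p s (subst (.allRight Z) star t) = subst p s t := by
  induction s using ind with | h s
  induction t using ind with | h t
  rw [subst_mk, star, subst_mk]
  exact sound (TmEq.star_eta p s t)

theorem letTens_subst (p : Split X Y Z) (s : El Y (.tensor A B))
    (t : El (.tensor A B :: Z) C) :
    letTens p s (subst (.left (.left (.allRight Z))) (tens (.left (.right .nil)) var var) t) =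
      subst p s t := by
  induction s using ind with | h s
  induction t using ind with | h t
  rw [subst_mk]
  refine Eq.trans ?_ (sound (TmEq.tens_eta p s t))
  exact congrArg (letTens p (mk s)) (subst_mk _ _ _)

theorem letTens_mk_tens (p : Split X Y Z) (q : Split Y U V) (a : Tm U A) (b : Tm V B)
    (t : Tm (A :: B :: Z) C) :
    letTens p (tens q (mk a) (mk b)) (mk t) = subst (Split.assoc p q.symm).2.1 (mk b)
      (subst (.right (Split.assoc p q.symm).2.2) (mk a) (mk t)) := by
  rw [subst_mk, subst_mk]
  exact sound (TmEq.tens_beta p q a b t)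

theorem letTens_tens (p : Split X Y Z) (q : Split Y U V) (a : El U A) (b : El V B)
    (t : El (A :: B :: Z) C) :
    letTens p (tens q a b) t = subst (Split.assoc p q.symm).2.1 b
      (subst (.right (Split.assoc p q.symm).2.2) a t) := by
  induction a using ind with | h a
  induction b using ind with | h b
  induction t using ind with | h t
  exact letTens_mk_tens p q a b t

end El

end LFSq

namespace LFSq

/-! ### Closed linear functions and the structural maps -/

namespace El

variable {S : Signature.{u}} {X Y Z U V W : Ctx S} {A B C D : Ty S.Base}

theorem subst_lam_mk (q : Split X Y Z) (s : Tm Y A) (t : Tm (B :: A :: Z) C) :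
    subst q (mk s) (lam (mk t)) =
      lam (mk (Tm.substAt s t (.right (.left (.allRight Z))) (.right q))) :=
  (subst_mk q s (.lam t)).trans (congrArg mk (by rw [Tm.subst, Tm.substAt]))

theorem subst_lam_lam_mk (q : Split X Y Z) (s : Tm Y A) (t : Tm (C :: B :: A :: Z) D) :
    subst q (mk s) (lam (lam (mk t))) =
      lam (lam (mk (Tm.substAt s t (.right (.right (.left (.allRight Z))))
        (.right (.right q))))) :=
  (subst_mk q s (.lam (.lam t))).trans
    (congrArg mk (by rw [Tm.subst, Tm.substAt, Tm.substAt]))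

/-- Application of a closed function to a term in context. -/
def act (F : El (S := S) [] (.lolli A B)) (s : El X A) : El X B :=
  app (.allRight X) F s

theorem subst_act (q : Split X Y Z) (s : El Y A) (F : El (S := S) [] (.lolli B C))
    (t : El (A :: Z) B) : subst q s (act F t) = act F (subst q s t) := by
  induction s using ind with | h s
  induction t using ind with | h t
  induction F using ind with | h F
  rw [subst_mk]
  exact (subst_mk q s (.app (.allRight _) F t)).trans
    (congrArg mk (Tm.substAt_app_closed s F t _ _))

theorem act_lam (b : El [A] B) (s : El X A) : act (lam b) s = subst (.allLeft X) s b := by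
  rw [act, app_lam, Split.symm_allRight]

/-- By η for `⊸`, a closed function is the abstraction of its value on a variable. -/
theorem act_ext {F G : El (S := S) [] (.lolli A B)} (h : act F var = act G var) : F = G := by
  rw [← lam_app_var F, ← lam_app_var G]
  exact congrArg lam h

def idHom (A : Ty S.Base) : El (S := S) [] (.lolli A A) := lam var

def comp (F : El (S := S) [] (.lolli A B)) (G : El (S := S) [] (.lolli B C)) :
    El (S := S) [] (.lolli A C) := lam (act G (act F var))

theorem act_idHom (s : El X A) : act (idHom A) s = s := by
  rw [idHom, act_lam, subst_var]

theorem act_comp (F : El (S := S) [] (.lolli A B)) (G : El (S := S) [] (.lolli B C))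
    (s : El X A) : act (comp F G) s = act G (act F s) := by
  rw [comp, act_lam, subst_act, subst_act, subst_var]

/-- Two functions on a tensor product agree if they agree on a generic pure tensor. -/
theorem act_tens_ext {F G : El (S := S) [] (.lolli (.tensor A B) C)}
    (h : act F (tens (.left (.right .nil)) var var) =
      act G (tens (.left (.right .nil)) var var)) : F = G := by
  apply act_ext
  -- By η for `⊗`, the value of `F` at a variable is a `let` whose body is its value at a generic
  -- pair.
  have e (F : El (S := S) [] (.lolli (.tensor A B) C)) :
      act F var = letTens (.left .nil) var (act F (tens (.left (.right .nil)) var var)) := by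
    have := letTens_subst (.left .nil) var (act F (var (A := .tensor A B)))
    rw [subst_act, subst_act] at this
    have e₁ := subst_var (tens (.left (.right .nil)) (var (S := S) (A := A)) (var (A := B)))
    have e₂ := subst_var (var (S := S) (A := .tensor A B))
    simp only [Split.allLeft] at e₁ e₂
    simp only [Split.allRight] at this
    rw [e₁, e₂] at this
    exact this.symm
  rw [e F, e G, h]

theorem act_unit_ext {F G : El (S := S) [] (.lolli .unit C)}
    (h : act F star = act G star) : F = G := by
  apply act_ext
  have e (F : El (S := S) [] (.lolli .unit C)) :
      act F var = letStar (.left .nil) var (act F star) := by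
    have := letStar_subst (.left .nil) var (act F (var (A := .unit)))
    rw [subst_act, subst_act] at this
    have e₁ := subst_var (star (S := S))
    have e₂ := subst_var (var (S := S) (A := .unit))
    simp only [Split.allLeft] at e₁ e₂
    simp only [Split.allRight] at this
    rw [e₁, e₂] at this
    exact this.symm
  rw [e F, e G, h]

/-- The left factor is the one abstracted, as required for an internal hom that is right adjoint to
tensoring on the left. -/
def curry (F : El (S := S) [] (.lolli (.tensor A B) C)) :
    El (S := S) [] (.lolli B (.lolli A C)) :=
  lam (lam (act F (tens (.left (.right .nil)) var var)))

theorem act_curry (F : El (S := S) [] (.lolli (.tensor A B) C)) (s : El X B) :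
    act (curry F) s = lam (act F (tens (.left (.allRight X)) var s)) := by
  rw [curry, act_lam]
  induction s using ind with | h s
  induction F using ind with | h F
  refine (subst_lam_mk _ s (.app (.allRight _) F (.tens (.left (.right .nil)) .var .var))).trans ?_
  rw [Tm.substAt_app_closed, Tm.substAt_tens_right (m := .left (.right .nil)) (Q := [])
    (p' := .left .nil) (r := .left .nil) (W := X) (k₁ := .right (.allLeft X))
    (k₂ := .allLeft X) s rfl, Tm.substAt_var_allLeft, Split.symm, Split.symm_allLeft]
  · rfl
  · rw [Split.symm, Split.symm, Split.unassoc_right_right, Split.unassoc_nil]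

def uncurry (G : El (S := S) [] (.lolli B (.lolli A C))) :
    El (S := S) [] (.lolli (.tensor A B) C) :=
  lam (letTens (.left .nil) var (app (.right (.left .nil)) (act G var) var))

theorem subst_letTens_var (s : El X (.tensor A B)) (t : El [A, B] C) :
    subst (.allLeft X) s (letTens (.left .nil) var t) = letTens (.allLeft X) s t := by
  induction s using ind with | h s
  induction t using ind with | h t
  refine (subst_mk _ s (.letTens (.left .nil) .var t)).trans (congrArg mk ?_)
  rw [Tm.subst, Tm.substAt_letTens_left s (Split.locate_left_left .nil) (Split.unassoc_nil X)]
  exact congrArg (Tm.letTens _ · _) (Tm.substAt_var_allLeft s)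

theorem letTens_allLeft_tens (q : Split X U V) (a : El U A) (b : El V B) (t : El [A, B] C) :
    letTens (.allLeft X) (tens q a b) t = subst q.symm b (subst (.right (.allLeft U)) a t) := by
  rw [letTens_tens, Split.assoc_allLeft]

theorem act_uncurry (G : El (S := S) [] (.lolli B (.lolli A C))) (p : Split X U V) (a : El U A)
    (b : El V B) : act (uncurry G) (tens p a b) = app p.symm (act G b) a := by
  rw [uncurry, act_lam, subst_letTens_var, letTens_allLeft_tens,
    subst_app_right (k₁ := .right (.allLeft U)) (k₂ := .allLeft U), subst_var, Split.symm,
    Split.symm_allLeft, subst_app_left (k₁ := p.symm) (k₂ := .allLeft V), subst_act, subst_var]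
  · exact Split.unassoc_allRight _
  · rw [Split.symm, Split.symm, Split.unassoc_right_right, Split.unassoc_nil]

theorem app_lam_act (p : Split X U V) (F : El (S := S) [] (.lolli (.tensor A B) C)) (a : El U A)
    (b : El V B) : app p.symm (lam (act F (tens (.left (.allRight V)) var b))) a =
      act F (tens p a b) := by
  rw [app_lam, subst_act, Split.symm_symm, subst_tens_left (Split.unassoc_allRight p), subst_var]

theorem uncurry_curry (F : El (S := S) [] (.lolli (.tensor A B) C)) :
    uncurry (curry F) = F := by
  apply act_tens_ext
  rw [act_uncurry, act_curry, app_lam_act]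

theorem curry_uncurry (G : El (S := S) [] (.lolli B (.lolli A C))) :
    curry (uncurry G) = G := by
  apply act_ext
  rw [act_curry, act_uncurry, Split.symm, Split.symm_allRight, lam_app_var]

/-- The braiding. -/
def swap (A B : Ty S.Base) : El (S := S) [] (.lolli (.tensor A B) (.tensor B A)) :=
  uncurry (lam (lam (tens (.right (.left .nil)) var var)))

/-- On pure tensors the braiding only mirrors the splitting. Together with `act_assocHom` this
reduces coherence in the term model to computation with splittings. -/
theorem act_swap (p : Split X U V) (a : El U A) (b : El V B) :
    act (swap A B) (tens p a b) = tens p.symm b a := by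
  have : act (lam (lam (tens (.right (.left .nil)) var var))) b =
      lam (tens (.right (.allLeft V)) b (var (A := A))) := by
    rw [act_lam]
    induction b using ind with | h b
    refine (subst_lam_mk _ b (.tens (.right (.left .nil)) .var .var)).trans ?_
    rw [Tm.substAt_tens_left (m := .right (.left .nil)) (Q := [])
      (p' := .left .nil) (r := .right .nil) (W := V) (k₁ := .right (.allLeft V))
      (k₂ := .allLeft V) b rfl, Tm.substAt_var_allLeft]
    · rfl
    · rw [Split.unassoc_right_right, Split.unassoc_nil]
  rw [swap, act_uncurry, this, app_lam, Split.symm_symm,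
    subst_tens_right (k₁ := p) (k₂ := .allLeft U), subst_var]
  rw [Split.symm_allLeft, Split.unassoc_allRight]

/-- Tensoring a function on the left with an identity. -/
def tensLeft (A : Ty S.Base) (G : El (S := S) [] (.lolli B C)) :
    El (S := S) [] (.lolli (.tensor A B) (.tensor A C)) :=
  uncurry (comp G (curry (idHom _)))

theorem act_tensLeft (G : El (S := S) [] (.lolli B C)) (p : Split X U V) (a : El U A)
    (b : El V B) : act (tensLeft A G) (tens p a b) = tens p a (act G b) := by
  rw [tensLeft, act_uncurry, act_comp, act_curry, app_lam_act, act_idHom]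

def tensRight (F : El (S := S) [] (.lolli A B)) (C : Ty S.Base) :
    El (S := S) [] (.lolli (.tensor A C) (.tensor B C)) :=
  comp (swap A C) (comp (tensLeft C F) (swap C B))

theorem act_tensRight (F : El (S := S) [] (.lolli A B)) (p : Split X U V) (a : El U A)
    (b : El V C) : act (tensRight F C) (tens p a b) = tens p (act F a) b := by
  rw [tensRight, act_comp, act_swap, act_comp, act_tensLeft, act_swap, Split.symm_symm]

/-- Currying in the second factor. -/
def uncurryRight (G : El (S := S) [] (.lolli A (.lolli B C))) :
    El (S := S) [] (.lolli (.tensor A B) C) := comp (swap A B) (uncurry G)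

theorem act_uncurryRight (G : El (S := S) [] (.lolli A (.lolli B C))) (p : Split X U V)
    (a : El U A) (b : El V B) : act (uncurryRight G) (tens p a b) = app p (act G a) b := by
  rw [uncurryRight, act_comp, act_swap, act_uncurry, Split.symm_symm]

def assocHom (A B C : Ty S.Base) :
    El (S := S) [] (.lolli (.tensor (.tensor A B) C) (.tensor A (.tensor B C))) :=
  uncurryRight (uncurryRight (lam (lam (lam
    (tens (.right (.right (.left .nil))) var (tens (.right (.left .nil)) var var))))))

/-- The associator is written with three abstractions so that it can be applied to one component at
a time. The steps `e₁` and `e₂` compute the abstracted function after the first and second argument,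
and the splittings met along the way assemble into `Split.assoc p q`. -/
theorem act_assocHom (p : Split X Y Z) (q : Split Y U V) (a : El U A) (b : El V B) (c : El Z C) :
    act (assocHom A B C) (tens p (tens q a b) c) =
      tens (Split.assoc p q).2.1 a (tens (Split.assoc p q).2.2 b c) := by
  rw [assocHom, act_uncurryRight, act_uncurryRight, act_lam]
  induction a using ind with | h a
  induction b using ind with | h b
  have e₁ : subst (.allLeft U) (mk a) (lam (lam
      (tens (.right (.right (.left .nil))) (var (A := A))
        (tens (.right (.left .nil)) (var (A := B)) (var (A := C)))))) =
      lam (lam (mk (.tens (.right (.right (.allLeft U))) a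
        (.tens (.right (.left .nil)) .var .var)))) := by
    refine (subst_lam_lam_mk _ a (.tens (.right (.right (.left .nil))) .var
      (.tens (.right (.left .nil)) .var .var))).trans ?_
    rw [Tm.substAt_tens_left (m := .right (.right (.left .nil))) (Q := [])
      (p' := .left .nil) (r := .right (.right .nil)) (W := U)
      (k₁ := .right (.right (.allLeft U))) (k₂ := .allLeft U) a rfl, Tm.substAt_var_allLeft]
    rw [Split.unassoc_right_right, Split.unassoc_right_right, Split.unassoc_nil]
  have e₂ : app q (lam (lam (mk (.tens (.right (.right (.allLeft U))) a
        (.tens (.right (.left .nil)) .var .var))))) (mk b) =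
      lam (tens (.right q) (mk a) (tens (.right (.allLeft V)) (mk b) (var (A := C)))) := by
    rw [app_lam]
    refine (subst_lam_mk _ b _).trans ?_
    rw [Tm.substAt_tens_right (m := .right (.right (.allLeft U))) (Q := [C])
      (p' := .right (.left .nil)) (r := .right (.allLeft U)) (W := C :: V)
      (k₁ := .left q.symm) (k₂ := .right (.allLeft V)) b,
      Tm.substAt_tens_left (m := .right (.left .nil)) (Q := [])
      (p' := .left .nil) (r := .right .nil) (W := V) (k₁ := .right (.allLeft V))
      (k₂ := .allLeft V) b rfl, Tm.substAt_var_allLeft, Split.symm, Split.symm_symm]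
    · rfl
    · rw [Split.unassoc_right_right, Split.unassoc_nil]
    · simp only [Split.locate, Split.locate_left_right]; rfl
    · rw [Split.symm, Split.symm_allLeft, Split.unassoc_right_left, Split.unassoc_allRight]
  rw [e₁, e₂, app_lam, subst_tens_right (Split.unassoc_symm p q),
    subst_tens_right (k₁ := (Split.assoc p q).2.2.symm) (k₂ := .allLeft Z), subst_var,
    Split.symm_symm, Split.symm_symm]
  rw [Split.symm_allLeft, Split.unassoc_allRight]

/-- Built from braidings and the associator in the same way as `Split.unassoc` is built from `symm`
and `assoc`, so that its action on pure tensors matches by unfolding. -/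
def assocInv (A B C : Ty S.Base) :
    El (S := S) [] (.lolli (.tensor A (.tensor B C)) (.tensor (.tensor A B) C)) :=
  comp (swap _ _) (comp (tensRight (swap _ _) _) (comp (assocHom _ _ _)
    (comp (swap _ _) (tensRight (swap _ _) _))))

theorem act_assocInv (p : Split X Y Z) (q : Split Z U V) (a : El Y A) (b : El U B) (c : El V C) :
    act (assocInv A B C) (tens p a (tens q b c)) =
      tens (Split.unassoc p q).2.1 (tens (Split.unassoc p q).2.2 a b) c := by
  simp only [assocInv, act_comp, act_swap, act_tensRight, act_assocHom]
  rfl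

def leftUnitHom (A : Ty S.Base) : El (S := S) [] (.lolli (.tensor .unit A) A) :=
  uncurry (lam (lam (letStar (.left (.right .nil)) var var)))

theorem act_leftUnitHom (p : Split X U V) (s : El U .unit) (a : El V A) :
    act (leftUnitHom A) (tens p s a) = letStar p s a := by
  have : act (lam (lam (letStar (.left (.right .nil)) var var))) a =
      lam (letStar (.left (.allRight V)) var a) := by
    rw [act_lam]
    induction a using ind with | h a
    refine (subst_lam_mk _ a (.letStar (.left (.right .nil)) .var .var)).trans ?_
    rw [Tm.substAt_letStar_right (m := .left (.right .nil)) (Q := [])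
      (p' := .left .nil) (r := .left .nil) (W := V) (k₁ := .right (.allLeft V))
      (k₂ := .allLeft V) a rfl, Tm.substAt_var_allLeft, Split.symm, Split.symm_allLeft]
    · rfl
    · rw [Split.symm, Split.symm, Split.unassoc_right_right, Split.unassoc_nil]
  rw [leftUnitHom, act_uncurry, this, app_lam, Split.symm_symm,
    subst_letStar_left (Split.unassoc_allRight p), subst_var]

def leftUnitInv (A : Ty S.Base) : El (S := S) [] (.lolli A (.tensor .unit A)) :=
  lam (tens (.right .nil) star var)

theorem act_leftUnitInv (a : El X A) :
    act (leftUnitInv A) a = tens (.allRight X) star a := by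
  rw [leftUnitInv, act_lam, subst_tens_right (m := .nil) (Split.unassoc_nil X), subst_var,
    Split.symm_allLeft]

end El

end LFSq

namespace LFSq

/-! ### Coherence laws on generic tensors -/

namespace El

variable {S : Signature.{u}} {X Y Z U V W : Ctx S} {A B C D A' B' C' E : Ty S.Base}

theorem act_leftUnitHom_star (a : El X A) :
    act (leftUnitHom A) (tens (.allRight X) star a) = a := by
  rw [act_leftUnitHom, letStar_star]

def rightUnitHom (A : Ty S.Base) : El (S := S) [] (.lolli (.tensor A .unit) A) :=
  comp (swap _ _) (leftUnitHom A)

def rightUnitInv (A : Ty S.Base) : El (S := S) [] (.lolli A (.tensor A .unit)) :=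
  comp (leftUnitInv A) (swap _ _)

theorem act_rightUnitInv (a : El X A) :
    act (rightUnitInv A) a = tens (.allLeft X) a star := by
  rw [rightUnitInv, act_comp, act_leftUnitInv, act_swap, Split.symm_allRight]

theorem act_rightUnitHom_star (a : El X A) :
    act (rightUnitHom A) (tens (.allLeft X) a star) = a := by
  rw [rightUnitHom, act_comp, act_swap, Split.symm_allLeft, act_leftUnitHom_star]

theorem act_tens_unit_ext {F G : El (S := S) [] (.lolli (.tensor A .unit) C)}
    (h : act F (tens (.allLeft [A]) var star) = act G (tens (.allLeft [A]) var star)) :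
    F = G := by
  rw [← uncurry_curry F, ← uncurry_curry G]
  refine congrArg uncurry (act_unit_ext ?_)
  rw [act_curry, act_curry]
  exact congrArg lam h

/-- Currying abstracts the left factor; swapping first leaves the left factor as the argument. This
lets extensionality be iterated inside the left factor, as `act_curry` lets it be iterated on the
right. -/
theorem curry_swap_ext {F G : El (S := S) [] (.lolli (.tensor A B) C)}
    (h : curry (comp (swap _ _) F) = curry (comp (swap _ _) G)) : F = G := by
  have h' := congrArg uncurry h
  rw [uncurry_curry, uncurry_curry] at h'
  apply act_tens_ext
  have e := congrArg (fun F => act F (tens (.right (.left .nil)) (var (A := B))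
    (var (S := S) (A := A)))) h'
  simp only [act_comp, act_swap] at e
  exact e

theorem act_unit_tens_ext {F G : El (S := S) [] (.lolli (.tensor .unit A) C)}
    (h : act F (tens (.allRight [A]) star var) = act G (tens (.allRight [A]) star var)) :
    F = G := by
  apply curry_swap_ext
  refine congrArg curry (act_tens_unit_ext ?_)
  rw [act_comp, act_comp, act_swap, Split.symm_allLeft, h]

theorem act_tens_right_ext {F G : El (S := S) [] (.lolli (.tensor A (.tensor B C)) D)}
    (h : act F (tens (.left (.right (.right .nil))) var (tens (.left (.right .nil)) var var)) =
      act G (tens (.left (.right (.right .nil))) var (tens (.left (.right .nil)) var var))) :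
    F = G := by
  rw [← uncurry_curry F, ← uncurry_curry G]
  refine congrArg uncurry (act_tens_ext ?_)
  rw [act_curry, act_curry]
  exact congrArg lam h

theorem act_curry_swap (F : El (S := S) [] (.lolli (.tensor A B) C)) (s : El X A) :
    act (curry (comp (swap _ _) F)) s = lam (act F (tens (.right (.allLeft X)) s var)) := by
  rw [act_curry, act_comp, act_swap, Split.symm, Split.symm_allRight]

theorem act_tens_left_ext {F G : El (S := S) [] (.lolli (.tensor (.tensor A B) C) D)}
    (h : act F (tens (.right (.left (.left .nil))) (tens (.left (.right .nil)) var var) var) =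
      act G (tens (.right (.left (.left .nil))) (tens (.left (.right .nil)) var var) var)) :
    F = G := by
  refine curry_swap_ext (act_tens_ext ?_)
  rw [act_curry_swap, act_curry_swap]
  exact congrArg lam h

theorem act_tens_left_unit_ext {F G : El (S := S) [] (.lolli (.tensor (.tensor A .unit) C) D)}
    (h : act F (tens (.right (.allLeft [A])) (tens (.allLeft [A]) var star) var) =
      act G (tens (.right (.allLeft [A])) (tens (.allLeft [A]) var star) var)) :
    F = G := by
  refine curry_swap_ext (act_tens_unit_ext ?_)
  rw [act_curry_swap, act_curry_swap, h]

theorem act_tens_left_left_ext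
    {F G : El (S := S) [] (.lolli (.tensor (.tensor (.tensor A B) C) D) E)}
    (h : act F (tens (.right (.allLeft [C, A, B])) (tens (.right (.left (.left .nil)))
      (tens (.left (.right .nil)) var var) var) var) =
      act G (tens (.right (.allLeft [C, A, B])) (tens (.right (.left (.left .nil)))
      (tens (.left (.right .nil)) var var) var) var)) :
    F = G := by
  refine curry_swap_ext (act_tens_left_ext ?_)
  rw [act_curry_swap, act_curry_swap, h]

theorem id_comp (F : El (S := S) [] (.lolli A B)) : comp (idHom A) F = F :=
  act_ext (by rw [act_comp, act_idHom])

theorem comp_id (F : El (S := S) [] (.lolli A B)) : comp F (idHom B) = F :=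
  act_ext (by rw [act_comp, act_idHom])

theorem comp_assoc (F : El (S := S) [] (.lolli A B)) (G : El (S := S) [] (.lolli B C))
    (H : El (S := S) [] (.lolli C D)) : comp (comp F G) H = comp F (comp G H) :=
  act_ext (by simp only [act_comp])

def tensHom (F : El (S := S) [] (.lolli A B)) (G : El (S := S) [] (.lolli A' B')) :
    El (S := S) [] (.lolli (.tensor A A') (.tensor B B')) :=
  comp (tensRight F _) (tensLeft _ G)

theorem act_tensHom (F : El (S := S) [] (.lolli A B)) (G : El (S := S) [] (.lolli A' B'))
    (p : Split X U V) (a : El U A) (b : El V A') :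
    act (tensHom F G) (tens p a b) = tens p (act F a) (act G b) := by
  rw [tensHom, act_comp, act_tensRight, act_tensLeft]

theorem tensHom_idHom : tensHom (idHom A) (idHom (S := S) B) = idHom _ :=
  act_tens_ext (by simp only [act_tensHom, act_idHom])

theorem tensHom_comp (F : El (S := S) [] (.lolli A B)) (F' : El (S := S) [] (.lolli A' B'))
    (G : El (S := S) [] (.lolli B C)) (G' : El (S := S) [] (.lolli B' C')) :
    comp (tensHom F F') (tensHom G G') = tensHom (comp F G) (comp F' G') :=
  act_tens_ext (by simp only [act_tensHom, act_comp])

theorem tensLeft_idHom : tensLeft A (idHom (S := S) B) = idHom _ :=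
  act_tens_ext (by simp only [act_tensLeft, act_idHom])

theorem tensRight_idHom : tensRight (idHom (S := S) A) B = idHom _ :=
  act_tens_ext (by simp only [act_tensRight, act_idHom])

theorem assocHom_naturality (F : El (S := S) [] (.lolli A A')) (G : El (S := S) [] (.lolli B B'))
    (H : El (S := S) [] (.lolli C C')) :
    comp (tensHom (tensHom F G) H) (assocHom _ _ _) =
      comp (assocHom _ _ _) (tensHom F (tensHom G H)) :=
  act_tens_left_ext (by simp only [act_comp, act_tensHom, act_assocHom])

theorem leftUnitHom_naturality (F : El (S := S) [] (.lolli A B)) :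
    comp (tensLeft .unit F) (leftUnitHom B) = comp (leftUnitHom A) F :=
  act_unit_tens_ext (by simp only [act_comp, act_tensLeft, act_leftUnitHom_star])

theorem rightUnitHom_naturality (F : El (S := S) [] (.lolli A B)) :
    comp (tensRight F .unit) (rightUnitHom B) = comp (rightUnitHom A) F :=
  act_tens_unit_ext (by simp only [act_comp, act_tensRight, act_rightUnitHom_star])

theorem assocHom_assocInv : comp (assocHom A B C) (assocInv (S := S) A B C) = idHom _ :=
  act_tens_left_ext (by
    simp only [act_comp, act_assocHom, act_assocInv, act_idHom]; rfl)

theorem assocInv_assocHom : comp (assocInv A B C) (assocHom (S := S) A B C) = idHom _ :=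
  act_tens_right_ext (by
    simp only [act_comp, act_assocHom, act_assocInv, act_idHom]; rfl)

theorem leftUnitHom_leftUnitInv :
    comp (leftUnitHom A) (leftUnitInv (S := S) A) = idHom _ :=
  act_unit_tens_ext (by
    simp only [act_comp, act_leftUnitHom_star, act_leftUnitInv, act_idHom])

theorem leftUnitInv_leftUnitHom :
    comp (leftUnitInv A) (leftUnitHom (S := S) A) = idHom _ :=
  act_ext (by simp only [act_comp, act_leftUnitHom_star, act_leftUnitInv, act_idHom])

theorem swap_swap : comp (swap A B) (swap (S := S) B A) = idHom _ :=
  act_tens_ext (by simp only [act_comp, act_swap, act_idHom, Split.symm_symm])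

theorem rightUnitHom_rightUnitInv :
    comp (rightUnitHom A) (rightUnitInv (S := S) A) = idHom _ :=
  act_tens_unit_ext (by
    simp only [act_comp, act_rightUnitHom_star, act_rightUnitInv, act_idHom])

theorem rightUnitInv_rightUnitHom :
    comp (rightUnitInv A) (rightUnitHom (S := S) A) = idHom _ :=
  act_ext (by simp only [act_comp, act_rightUnitHom_star, act_rightUnitInv, act_idHom])

/-- Both sides send a generic fourfold tensor to the same variables with explicitly computed
splittings, which agree by evaluation. The hexagons and the two inverse laws of the associator go
the same way. -/
theorem assocHom_pentagon :
    comp (tensRight (assocHom A B C) D) (comp (assocHom A (.tensor B C) D)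
      (tensLeft A (assocHom (S := S) B C D))) =
      comp (assocHom (.tensor A B) C D) (assocHom A B (.tensor C D)) :=
  act_tens_left_left_ext (by
    simp only [act_comp, act_assocHom, act_tensRight, act_tensLeft]; rfl)

theorem assocHom_triangle :
    comp (assocHom A .unit B) (tensLeft A (leftUnitHom (S := S) B)) =
      tensRight (rightUnitHom A) B :=
  act_tens_left_unit_ext (by
    simp only [act_comp, act_assocHom, act_tensRight, act_tensLeft, act_rightUnitHom_star]
    exact congrArg (tens _ _) (act_leftUnitHom_star _))

theorem swap_naturality_right (F : El (S := S) [] (.lolli A B)) :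
    comp (tensLeft C F) (swap C B) = comp (swap C A) (tensRight F C) :=
  act_tens_ext (by simp only [act_comp, act_swap, act_tensRight, act_tensLeft])

theorem swap_naturality_left (F : El (S := S) [] (.lolli A B)) :
    comp (tensRight F C) (swap B C) = comp (swap A C) (tensLeft C F) :=
  act_tens_ext (by simp only [act_comp, act_swap, act_tensRight, act_tensLeft])

theorem swap_hexagon_forward :
    comp (assocHom A B C) (comp (swap A (.tensor B C)) (assocHom (S := S) B C A)) =
      comp (tensRight (swap A B) C) (comp (assocHom B A C) (tensLeft B (swap A C))) :=
  act_tens_left_ext (by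
    simp only [act_comp, act_swap, act_tensRight, act_tensLeft, act_assocHom]; rfl)

theorem swap_hexagon_reverse :
    comp (assocInv A B C) (comp (swap (.tensor A B) C) (assocInv (S := S) C A B)) =
      comp (tensLeft A (swap B C)) (comp (assocInv A C B) (tensRight (swap A C) B)) :=
  act_tens_right_ext (by
    simp only [act_comp, act_swap, act_tensRight, act_tensLeft, act_assocInv]; rfl)

theorem curry_naturality (F : El (S := S) [] (.lolli B C))
    (G : El (S := S) [] (.lolli (.tensor A C) D)) :
    curry (comp (tensLeft A F) G) = comp F (curry G) :=
  act_ext (by simp only [act_comp, act_curry, act_tensLeft])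

def lift (F : El (S := S) [] (.lolli A B)) (G : El (S := S) [] (.lolli A C)) :
    El (S := S) [] (.lolli A (.prod B C)) := lam (pair (act F var) (act G var))

def fstHom (A B : Ty S.Base) : El (S := S) [] (.lolli (.prod A B) A) := lam (fst var)

def sndHom (A B : Ty S.Base) : El (S := S) [] (.lolli (.prod A B) B) := lam (snd var)

def trivHom (A : Ty S.Base) : El (S := S) [] (.lolli A .one) := lam triv

theorem act_lift (F : El (S := S) [] (.lolli A B)) (G : El (S := S) [] (.lolli A C))
    (s : El X A) : act (lift F G) s = pair (act F s) (act G s) := by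
  rw [lift, act_lam, subst_pair, subst_act, subst_act, subst_var]

theorem act_fstHom (s : El X (.prod A B)) : act (fstHom A B) s = fst s := by
  rw [fstHom, act_lam, subst_fst, subst_var]

theorem act_sndHom (s : El X (.prod A B)) : act (sndHom A B) s = snd s := by
  rw [sndHom, act_lam, subst_snd, subst_var]

theorem lift_fstHom (F : El (S := S) [] (.lolli A B)) (G : El (S := S) [] (.lolli A C)) :
    comp (lift F G) (fstHom B C) = F :=
  act_ext (by simp only [act_comp, act_lift, act_fstHom, fst_pair])

theorem lift_sndHom (F : El (S := S) [] (.lolli A B)) (G : El (S := S) [] (.lolli A C)) :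
    comp (lift F G) (sndHom B C) = G :=
  act_ext (by simp only [act_comp, act_lift, act_sndHom, snd_pair])

theorem lift_unique {F : El (S := S) [] (.lolli A B)} {G : El (S := S) [] (.lolli A C)}
    {H : El (S := S) [] (.lolli A (.prod B C))} (h₁ : comp H (fstHom B C) = F)
    (h₂ : comp H (sndHom B C) = G) : H = lift F G := by
  subst h₁ h₂
  exact act_ext (by simp only [act_comp, act_lift, act_fstHom, act_sndHom, pair_fst_snd])

theorem trivHom_unique (F : El (S := S) [] (.lolli A .one)) : F = trivHom A :=
  act_ext ((eq_triv _).trans (eq_triv _).symm)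

end El

end LFSq

/-! ### The syntactic category and its structure -/

namespace LFSq

/-- The syntactic category: its objects are the types and its arrows are the closed terms of
linear function types up to provable equality. -/
def SynCat (S : Signature.{u}) : Type u := Ty S.Base

namespace SynCat

variable (S : Signature.{u})

instance : Category.{u} (SynCat S) where
  Hom A B := El (S := S) [] (.lolli A B)
  id A := El.idHom A
  comp F G := El.comp F G
  id_comp F := El.id_comp F
  comp_id F := El.comp_id F
  assoc F G H := El.comp_assoc F G H

instance : MonoidalCategoryStruct (SynCat S) where
  tensorObj A B := Ty.tensor A B
  whiskerLeft A _ _ F := El.tensLeft A F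
  whiskerRight F A := El.tensRight F A
  tensorHom F G := El.tensHom F G
  tensorUnit := Ty.unit
  associator A B C :=
    ⟨El.assocHom A B C, El.assocInv A B C, El.assocHom_assocInv, El.assocInv_assocHom⟩
  leftUnitor A :=
    ⟨El.leftUnitHom A, El.leftUnitInv A, El.leftUnitHom_leftUnitInv, El.leftUnitInv_leftUnitHom⟩
  rightUnitor A :=
    ⟨El.rightUnitHom A, El.rightUnitInv A, El.rightUnitHom_rightUnitInv,
      El.rightUnitInv_rightUnitHom⟩

instance : MonoidalCategory (SynCat S) where
  tensorHom_def _ _ := rfl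
  id_tensorHom_id _ _ := El.tensHom_idHom
  tensorHom_comp_tensorHom F F' G G' := El.tensHom_comp F F' G G'
  whiskerLeft_id _ _ := El.tensLeft_idHom
  id_whiskerRight _ _ := El.tensRight_idHom
  associator_naturality F G H := El.assocHom_naturality F G H
  leftUnitor_naturality F := El.leftUnitHom_naturality F
  rightUnitor_naturality F := El.rightUnitHom_naturality F
  pentagon _ _ _ _ := El.assocHom_pentagon
  triangle _ _ := El.assocHom_triangle

instance : SymmetricCategory (SynCat S) where
  braiding A B := ⟨El.swap A B, El.swap B A, El.swap_swap, El.swap_swap⟩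
  braiding_naturality_right _ _ _ F := El.swap_naturality_right F
  braiding_naturality_left F _ := El.swap_naturality_left F
  hexagon_forward _ _ _ := El.swap_hexagon_forward
  hexagon_reverse _ _ _ := El.swap_hexagon_reverse
  symmetry _ _ := El.swap_swap

/-- Currying as an equivalence. -/
def curryEquiv (A X Y : SynCat S) :
    ((tensorLeft A).obj X ⟶ Y) ≃ (X ⟶ (Ty.lolli A Y : Ty S.Base)) where
  toFun F := El.curry F
  invFun G := El.uncurry G
  left_inv F := El.uncurry_curry F
  right_inv G := El.curry_uncurry G

instance : MonoidalClosed (SynCat S) where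
  closed A :=
    { rightAdj := Adjunction.rightAdjointOfEquiv (curryEquiv S A)
        fun _ _ _ F G => El.curry_naturality F G
      adj := Adjunction.adjunctionOfEquivRight (curryEquiv S A)
        fun _ _ _ F G => El.curry_naturality F G }

instance : FiniteProducts (SynCat S) where
  terminalCone :=
    { cone := asEmptyCone (Ty.one : Ty S.Base)
      isLimit := IsTerminal.ofUniqueHom (fun A => El.trivHom A) fun _ F => El.trivHom_unique F }
  binaryCone A B :=
    { cone := BinaryFan.mk (P := (Ty.prod A B : Ty S.Base)) (El.fstHom A B) (El.sndHom A B)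
      isLimit := BinaryFan.isLimitMk (fun s => El.lift s.fst s.snd)
        (fun _ => El.lift_fstHom _ _) (fun _ => El.lift_sndHom _ _)
        fun _ _ h₁ h₂ => El.lift_unique h₁ h₂ }

variable {S}

/-- The closed structure is obtained from an adjunction assembled out of hom-set bijections; this
lemma recovers the original bijection from it, and `ev_eq` the corresponding evaluation. -/
theorem curry_eq {A X Y : SynCat S} (F : A ⊗ X ⟶ Y) : MonoidalClosed.curry F = El.curry F :=
  congrArg (fun e : ∀ X Y, ((tensorLeft A).obj X ⟶ Y) ≃ (X ⟶ (ihom A).obj Y) => e X Y F)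
    (Adjunction.mkOfHomEquiv_homEquiv _)

theorem ev_eq (A B : SynCat S) :
    (ihom.ev A).app B = El.uncurry (El.idHom (Ty.lolli A B : Ty S.Base)) :=
  (MonoidalClosed.uncurry_id_eq_ev A B).symm.trans
    ((MonoidalClosed.curry_eq_iff _ _).1
      ((curry_eq _).trans (El.curry_uncurry _))).symm

end SynCat

end LFSq

namespace LFSq

/-! ### Terms in context as closed functions on tensor products -/

theorem Tm.untuple_congr {S : Signature.{u}} : ∀ (X : Ctx S) {C : Ty S.Base} {t t' : Tm X C},
    TmEq t t' → TmEq (Tm.untuple X t) (Tm.untuple X t')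
  | [], _, _, _, h => TmEq.letStar _ (TmEq.refl _) h
  | _ :: X, _, _, _, h =>
      TmEq.letTens _ (TmEq.refl _) (TmEq.app _ (Tm.untuple_congr X (TmEq.lam h)) (TmEq.refl _))

namespace El

variable {S : Signature.{u}} {X Y Z : Ctx S} {A B C : Ty S.Base}

def tuple (X : Ctx S) : El X X.tensor := mk (Tm.tuple X)

def untuple (X : Ctx S) : El X C → El [X.tensor] C :=
  Quotient.map (Tm.untuple X) fun _ _ h => Tm.untuple_congr X h

theorem untuple_nil (t : El (S := S) [] C) : untuple [] t = letStar (.left .nil) var t := by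
  induction t using ind with | h t
  rfl

theorem untuple_cons (t : El (A :: X) C) : untuple (A :: X) t =
    letTens (.left .nil) var (app (.right (.left .nil)) (untuple X (lam t)) var) := by
  induction t using ind with | h t
  rfl

theorem tuple_cons (A : Ty S.Base) (X : Ctx S) :
    tuple (A :: X) = tens (.left (.allRight X)) var (tuple X) := rfl

/-- The closed function on the tensor product of a context given by a term in that context. -/
def closure (t : El X C) : El (S := S) [] (.lolli X.tensor C) := lam (untuple X t)

/-- Taking apart a tuple that has just been formed does nothing: each layer is one β-step for `⊗`
and one for `⊸`, ending with the β-step for the unit. -/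
theorem subst_tuple_untuple (t : El X C) : subst (.allLeft X) (tuple X) (untuple X t) = t := by
  induction X generalizing C with
  | nil =>
    rw [untuple_nil]
    refine (subst_letStar_left (m := .nil) (Split.unassoc_nil []) _ _ _).trans ?_
    refine (congrArg (letStar .nil · t) (subst_var (X := []) _)).trans ?_
    exact letStar_star t
  | cons A X ih =>
    rw [untuple_cons]
    refine (subst_letTens_var _ _).trans ?_
    rw [tuple_cons, letTens_allLeft_tens, subst_app_right (k₁ := .right (.allLeft [A]))
      (k₂ := .allLeft [A]), subst_var]
    · change subst (.right (Split.allRight X).symm) (tuple X)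
        (app (.left (Split.allRight [A])) (untuple X (lam t)) var) = t
      rw [Split.symm_allRight]
      refine (subst_app_left (m := Split.allRight [A]) (Split.unassoc_allRight _) _ _ _).trans ?_
      rw [ih, app_lam_var]
    · rw [Split.symm, Split.symm, Split.unassoc_right_right, Split.unassoc_nil]

@[simp]
theorem act_closure_tuple (t : El X C) : act (closure t) (tuple X) = t := by
  rw [closure, act_lam, subst_tuple_untuple]

theorem act_tuple_ext {F G : El (S := S) [] (.lolli X.tensor C)}
    (h : act F (tuple X) = act G (tuple X)) : F = G := by
  induction X generalizing C with
  | nil => exact act_unit_ext h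
  | cons A X ih =>
    have e : curry (A := A) (B := (Ctx.tensor X)) F = curry (A := A) (B := (Ctx.tensor X)) G :=
      ih ((act_curry (A := A) (B := (Ctx.tensor X)) F (tuple X)).trans
        ((congrArg lam h).trans (act_curry (A := A) (B := (Ctx.tensor X)) G (tuple X)).symm))
    exact (uncurry_curry (A := A) (B := (Ctx.tensor X)) F).symm.trans
      ((congrArg uncurry e).trans (uncurry_curry (A := A) (B := (Ctx.tensor X)) G))

/-- A closed function on the tensor of a context is determined by its value on the generic tuple.
The `closure_*` lemmas that follow use this to show that `closure` obeys the clauses defining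
`Interpretation.tm`, up to the identification of hom and evaluation. -/
theorem closure_eq {t : El X C} {F : El (S := S) [] (.lolli X.tensor C)}
    (h : act F (tuple X) = t) : closure t = F :=
  act_tuple_ext (by rw [act_closure_tuple, h])

theorem closure_act (F : El (S := S) [] (.lolli A B)) (t : El X A) :
    closure (act F t) = comp (closure t) F :=
  closure_eq (by rw [act_comp, act_closure_tuple])

theorem closure_var : closure (var (S := S) (A := A)) = rightUnitHom A :=
  closure_eq (act_rightUnitHom_star var)

theorem closure_tuple : closure (tuple X) = idHom X.tensor :=
  closure_eq (act_idHom _)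

theorem closure_pair (a : El X A) (b : El X B) :
    closure (pair a b) = lift (closure a) (closure b) :=
  closure_eq (by rw [act_lift, act_closure_tuple, act_closure_tuple])

theorem closure_fst (t : El X (.prod A B)) : closure (fst t) = comp (closure t) (fstHom A B) :=
  closure_eq (by rw [act_comp, act_fstHom, act_closure_tuple])

theorem closure_snd (t : El X (.prod A B)) : closure (snd t) = comp (closure t) (sndHom A B) :=
  closure_eq (by rw [act_comp, act_sndHom, act_closure_tuple])

theorem closure_op (f : S.Fn) (t : El X (S.dom f)) :
    closure (op f t) = comp (closure t) (lam (op f var)) :=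
  closure_eq (by rw [act_comp, act_closure_tuple, act_lam, subst_op, subst_var])

theorem closure_lam (t : El (A :: X) B) : closure (lam t) = curry (closure t) :=
  closure_eq ((act_curry (A := A) (B := X.tensor) _ _).trans
    (congrArg lam (act_closure_tuple t)))

theorem mk_letIn (s : Tm Y X.tensor) (t : Tm X C) :
    mk (Tm.letIn s t) = act (closure (mk t)) (mk s) := by
  rw [closure, act_lam]
  exact (subst_mk _ _ _).symm

theorem mk_single (t : Tm X A) : mk (Tm.single t) = act (rightUnitInv A) (mk t) :=
  (act_rightUnitInv (mk t)).symm

theorem act_rightUnitHom_rightUnitInv (t : El X A) :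
    act (rightUnitHom A) (act (rightUnitInv A) t) = t := by
  rw [← act_comp, rightUnitInv_rightUnitHom, act_idHom]

theorem act_rightUnitInv_rightUnitHom (t : El X (.tensor A .unit)) :
    act (rightUnitInv A) (act (rightUnitHom A) t) = t := by
  rw [← act_comp, rightUnitHom_rightUnitInv, act_idHom]

/-- The closed function distributing the variables of a context. -/
def splitHom (p : Split X Y Z) : El (S := S) [] (.lolli X.tensor (.tensor Y.tensor Z.tensor)) :=
  closure (tens p (tuple Y) (tuple Z))

theorem act_splitHom (p : Split X Y Z) :
    act (splitHom p) (tuple X) = tens p (tuple Y) (tuple Z) := act_closure_tuple _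

theorem closure_tens (p : Split X Y Z) (s : El Y A) (t : El Z B) :
    closure (tens p s t) = comp (splitHom p) (tensHom (closure s) (closure t)) :=
  closure_eq (by
    rw [act_comp, act_splitHom, act_tensHom, act_closure_tuple, act_closure_tuple])

theorem closure_letStar (p : Split X Y Z) (s : El Y .unit) (t : El Z C) :
    closure (letStar p s t) = comp (splitHom p) (comp (tensRight (closure s) Z.tensor)
      (comp (leftUnitHom Z.tensor) (closure t))) :=
  closure_eq (by
    -- A commuting conversion, obtained by applying η for the unit to the term `F (leftUnitHom (x ⊗
    -- u))` in the variable `x`.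
    have e : ∀ (F : El (S := S) [] (.lolli Z.tensor C)) (u : El Z Z.tensor),
        act F (letStar p s u) = letStar p s (act F u) := by
      intro F u
      have h₁ : ∀ {W V : Ctx S} (q : Split W V Z) (r : El V .unit),
          subst q r (act F (act (leftUnitHom _) (tens (.left (.allRight Z)) var u))) =
            act F (letStar q r u) := by
        intro W V q r
        rw [subst_act, subst_act, subst_tens_left (Split.unassoc_allRight q), subst_var,
          act_leftUnitHom]
      have := letStar_subst p s
        (act F (act (leftUnitHom _) (tens (.left (.allRight Z)) var u)))
      rw [h₁, h₁, letStar_star] at this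
      exact this.symm
    rw [act_comp, act_splitHom, act_comp, act_tensRight, act_comp, act_leftUnitHom,
      act_closure_tuple, e, act_closure_tuple])

/-- The commuting conversion for `⊗`, from η applied to the term `F (assocHom (z ⊗ u))` in the
variable `z`; on a generic pair the associator computes. -/
theorem act_assocHom_letTens (p : Split X Y Z) (s : El Y (.tensor A B)) {D : Ty S.Base}
    (u : El Z D) (F : El (S := S) [] (.lolli (.tensor A (.tensor B D)) C)) :
    act F (act (assocHom A B D) (tens p s u)) =
      letTens p s (act F (tens (.left (.allRight (B :: Z))) var
        (tens (.left (.allRight Z)) var u))) := by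
  have h₁ : ∀ {W V : Ctx S} (q : Split W V Z) (r : El V (.tensor A B)),
      subst q r (act F (act (assocHom _ _ _) (tens (.left (.allRight Z)) var u))) =
        act F (act (assocHom _ _ _) (tens q r u)) := by
    intro W V q r
    rw [subst_act, subst_act, subst_tens_left (Split.unassoc_allRight q), subst_var]
  have := letTens_subst p s
    (act F (act (assocHom _ _ _) (tens (.left (.allRight Z)) var u)))
  rw [h₁, h₁, act_assocHom] at this
  rw [← this]
  have h₂ : Split.assoc (.left (A := A) (.left (A := B) (.allRight Z))) (.left (.right .nil)) =
      ⟨B :: Z, .left (.allRight (B :: Z)), .left (.allRight Z)⟩ := by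
    have h₃ := Split.assoc_allRight_right (.allRight Z)
    simp only [Split.allRight] at h₃
    change (⟨B :: (Split.assoc (.allRight Z) .nil).1,
      .left (.right (Split.assoc (.allRight Z) .nil).2.1),
      .left (Split.assoc (.allRight Z) .nil).2.2⟩ :
        (W : Ctx S) × Split (A :: B :: Z) [A] W × Split W [B] Z) = _
    rw [h₃]
    rfl
  rw [h₂]

theorem closure_letTens (p : Split X Y Z) (s : El Y (.tensor A B)) (t : El (A :: B :: Z) C) :
    closure (letTens p s t) = comp (splitHom p) (comp (tensRight (closure s) Z.tensor)
      (comp (assocHom A B Z.tensor) (closure t))) :=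
  closure_eq (by
    rw [act_comp, act_splitHom, act_comp, act_tensRight, act_closure_tuple]
    refine (act_comp (assocHom A B Z.tensor) (closure t) _).trans ?_
    refine (act_assocHom_letTens p s (tuple Z) (closure t)).trans ?_
    exact congrArg _ (act_closure_tuple t))

theorem closure_app (p : Split X Y Z) (s : El Y (.lolli A B)) (t : El Z A) :
    closure (app p s t) = comp (splitHom p) (comp (tensHom (closure s) (closure t))
      (comp (swap _ _) (uncurry (idHom _)))) :=
  closure_eq (by
    rw [act_comp, act_splitHom, act_comp, act_tensHom, act_comp, act_swap, act_uncurry,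
      act_closure_tuple, act_closure_tuple, act_idHom, Split.symm_symm])

theorem splitHom_nil : splitHom (S := S) .nil = leftUnitInv .unit :=
  closure_eq (act_leftUnitInv star)

/-- Stated for arbitrary types and terms in place of tensors and tuples of contexts, so that
rewriting is not obstructed by the unfolding of `Ctx.tensor (A :: X)`. -/
theorem act_splitHom_left {A' B' C' D' : Ty S.Base} {F : El (S := S) [] (.lolli B' (.tensor C' D'))}
    {p : Split X Y Z} {x : El X B'} {y : El Y C'} {z : El Z D'} (h : act F x = tens p y z) :
    act (comp (tensLeft A' F) (assocInv A' C' D')) (tens (.left (.allRight X)) var x) =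
      tens (.left p) (tens (.left (.allRight Y)) var y) z := by
  rw [act_comp, act_tensLeft, h, act_assocInv, Split.unassoc_left, Split.unassoc_allRight_left]

theorem act_splitHom_right {A' B' C' D' : Ty S.Base}
    {F : El (S := S) [] (.lolli B' (.tensor C' D'))}
    {p : Split X Y Z} {x : El X B'} {y : El Y C'} {z : El Z D'} (h : act F x = tens p y z) :
    act (comp (tensLeft A' F) (comp (assocInv A' C' D') (comp (tensRight (swap A' C') D')
      (assocHom C' A' D')))) (tens (.left (.allRight X)) var x) =
      tens (.right p) y (tens (.left (.allRight Z)) var z) := by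
  rw [act_comp, act_tensLeft, h, act_comp, act_assocInv, Split.unassoc_left,
    Split.unassoc_allRight_left, act_comp, act_tensRight, act_swap, act_assocHom]
  change tens (Split.right (Split.assoc p (Split.allRight Y).symm).2.1) _
    (tens (Split.left (Split.assoc p (Split.allRight Y).symm).2.2) _ _) = _
  rw [Split.symm_allRight, Split.assoc_allLeft_right]

theorem splitHom_left (p : Split X Y Z) : splitHom (.left (A := A) p) =
    comp (tensLeft A (splitHom p)) (assocInv A Y.tensor Z.tensor) :=
  closure_eq (act_splitHom_left (act_splitHom p))

theorem splitHom_right (p : Split X Y Z) : splitHom (.right (A := A) p) =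
    comp (tensLeft A (splitHom p)) (comp (assocInv A Y.tensor Z.tensor)
      (comp (tensRight (swap A Y.tensor) Z.tensor) (assocHom Y.tensor A Z.tensor))) :=
  closure_eq (act_splitHom_right (act_splitHom p))

end El

end LFSq

namespace LFSq

/-! ### Calculus of simultaneous substitutions, and formulas up to term equality -/

namespace El

variable {S : Signature.{u}} {X Y Z : Ctx S} {A B C : Ty S.Base}

/-- Substitution of a tuple for all variables of a context. -/
def letIn (s : El Y X.tensor) (t : El X C) : El Y C := act (closure t) s

/-- The one-component tuple. -/
def single (t : El X A) : El X (Ctx.tensor [A]) := act (rightUnitInv A) t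

/-- The substitution acting under a quantifier. -/
def liftCtx (A : Ty S.Base) (s : El Y X.tensor) :
    El [.prod A Y.tensor] (Ctx.tensor [.prod A X.tensor]) :=
  single (pair (fst var) (letIn (snd var) s))

theorem mk_lift (A : Ty S.Base) (s : Tm Y X.tensor) :
    mk (Formula.lift A s) = liftCtx A (mk s) :=
  (mk_single _).trans (congrArg (fun t => single (pair (fst var) t)) (mk_letIn _ _))

theorem letIn_tuple (t : El X C) : letIn (tuple X) t = t := act_closure_tuple t

theorem letIn_single (s : El X A) (t : El [A] B) :
    letIn (single s) t = subst (.allLeft X) s t := by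
  have h : closure t = comp (rightUnitHom A) (lam t) :=
    closure_eq ((act_comp _ _ _).trans ((congrArg (act (lam t)) (act_rightUnitHom_star var)).trans
      ((act_lam t var).trans (subst_left_allRight_var t))))
  rw [letIn, h]
  refine (act_comp _ _ _).trans ((congrArg (act (lam t)) ?_).trans (act_lam t s))
  exact act_rightUnitHom_rightUnitInv s

theorem letIn_tuple_right (s : El Y X.tensor) : letIn s (tuple X) = s := by
  rw [letIn, closure_tuple, act_idHom]

/-- Closures turn iterated substitution into composition of closed functions, so no induction on
terms is needed. -/
theorem letIn_letIn (s : El Z Y.tensor) (r : El Y X.tensor) (t : El X C) :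
    letIn s (letIn r t) = letIn (letIn s r) t := by
  rw [letIn, letIn, closure_act, act_comp]
  rfl

theorem letIn_pair (s : El Y X.tensor) (a : El X A) (b : El X B) :
    letIn s (pair a b) = pair (letIn s a) (letIn s b) := by
  rw [letIn, closure_pair, act_lift]
  rfl

theorem letIn_fst (s : El Y X.tensor) (t : El X (.prod A B)) :
    letIn s (fst t) = fst (letIn s t) := by
  rw [letIn, closure_fst, act_comp, act_fstHom]
  rfl

theorem letIn_snd (s : El Y X.tensor) (t : El X (.prod A B)) :
    letIn s (snd t) = snd (letIn s t) := by
  rw [letIn, closure_snd, act_comp, act_sndHom]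
  rfl

theorem letIn_act (s : El Y X.tensor) (F : El (S := S) [] (.lolli A B)) (t : El X A) :
    letIn s (act F t) = act F (letIn s t) := by
  rw [letIn, closure_act, act_comp]
  rfl

theorem letIn_single_right (s : El Y X.tensor) (t : El X A) :
    letIn s (single t) = single (letIn s t) :=
  letIn_act s (rightUnitInv A) t

theorem letIn_single_var (s : El X A) : letIn (single s) var = s := by
  rw [letIn_single, subst_var]

theorem single_var : single (S := S) (var (A := A)) = tuple [A] := act_rightUnitInv var

/-- Substitution under a quantifier respects composition; this is the quantifier step of
`Formula.subst_subst`. -/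
theorem letIn_liftCtx (A : Ty S.Base) (s : El Z Y.tensor) (r : El Y X.tensor) :
    letIn (liftCtx A s) (liftCtx A r) = liftCtx A (letIn s r) := by
  rw [liftCtx, liftCtx, liftCtx, letIn_single_right, letIn_pair, letIn_fst, letIn_letIn, letIn_snd,
    letIn_single_var, fst_pair, snd_pair, letIn_letIn]

theorem liftCtx_tuple (A : Ty S.Base) (X : Ctx S) :
    liftCtx A (tuple X) = tuple [.prod A X.tensor] := by
  rw [liftCtx, letIn_tuple_right, pair_fst_snd, single_var]

/-- Instantiating a freshly adjoined variable by the quantified one changes nothing. -/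
theorem letIn_single_liftCtx (A : Ty S.Base) (X : Ctx S) :
    letIn (single (pair (fst var) (tuple [.prod A X.tensor]))) (liftCtx A (snd var)) =
      tuple [.prod A X.tensor] := by
  rw [liftCtx, letIn_single_right, letIn_pair, letIn_fst, letIn_letIn, letIn_snd, letIn_snd,
    letIn_single_var, fst_pair, snd_pair, letIn_tuple, pair_fst_snd, single_var]

end El

theorem Tm.letIn_letIn {S : Signature.{u}} {X Y Z : Ctx S} {A : Ty S.Base} {s : Tm Z Y.tensor}
    {r : Tm Y X.tensor} {q : Tm Z X.tensor} (h : El.letIn (El.mk s) (El.mk r) = El.mk q)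
    (t : Tm X A) : TmEq (Tm.letIn s (Tm.letIn r t)) (Tm.letIn q t) :=
  El.mk_eq_mk.1 (by
    rw [El.mk_letIn, El.mk_letIn, El.mk_letIn, ← h]
    exact El.letIn_letIn _ _ _)

namespace Formula

variable {S : Signature.{u}}

/-- Equality of formulas up to provable equality of the terms in literals. -/
inductive Eqv : {X : Ctx S} → Formula X → Formula X → Prop
  | atom {X : Ctx S} (R : S.Pred) {s t : Tm X (S.arity R)} :
      TmEq s t → Eqv (atom R s) (atom R t)
  | natom {X : Ctx S} (R : S.Pred) {s t : Tm X (S.arity R)} :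
      TmEq s t → Eqv (natom R s) (natom R t)
  | top {X : Ctx S} : Eqv (top (X := X)) top
  | bot {X : Ctx S} : Eqv (bot (X := X)) bot
  | and {X : Ctx S} {φ φ' ψ ψ' : Formula X} :
      Eqv φ φ' → Eqv ψ ψ' → Eqv (and φ ψ) (and φ' ψ')
  | or {X : Ctx S} {φ φ' ψ ψ' : Formula X} :
      Eqv φ φ' → Eqv ψ ψ' → Eqv (or φ ψ) (or φ' ψ')
  | all {X : Ctx S} (A : Ty S.Base) {φ φ' : Formula [Ty.prod A X.tensor]} :
      Eqv φ φ' → Eqv (all A φ) (all A φ')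
  | ex {X : Ctx S} (A : Ty S.Base) {φ φ' : Formula [Ty.prod A X.tensor]} :
      Eqv φ φ' → Eqv (ex A φ) (ex A φ')

theorem Eqv.trans {X : Ctx S} {φ ψ χ : Formula X} (h : Eqv φ ψ) (h' : Eqv ψ χ) : Eqv φ χ := by
  induction h with
  | atom R h => cases h' with | atom _ h' => exact .atom R (h.trans h')
  | natom R h => cases h' with | natom _ h' => exact .natom R (h.trans h')
  | top => exact h'
  | bot => exact h'
  | and _ _ ih ih' => cases h' with | and h h' => exact .and (ih h) (ih' h')
  | or _ _ ih ih' => cases h' with | or h h' => exact .or (ih h) (ih' h')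
  | all A _ ih => cases h' with | all _ h => exact .all A (ih h)
  | ex A _ ih => cases h' with | ex _ h => exact .ex A (ih h)

theorem subst_congr {X Y : Ctx S} (φ : Formula X) {s s' : Tm Y X.tensor} (h : TmEq s s') :
    Eqv (subst s φ) (subst s' φ) := by
  induction φ generalizing Y with
  | atom R t => exact .atom R (El.mk_eq_mk.1 (by rw [El.mk_letIn, El.mk_letIn, El.sound h]))
  | natom R t => exact .natom R (El.mk_eq_mk.1 (by rw [El.mk_letIn, El.mk_letIn, El.sound h]))
  | top => exact .top
  | bot => exact .bot
  | and φ ψ ih ih' => exact .and (ih h) (ih' h)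
  | or φ ψ ih ih' => exact .or (ih h) (ih' h)
  | all A φ ih => exact .all A (ih (El.mk_eq_mk.1 (by rw [El.mk_lift, El.mk_lift, El.sound h])))
  | ex A φ ih => exact .ex A (ih (El.mk_eq_mk.1 (by rw [El.mk_lift, El.mk_lift, El.sound h])))

/-- The composite is represented by any term `q` in the right class. This freedom is needed for the
induction, since lifting a composite agrees with composing the lifts only up to provable equality.
-/
theorem subst_subst {X Y Z : Ctx S} (φ : Formula X) {s : Tm Z Y.tensor} {r : Tm Y X.tensor}
    {q : Tm Z X.tensor} (h : El.letIn (El.mk s) (El.mk r) = El.mk q) :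
    Eqv (subst s (subst r φ)) (subst q φ) := by
  induction φ generalizing Y Z with
  | atom R t => exact .atom R (Tm.letIn_letIn h t)
  | natom R t => exact .natom R (Tm.letIn_letIn h t)
  | top => exact .top
  | bot => exact .bot
  | and φ ψ ih ih' => exact .and (ih h) (ih' h)
  | or φ ψ ih ih' => exact .or (ih h) (ih' h)
  | all A φ ih =>
    have h' : El.letIn (El.mk (lift A s)) (El.mk (lift A r)) = El.mk (lift A q) := by
      rw [El.mk_lift, El.mk_lift, El.mk_lift, El.letIn_liftCtx, h]
    exact .all A (ih h')
  | ex A φ ih =>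
    have h' : El.letIn (El.mk (lift A s)) (El.mk (lift A r)) = El.mk (lift A q) := by
      rw [El.mk_lift, El.mk_lift, El.mk_lift, El.letIn_liftCtx, h]
    exact .ex A (ih h')

theorem subst_tuple {X : Ctx S} (φ : Formula X) {s : Tm X X.tensor}
    (h : El.mk s = El.tuple X) : Eqv (subst s φ) φ := by
  induction φ with
  | atom R t => exact .atom R (El.mk_eq_mk.1 (by rw [El.mk_letIn, h]; exact El.letIn_tuple _))
  | natom R t => exact .natom R (El.mk_eq_mk.1 (by rw [El.mk_letIn, h]; exact El.letIn_tuple _))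
  | top => exact .top
  | bot => exact .bot
  | and φ ψ ih ih' => exact .and (ih h) (ih' h)
  | or φ ψ ih ih' => exact .or (ih h) (ih' h)
  | all A φ ih => exact .all A (ih (by rw [El.mk_lift, h, El.liftCtx_tuple]))
  | ex A φ ih => exact .ex A (ih (by rw [El.mk_lift, h, El.liftCtx_tuple]))

theorem inst_lift_snd {X : Ctx S} {A : Ty S.Base} (φ : Formula [Ty.prod A X.tensor]) :
    Eqv (inst (subst (lift A (Tm.snd Tm.var)) φ) (Tm.fst Tm.var)) φ := by
  refine (subst_subst φ (q := Tm.tuple _) ?_).trans (subst_tuple φ rfl)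
  rw [El.mk_single, El.mk_lift]
  exact El.letIn_single_liftCtx A X

theorem subst_neg {X Y : Ctx S} (φ : Formula X) (s : Tm Y X.tensor) :
    subst s (neg φ) = neg (subst s φ) := by
  induction φ generalizing Y with
  | atom R t => rfl
  | natom R t => rfl
  | top => rfl
  | bot => rfl
  | and φ ψ ih ih' => simp only [neg, subst, ih, ih']
  | or φ ψ ih ih' => simp only [neg, subst, ih, ih']
  | all A φ ih => simp only [neg, subst, ih]
  | ex A φ ih => simp only [neg, subst, ih]

theorem neg_neg {X : Ctx S} (φ : Formula X) : neg (neg φ) = φ := by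
  induction φ with
  | atom R t => rfl
  | natom R t => rfl
  | top => rfl
  | bot => rfl
  | and φ ψ ih ih' => simp only [neg, ih, ih']
  | or φ ψ ih ih' => simp only [neg, ih, ih']
  | all A φ ih => simp only [neg, ih]
  | ex A φ ih => simp only [neg, ih]

end Formula

namespace Derivable

variable {S : Signature.{u}} {L : QuantumLogic} {T : Set (Sequent S)} {X Y : Ctx S}
  {φ ψ χ : Formula X}

theorem cut (h : Derivable L T X {φ} {ψ}) (h' : Derivable L T X {ψ} {χ}) :
    Derivable L T X {φ} {χ} := by
  have := cutL (Γ' := 0) h h'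
  rwa [add_zero] at this

/-- The premise has the shape produced by reading the rules upwards: `allR` weakens `∀φ`, and `allL`
then instantiates it at the variable just introduced. By `Formula.inst_lift_snd` this instance is
equivalent to `φ`. -/
theorem all_mono {A : Ty S.Base} {φ ψ : Formula [Ty.prod A X.tensor]}
    (h : Derivable L T _ {Formula.inst (Formula.subst (Formula.lift A (Tm.snd Tm.var)) φ)
      (Tm.fst Tm.var)} {ψ}) :
    Derivable L T X {Formula.all A φ} {Formula.all A ψ} :=
  allR (allL _ h)

theorem ex_mono {A : Ty S.Base} {φ ψ : Formula [Ty.prod A X.tensor]}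
    (h : Derivable L T _ {φ} {Formula.inst (Formula.subst (Formula.lift A (Tm.snd Tm.var)) ψ)
      (Tm.fst Tm.var)}) :
    Derivable L T X {Formula.ex A φ} {Formula.ex A ψ} :=
  exL (exR _ h)

/-- Induction on the formula `ψ`, with `φ` arbitrary, rather than on the equivalence: the quantifier
cases also need the hypothesis for the weakened and reinstantiated body, which is only equivalent to
the original one. Negative literals come from `dual`. -/
theorem of_eqv (h : Formula.Eqv φ ψ) :
    Derivable L T X {φ} {ψ} ∧ Derivable L T X {ψ} {φ} := by
  induction ψ with
  | atom R t => cases h with | atom _ h => exact ⟨.eq R h, .eq R h.symm⟩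
  | natom R t => cases h with
    | natom _ h => exact ⟨dual (.eq R h.symm), dual (.eq R h)⟩
  | top => cases h; exact ⟨.ax _, .ax _⟩
  | bot => cases h; exact ⟨.ax _, .ax _⟩
  | and φ ψ ih ih' => cases h with
    | and h h' => exact ⟨andR (andL₁ (ih h).1) (andL₂ (ih' h').1),
        andR (andL₁ (ih h).2) (andL₂ (ih' h').2)⟩
  | or φ ψ ih ih' => cases h with
    | or h h' => exact ⟨orL (orR₁ (ih h).1) (orR₂ (ih' h').1),
        orL (orR₁ (ih h).2) (orR₂ (ih' h').2)⟩
  | all A ψ ih => cases h with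
    | all _ h => exact ⟨all_mono (ih ((Formula.inst_lift_snd _).trans h)).1,
        all_mono ((ih (Formula.inst_lift_snd _)).1.cut (ih h).2)⟩
  | ex A ψ ih => cases h with
    | ex _ h => exact ⟨ex_mono ((ih h).1.cut (ih (Formula.inst_lift_snd _)).2),
        ex_mono (ih ((Formula.inst_lift_snd _).trans h)).2⟩

end Derivable

end LFSq

namespace LFSq

/-! ### Lindenbaum algebras -/

namespace Derivable

variable {S : Signature.{u}} {L : QuantumLogic} {T : Set (Sequent S)} {X Y : Ctx S}
  {φ ψ χ : Formula X} {Γ Γ' Δ Δ' : Multiset (Formula X)}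

/-- Left rules act only on a formula standing alone, so a context cannot be combined in place.
Instead each member is cut against `χ`, and the copies of `χ` are contracted; weakening covers the
empty context. -/
theorem collect_left (h : ∀ φ ∈ Γ, Derivable L T X {χ} {φ}) :
    ∀ {Γ'}, Derivable L T X (Γ + Γ') Δ → Derivable L T X (χ ::ₘ Γ') Δ := by
  induction Γ using Multiset.induction with
  | empty => exact fun d => weakL _ (by rwa [zero_add] at d)
  | cons φ Γ ih =>
    intro Γ' d
    rw [Multiset.cons_add] at d
    have := cutL (h φ (Multiset.mem_cons_self φ Γ)) d
    rw [Multiset.singleton_add, ← Multiset.add_cons] at this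
    exact contrL (ih (fun φ hφ => h φ (Multiset.mem_cons_of_mem hφ)) this)

theorem collect_right (h : ∀ φ ∈ Δ, Derivable L T X {φ} {χ}) :
    ∀ {Δ'}, Derivable L T X Γ (Δ + Δ') → Derivable L T X Γ (χ ::ₘ Δ') := by
  induction Δ using Multiset.induction with
  | empty => exact fun d => weakR _ (by rwa [zero_add] at d)
  | cons φ Δ ih =>
    intro Δ' d
    rw [Multiset.cons_add] at d
    have := cutR d (h φ (Multiset.mem_cons_self φ Δ))
    rw [Multiset.singleton_add, ← Multiset.add_cons] at this
    exact contrR (ih (fun φ hφ => h φ (Multiset.mem_cons_of_mem hφ)) this)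

theorem all_congr {A : Ty S.Base} {φ ψ : Formula [Ty.prod A X.tensor]}
    (h : Derivable L T _ {φ} {ψ}) : Derivable L T X {Formula.all A φ} {Formula.all A ψ} :=
  all_mono ((of_eqv (Formula.inst_lift_snd φ)).1.cut h)

theorem ex_congr {A : Ty S.Base} {φ ψ : Formula [Ty.prod A X.tensor]}
    (h : Derivable L T _ {φ} {ψ}) : Derivable L T X {Formula.ex A φ} {Formula.ex A ψ} :=
  ex_mono (h.cut (of_eqv (Formula.inst_lift_snd ψ)).2)

theorem subst_single (s : Tm Y X.tensor) (h : Derivable L T X {φ} {ψ}) :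
    Derivable L T Y {φ.subst s} {ψ.subst s} := by
  have := subst s h
  rwa [Multiset.map_singleton, Multiset.map_singleton] at this

theorem neg_single (h : Derivable L T X {φ} {ψ}) : Derivable L T X {ψ.neg} {φ.neg} := by
  have := dual h
  rwa [Multiset.map_singleton, Multiset.map_singleton] at this

theorem and_neg (hL : L = QuantumLogic.ortho) (φ : Formula X) :
    Derivable L T X {φ.and φ.neg} {Formula.bot} := by
  have := weakR Formula.bot (transL hL (ax (L := L) (T := T) φ))
  refine collect_left (Γ := {φ} + Multiset.map Formula.neg {φ}) (Γ' := 0) ?_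
    (by rwa [add_zero])
  intro ψ hψ
  rw [Multiset.map_singleton, Multiset.mem_add, Multiset.mem_singleton,
    Multiset.mem_singleton] at hψ
  rcases hψ with rfl | rfl
  · exact andL₁ (ax _)
  · exact andL₂ (ax _)

end Derivable

/-- Interderivability of formulas. -/
def formulaSetoid {S : Signature.{u}} (L : QuantumLogic) (T : Set (Sequent S)) (X : Ctx S) :
    Setoid (Formula X) where
  r φ ψ := Derivable L T X {φ} {ψ} ∧ Derivable L T X {ψ} {φ}
  iseqv := ⟨fun φ => ⟨.ax φ, .ax φ⟩, fun h => ⟨h.2, h.1⟩,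
    fun h h' => ⟨h.1.cut h'.1, h'.2.cut h.2⟩⟩

/-- Formulas in context up to interderivability. -/
def Lind {S : Signature.{u}} (L : QuantumLogic) (T : Set (Sequent S)) (X : Ctx S) : Type u :=
  Quotient (formulaSetoid L T X)

namespace Lind

variable {S : Signature.{u}} {L : QuantumLogic} {T : Set (Sequent S)} {X Y Z : Ctx S}
  {A B C : Ty S.Base}

variable (L T) in
def mk (φ : Formula X) : Lind L T X := Quotient.mk (formulaSetoid L T X) φ

theorem sound {φ ψ : Formula X} (h : Derivable L T X {φ} {ψ}) (h' : Derivable L T X {ψ} {φ}) :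
    mk L T φ = mk L T ψ := Quotient.sound (s := formulaSetoid L T X) ⟨h, h'⟩

theorem sound_eqv {φ ψ : Formula X} (h : Formula.Eqv φ ψ) : mk L T φ = mk L T ψ :=
  sound (Derivable.of_eqv h).1 (Derivable.of_eqv h).2

@[elab_as_elim]
theorem ind {P : Lind L T X → Prop} (h : ∀ φ, P (mk L T φ)) (a : Lind L T X) : P a :=
  Quotient.ind (s := formulaSetoid L T X) h a

instance : LE (Lind L T X) where
  le := Quotient.lift₂ (fun φ ψ => Derivable L T X {φ} {ψ}) fun _ _ _ _ h h' =>
    propext ⟨fun d => h.2.cut (d.cut h'.1), fun d => h.1.cut (d.cut h'.2)⟩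

theorem mk_le_mk {φ ψ : Formula X} : mk L T φ ≤ mk L T ψ ↔ Derivable L T X {φ} {ψ} := Iff.rfl

instance : Min (Lind L T X) where
  min := Quotient.map₂ .and fun _ _ h _ _ h' =>
    ⟨.andR (.andL₁ h.1) (.andL₂ h'.1), .andR (.andL₁ h.2) (.andL₂ h'.2)⟩

instance : Max (Lind L T X) where
  max := Quotient.map₂ .or fun _ _ h _ _ h' =>
    ⟨.orL (.orR₁ h.1) (.orR₂ h'.1), .orL (.orR₁ h.2) (.orR₂ h'.2)⟩

instance : Compl (Lind L T X) where
  compl := Quotient.map .neg fun _ _ h => ⟨h.2.neg_single, h.1.neg_single⟩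

instance : QLAlgebra L (Lind L T X) where
  le_refl a := by induction a using ind with | h φ => exact .ax φ
  le_trans a b c := by
    induction a using ind with | h φ
    induction b using ind with | h ψ
    induction c using ind with | h χ
    exact Derivable.cut
  le_antisymm a b := by
    induction a using ind with | h φ
    induction b using ind with | h ψ
    exact sound
  sup := max
  inf := min
  le_sup_left a b := by
    induction a using ind with | h φ
    induction b using ind with | h ψ
    exact Derivable.orR₁ (.ax φ)
  le_sup_right a b := by
    induction a using ind with | h φ
    induction b using ind with | h ψ
    exact Derivable.orR₂ (.ax ψ)
  sup_le a b c := by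
    induction a using ind with | h φ
    induction b using ind with | h ψ
    induction c using ind with | h χ
    exact Derivable.orL
  inf_le_left a b := by
    induction a using ind with | h φ
    induction b using ind with | h ψ
    exact Derivable.andL₁ (.ax φ)
  inf_le_right a b := by
    induction a using ind with | h φ
    induction b using ind with | h ψ
    exact Derivable.andL₂ (.ax ψ)
  le_inf a b c := by
    induction a using ind with | h φ
    induction b using ind with | h ψ
    induction c using ind with | h χ
    exact Derivable.andR
  top := mk L T .top
  bot := mk L T .bot
  le_top a := by induction a using ind with | h φ => exact .topR _
  bot_le a := by induction a using ind with | h φ => exact .botL _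
  compl_involutive a := by
    induction a using ind with | h φ
    exact congrArg (mk L T) φ.neg_neg
  compl_antitone a b := by
    induction a using ind with | h φ
    induction b using ind with | h ψ
    exact Derivable.neg_single
  inf_compl_le a hL := by
    induction a using ind with | h φ
    exact Derivable.and_neg hL φ

/-- The order on classes sees only sequents with one formula on each side. A context derives its
iterated conjunction and each member is derivable from it, and dually on the right, so cuts
translate both ways. -/
theorem derivable_iff {Γ Δ : Multiset (Formula X)} :
    Derivable L T X Γ Δ ↔ (Γ.map (mk L T)).inf ≤ (Δ.map (mk L T)).sup := by
  have hΓ : ∀ Γ : Multiset (Formula X), ∃ γ, mk L T γ = (Γ.map (mk L T)).inf ∧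
      Derivable L T X Γ {γ} := by
    intro Γ
    induction Γ using Multiset.induction with
    | empty => exact ⟨.top, rfl, .topR _⟩
    | cons φ Γ ih =>
      obtain ⟨γ, e, h⟩ := ih
      refine ⟨.and φ γ, ?_, .andR ?_ (.weakL φ h)⟩
      · rw [Multiset.map_cons, Multiset.inf_cons, ← e]
        rfl
      · exact .collect_left (Γ := {φ}) (by simpa using .ax φ)
          (by
            rw [add_comm]
            clear h e
            induction Γ using Multiset.induction with
            | empty => exact .ax φ
            | cons ψ Γ ih => rw [Multiset.cons_add]; exact .weakL ψ ih)
  have hΔ : ∀ Δ : Multiset (Formula X), ∃ δ, mk L T δ = (Δ.map (mk L T)).sup ∧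
      Derivable L T X {δ} Δ := by
    intro Δ
    induction Δ using Multiset.induction with
    | empty => exact ⟨.bot, rfl, .botL _⟩
    | cons φ Δ ih =>
      obtain ⟨δ, e, h⟩ := ih
      refine ⟨.or φ δ, ?_, .orL ?_ (.weakR φ h)⟩
      · rw [Multiset.map_cons, Multiset.sup_cons, ← e]
        rfl
      · exact .collect_right (Δ := {φ}) (by simpa using .ax φ)
          (by
            rw [add_comm]
            clear h e
            induction Δ using Multiset.induction with
            | empty => exact .ax φ
            | cons ψ Δ ih => rw [Multiset.cons_add]; exact .weakR ψ ih)
  obtain ⟨γ, e, h⟩ := hΓ Γ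
  obtain ⟨δ, e', h'⟩ := hΔ Δ
  rw [← e, ← e', mk_le_mk]
  constructor
  · intro d
    refine .collect_left (Γ := Γ) (Γ' := 0) (fun φ hφ => mk_le_mk.1 ?_)
      (.collect_right (Δ := Δ) (Δ' := 0) (fun φ hφ => mk_le_mk.1 ?_) ?_)
    · rw [e]
      exact Multiset.inf_le (Multiset.mem_map_of_mem _ hφ)
    · rw [e']
      exact Multiset.le_sup (Multiset.mem_map_of_mem _ hφ)
    · rwa [add_zero, add_zero]
  · intro d
    have h₁ := Derivable.cutL (Γ' := 0) h d
    rw [add_zero] at h₁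
    have h₂ := Derivable.cutR (Δ' := 0) h₁ h'
    rwa [add_zero] at h₂

/-- Well defined in the term because provably equal terms give interderivable formulas, and in the
formula because of the substitution rule. -/
def subst : El Y X.tensor → Lind L T X → Lind L T Y :=
  Quotient.map₂ Formula.subst fun _ s' h _ _ h' =>
    ⟨(Derivable.of_eqv (Formula.subst_congr _ h)).1.cut (h'.1.subst_single s'),
      (h'.2.subst_single s').cut (Derivable.of_eqv (Formula.subst_congr _ h)).2⟩

def all (A : Ty S.Base) : Lind L T [.prod A X.tensor] → Lind L T X :=
  Quotient.map (.all A) fun _ _ h => ⟨h.1.all_congr, h.2.all_congr⟩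

def ex (A : Ty S.Base) : Lind L T [.prod A X.tensor] → Lind L T X :=
  Quotient.map (.ex A) fun _ _ h => ⟨h.1.ex_congr, h.2.ex_congr⟩

theorem subst_mono (s : El Y X.tensor) {a b : Lind L T X} (h : a ≤ b) :
    subst s a ≤ subst s b := by
  induction s using El.ind with | h s
  induction a using ind with | h φ
  induction b using ind with | h ψ
  exact Derivable.subst_single s h

theorem subst_inf (s : El Y X.tensor) (a b : Lind L T X) :
    subst s (a ⊓ b) = subst s a ⊓ subst s b := by
  induction s using El.ind with | h s
  induction a using ind with | h φ
  induction b using ind with | h ψ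
  rfl

theorem subst_sup (s : El Y X.tensor) (a b : Lind L T X) :
    subst s (a ⊔ b) = subst s a ⊔ subst s b := by
  induction s using El.ind with | h s
  induction a using ind with | h φ
  induction b using ind with | h ψ
  rfl

theorem subst_top (s : El Y X.tensor) : subst s (⊤ : Lind L T X) = ⊤ := by
  induction s using El.ind with | h s
  rfl

theorem subst_bot (s : El Y X.tensor) : subst s (⊥ : Lind L T X) = ⊥ := by
  induction s using El.ind with | h s
  rfl

theorem subst_compl (s : El Y X.tensor) (a : Lind L T X) : subst s aᶜ = (subst s a)ᶜ := by
  induction s using El.ind with | h s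
  induction a using ind with | h φ
  exact congrArg (mk L T) (φ.subst_neg s)

theorem subst_subst (s : El Z Y.tensor) (r : El Y X.tensor) (a : Lind L T X) :
    subst s (subst r a) = subst (El.letIn s r) a := by
  generalize h : El.letIn s r = q
  induction s using El.ind with | h s
  induction r using El.ind with | h r
  induction q using El.ind with | h q
  induction a using ind with | h φ
  exact sound_eqv (φ.subst_subst h)

theorem subst_tuple (a : Lind L T X) : subst (El.tuple X) a = a := by
  induction a using ind with | h φ
  exact sound_eqv (φ.subst_tuple rfl)

theorem subst_all (s : El Y X.tensor) (a : Lind L T [.prod A X.tensor]) :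
    subst s (all A a) = all A (subst (El.liftCtx A s) a) := by
  induction s using El.ind with | h s
  induction a using ind with | h φ
  rw [← El.mk_lift]
  rfl

theorem subst_ex (s : El Y X.tensor) (a : Lind L T [.prod A X.tensor]) :
    subst s (ex A a) = ex A (subst (El.liftCtx A s) a) := by
  induction s using El.ind with | h s
  induction a using ind with | h φ
  rw [← El.mk_lift]
  rfl

/-- One direction instantiates at the adjoined variable itself; the other is the right rule, whose
side condition on fresh variables is built into weakening. -/
theorem le_all {a : Lind L T X} {b : Lind L T [.prod A X.tensor]} :
    a ≤ all A b ↔ subst (El.snd El.var) a ≤ b := by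
  induction a using ind with | h φ
  induction b using ind with | h ψ
  constructor
  · intro h
    refine le_trans (subst_mono _ h) ?_
    exact mk_le_mk.2 (.allL (Tm.fst Tm.var)
      (Derivable.of_eqv (Formula.inst_lift_snd ψ)).1)
  · intro h
    refine mk_le_mk.2 (.allR ?_)
    rw [Multiset.map_singleton]
    exact h

theorem ex_le {a : Lind L T X} {b : Lind L T [.prod A X.tensor]} :
    ex A b ≤ a ↔ b ≤ subst (El.snd El.var) a := by
  induction a using ind with | h φ
  induction b using ind with | h ψ
  constructor
  · intro h
    refine le_trans ?_ (subst_mono _ h)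
    exact mk_le_mk.2 (.exR (Tm.fst Tm.var)
      (Derivable.of_eqv (Formula.inst_lift_snd ψ)).2)
  · intro h
    refine mk_le_mk.2 (.exL ?_)
    rw [Multiset.map_singleton]
    exact h

/-- Reindexing along an arrow of the syntactic category. -/
def reindex (F : El (S := S) [] (.lolli A B)) (a : Lind L T [B]) : Lind L T [A] :=
  subst (El.single (El.act F El.var)) a

theorem reindex_idHom (a : Lind L T [A]) : reindex (El.idHom A) a = a := by
  rw [reindex, El.act_idHom, El.single_var, subst_tuple]

theorem reindex_comp (F : El (S := S) [] (.lolli A B)) (G : El (S := S) [] (.lolli B C))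
    (a : Lind L T [C]) : reindex (El.comp F G) a = reindex F (reindex G a) := by
  rw [reindex, reindex, reindex, subst_subst, El.letIn_single_right, El.letIn_act,
    El.letIn_single_var, El.act_comp]

end Lind

end LFSq

namespace LFSq

/-! ### Quantifiers along projections and the syntactic hyperdoctrine -/

namespace El

variable {S : Signature.{u}} {X Y Z : Ctx S} {A B C : Ty S.Base}

/-- The component of a one-component tuple. -/
def component (t : El X (Ctx.tensor [A])) : El X A := act (rightUnitHom A) t

/-- The identification of `A × (B ⊗ I)` with `A × B`, as a substitution. -/
def unitContract (A B : Ty S.Base) :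
    El (S := S) [.prod A (Ctx.tensor [B])] (Ctx.tensor [.prod A B]) :=
  single (pair (fst var) (component (snd var)))

def unitExpand (A B : Ty S.Base) :
    El (S := S) [.prod A B] (Ctx.tensor [.prod A (Ctx.tensor [B])]) :=
  single (pair (fst var) (single (snd var)))

theorem component_single (t : El X A) : component (single t) = t :=
  act_rightUnitHom_rightUnitInv t

theorem single_component (t : El X (Ctx.tensor [A])) :
    single (component t) = t :=
  act_rightUnitInv_rightUnitHom t

theorem letIn_component (s : El Y X.tensor) (t : El X (Ctx.tensor [A])) :
    letIn s (component t) = component (letIn s t) :=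
  letIn_act s (rightUnitHom A) t

theorem letIn_eq (s : El X (Ctx.tensor [A])) (t : El [A] B) :
    letIn s t = subst (.allLeft X) (component s) t := by
  rw [← letIn_single, single_component]

theorem letIn_unitExpand_snd (A B : Ty S.Base) :
    letIn (unitExpand A B) (snd var) = single (snd var) := by
  rw [unitExpand, letIn_snd, letIn_single_var, snd_pair]

/-- A quantifier in context `[B]` binds over `A × (B ⊗ I)`, a hyperdoctrine quantifies along `A × B
⟶ B`. This retraction, with the compatibility of both maps with the second projection, suffices to
transfer the adjunctions. -/
theorem letIn_unitExpand_unitContract (A B : Ty S.Base) :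
    letIn (unitExpand A B) (unitContract A B) = tuple [.prod A B] := by
  rw [unitContract, letIn_single_right, letIn_pair, letIn_fst, letIn_component,
    letIn_unitExpand_snd, component_single, unitExpand, letIn_single_var, fst_pair,
    pair_fst_snd, single_var]

theorem letIn_unitContract_single_snd (A B : Ty S.Base) :
    letIn (unitContract A B) (single (snd var)) = snd var := by
  rw [letIn_single_right, letIn_snd, unitContract, letIn_single_var, snd_pair,
    single_component]

end El

namespace Lind

variable {S : Signature.{u}} {L : QuantumLogic} {T : Set (Sequent S)} {X Y Z : Ctx S}
  {A B C : Ty S.Base}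

/-- The universal quantifier along a projection. -/
def allAlong (A B : Ty S.Base) (a : Lind L T [.prod A B]) : Lind L T [B] :=
  all A (subst (El.unitContract A B) a)

/-- The existential quantifier along a projection. -/
def exAlong (A B : Ty S.Base) (a : Lind L T [.prod A B]) : Lind L T [B] :=
  ex A (subst (El.unitContract A B) a)

theorem subst_unitExpand_snd (a : Lind L T [B]) :
    subst (El.unitExpand A B) (subst (El.snd El.var) a) = reindex (El.sndHom A B) a := by
  rw [subst_subst, El.letIn_unitExpand_snd, reindex, El.act_sndHom]

theorem subst_unitContract_reindex (a : Lind L T [B]) :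
    subst (El.unitContract A B) (reindex (El.sndHom A B) a) = subst (El.snd El.var) a := by
  rw [reindex, El.act_sndHom, subst_subst, El.letIn_unitContract_single_snd]

theorem subst_unitExpand_unitContract (b : Lind L T [.prod A B]) :
    subst (El.unitExpand A B) (subst (El.unitContract A B) b) = b := by
  rw [subst_subst, El.letIn_unitExpand_unitContract, subst_tuple]

theorem le_allAlong {a : Lind L T [B]} {b : Lind L T [.prod A B]} :
    a ≤ allAlong A B b ↔ reindex (El.sndHom A B) a ≤ b := by
  refine le_all.trans ⟨fun h => ?_, fun h => ?_⟩
  · have := subst_mono (El.unitExpand A B) h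
    rwa [subst_unitExpand_snd, subst_unitExpand_unitContract] at this
  · have := subst_mono (El.unitContract A B) h
    rwa [subst_unitContract_reindex] at this

theorem exAlong_le {a : Lind L T [B]} {b : Lind L T [.prod A B]} :
    exAlong A B b ≤ a ↔ b ≤ reindex (El.sndHom A B) a := by
  refine ex_le.trans ⟨fun h => ?_, fun h => ?_⟩
  · have := subst_mono (El.unitExpand A B) h
    rwa [subst_unitExpand_snd, subst_unitExpand_unitContract] at this
  · have := subst_mono (El.unitContract A B) h
    rwa [subst_unitContract_reindex] at this

/-- The computational content of Beck–Chevalley: both composite substitutions send the pair variable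
to its first component paired with `F` of its second. -/
theorem subst_liftCtx_unitContract (F : El (S := S) [] (.lolli C B)) (a : Lind L T [.prod A B]) :
    subst (El.liftCtx A (El.single (El.act F El.var))) (subst (El.unitContract A B) a) =
      subst (El.unitContract A C)
        (reindex (El.lift (El.fstHom A C) (El.comp (El.sndHom A C) F)) a) := by
  rw [reindex, subst_subst, subst_subst, El.act_lift, El.act_fstHom, El.act_comp, El.act_sndHom,
    El.unitContract, El.letIn_single_right, El.letIn_pair, El.letIn_fst, El.letIn_component,
    El.letIn_snd, El.liftCtx, El.letIn_single_var, El.fst_pair, El.snd_pair, El.letIn_single_right,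
    El.component_single, El.letIn_act, El.letIn_single_right, El.letIn_pair, El.letIn_fst,
    El.letIn_act, El.letIn_snd, El.unitContract, El.letIn_single_var, El.fst_pair, El.snd_pair,
    El.letIn_eq, El.subst_var]

theorem reindex_allAlong (F : El (S := S) [] (.lolli C B)) (a : Lind L T [.prod A B]) :
    reindex F (allAlong A B a) =
      allAlong A C (reindex (El.lift (El.fstHom A C) (El.comp (El.sndHom A C) F)) a) := by
  rw [allAlong, allAlong, ← subst_liftCtx_unitContract, ← subst_all]
  rfl

theorem reindex_exAlong (F : El (S := S) [] (.lolli C B)) (a : Lind L T [.prod A B]) :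
    reindex F (exAlong A B a) =
      exAlong A C (reindex (El.lift (El.fstHom A C) (El.comp (El.sndHom A C) F)) a) := by
  rw [exAlong, exAlong, ← subst_liftCtx_unitContract, ← subst_ex]
  rfl

end Lind

/-- The hyperdoctrine of formulas over the syntactic category. -/
def syntacticHyperdoctrine {S : Signature.{u}} (L : QuantumLogic) (T : Set (Sequent S)) :
    Hyperdoctrine.{u, u, u} L (SynCat S) where
  P :=
    { obj A := ⟨Lind L T [(A.unop : Ty S.Base)]⟩
      map F :=
        { toFun := Lind.reindex F.unop
          map_inf := Lind.subst_inf _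
          map_sup := Lind.subst_sup _
          map_top := Lind.subst_top _
          map_bot := Lind.subst_bot _
          map_compl := Lind.subst_compl _ }
      map_id _ := QLHom.ext (funext Lind.reindex_idHom)
      map_comp F G := QLHom.ext (funext (Lind.reindex_comp G.unop F.unop)) }
  all A B := Lind.allAlong A B
  ex A B := Lind.exAlong A B
  all_adjoint _ _ _ _ := Lind.le_allAlong.symm
  ex_adjoint _ _ _ _ := Lind.exAlong_le
  all_beckChevalley _ _ _ F a := Lind.reindex_allAlong F a
  ex_beckChevalley _ _ _ F a := Lind.reindex_exAlong F a

end LFSq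

namespace LFSq

/-! ### Transport along equalities of objects -/

section Transport

variable {C : Type v} [Category.{w} C]

/-- Heterogeneous equality is a congruence for each operation once the objects involved are equal
variables. It is stated for general objects so that the equalities can be eliminated before being
applied to interpreted types. -/
theorem comp_heq {X X' Y Y' Z Z' : C} (hX : X = X') (hY : Y = Y') (hZ : Z = Z')
    {f : X ⟶ Y} {f' : X' ⟶ Y'} {g : Y ⟶ Z} {g' : Y' ⟶ Z'} (hf : f ≍ f') (hg : g ≍ g') :
    f ≫ g ≍ f' ≫ g' := by
  subst hX hY hZ; cases hf; cases hg; rfl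

theorem tensorHom_heq [MonoidalCategory C] {X X' Y Y' U U' V V' : C} (hX : X = X') (hY : Y = Y')
    (hU : U = U') (hV : V = V') {f : X ⟶ Y} {f' : X' ⟶ Y'} {g : U ⟶ V} {g' : U' ⟶ V'}
    (hf : f ≍ f') (hg : g ≍ g') : (f ⊗ₘ g) ≍ (f' ⊗ₘ g') := by
  subst hX hY hU hV; cases hf; cases hg; rfl

theorem curry_heq [MonoidalCategory C] [MonoidalClosed C] {A A' X X' Y Y' : C} (hA : A = A')
    (hX : X = X') (hY : Y = Y') {f : A ⊗ X ⟶ Y} {f' : A' ⊗ X' ⟶ Y'} (hf : f ≍ f') :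
    MonoidalClosed.curry f ≍ MonoidalClosed.curry f' := by
  subst hA hX hY; cases hf; rfl

theorem lift_heq [FiniteProducts C] {X X' Y Y' Z Z' : C} (hX : X = X')
    (hY : Y = Y') (hZ : Z = Z') {f : X ⟶ Y} {f' : X' ⟶ Y'} {g : X ⟶ Z} {g' : X' ⟶ Z'}
    (hf : f ≍ f') (hg : g ≍ g') : FiniteProducts.lift f g ≍ FiniteProducts.lift f' g' := by
  subst hX hY hZ; cases hf; cases hg; rfl

variable {L : QuantumLogic} (P : Cᵒᵖ ⥤ QL.{z} L)

theorem QL.map_heq {X X' Y Y' : C} (hX : X = X') (hY : Y = Y') {f : X ⟶ Y} {f' : X' ⟶ Y'}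
    (hf : f ≍ f') {a : (P.obj (op Y)).carrier} {a' : (P.obj (op Y')).carrier} (ha : a ≍ a') :
    (P.map f.op).toFun a ≍ (P.map f'.op).toFun a' := by
  subst hX hY; cases hf; cases ha; rfl

theorem QL.map_eqToHom_heq {X Y : C} (h : X = Y) (a : (P.obj (op Y)).carrier) :
    (P.map (eqToHom h).op).toFun a ≍ a := by
  subst h
  rw [eqToHom_refl, op_id, P.map_id]
  rfl

theorem QL.compl_heq {X X' : C} (hX : X = X') {a : (P.obj (op X)).carrier}
    {a' : (P.obj (op X')).carrier} (ha : a ≍ a') : aᶜ ≍ a'ᶜ := by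
  subst hX; cases ha; rfl

theorem QL.inf_heq {X X' : C} (hX : X = X') {a b : (P.obj (op X)).carrier}
    {a' b' : (P.obj (op X')).carrier} (ha : a ≍ a') (hb : b ≍ b') : a ⊓ b ≍ a' ⊓ b' := by
  subst hX; cases ha; cases hb; rfl

theorem QL.sup_heq {X X' : C} (hX : X = X') {a b : (P.obj (op X)).carrier}
    {a' b' : (P.obj (op X')).carrier} (ha : a ≍ a') (hb : b ≍ b') : a ⊔ b ≍ a' ⊔ b' := by
  subst hX; cases ha; cases hb; rfl

theorem QL.le_iff_of_heq {X X' : C} (hX : X = X') {a b : (P.obj (op X)).carrier}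
    {a' b' : (P.obj (op X')).carrier} (ha : a ≍ a') (hb : b ≍ b') : a ≤ b ↔ a' ≤ b' := by
  subst hX; cases ha; cases hb; rfl

theorem Hyperdoctrine.all_heq [MonoidalCategory C] [FiniteProducts C]
    (H : Hyperdoctrine.{v, w, z} L C) {A A' X X' : C} (hA : A = A') (hX : X = X')
    {a : (H.P.obj (op (FiniteProducts.prod A X ⊗ 𝟙_ C))).carrier}
    {a' : (H.P.obj (op (FiniteProducts.prod A' X' ⊗ 𝟙_ C))).carrier} (ha : a ≍ a') :
    H.all A X ((H.P.map (ρ_ (FiniteProducts.prod A X)).inv.op).toFun a) ≍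
      H.all A' X' ((H.P.map (ρ_ (FiniteProducts.prod A' X')).inv.op).toFun a') := by
  subst hA hX; cases ha; rfl

theorem Hyperdoctrine.ex_heq [MonoidalCategory C] [FiniteProducts C]
    (H : Hyperdoctrine.{v, w, z} L C) {A A' X X' : C} (hA : A = A') (hX : X = X')
    {a : (H.P.obj (op (FiniteProducts.prod A X ⊗ 𝟙_ C))).carrier}
    {a' : (H.P.obj (op (FiniteProducts.prod A' X' ⊗ 𝟙_ C))).carrier} (ha : a ≍ a') :
    H.ex A X ((H.P.map (ρ_ (FiniteProducts.prod A X)).inv.op).toFun a) ≍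
      H.ex A' X' ((H.P.map (ρ_ (FiniteProducts.prod A' X')).inv.op).toFun a') := by
  subst hA hX; cases ha; rfl

end Transport

/-! ### The canonical interpretation of types and terms -/

variable {S : Signature.{u}}

/-- In the syntactic category, types interpret themselves. -/
theorem SynCat.obj_base : ∀ A : Ty S.Base,
    Ty.obj (C := SynCat S) (fun a => (Ty.base a : Ty S.Base)) A = A
  | .base _ => rfl
  | .unit => rfl
  | .tensor A B => congrArg₂ Ty.tensor (obj_base A) (obj_base B)
  | .lolli A B => congrArg₂ Ty.lolli (obj_base A) (obj_base B)
  | .one => rfl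
  | .prod A B => congrArg₂ Ty.prod (obj_base A) (obj_base B)

/-- An element as an arrow of the syntactic category. -/
def SynCat.ofEl {A B : Ty S.Base} (F : El (S := S) [] (.lolli A B)) :
    @Quiver.Hom (SynCat S) _ A B := F

open SynCat

/-- The interpretation of a signature in its syntactic hyperdoctrine. -/
def syntacticInterpretation (L : QuantumLogic) (T : Set (Sequent S)) :
    Interpretation S (syntacticHyperdoctrine L T) where
  base a := (Ty.base a : Ty S.Base)
  fn f := eqToHom (obj_base _) ≫ ofEl (El.lam (.op f .var)) ≫ eqToHom (obj_base _).symm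
  pred R := ((syntacticHyperdoctrine L T).P.map (eqToHom (obj_base (S.arity R))).op).toFun
    (Lind.mk L T (.atom R .var) : Lind L T [S.arity R])

namespace syntacticInterpretation

variable (L : QuantumLogic) (T : Set (Sequent S))

local notation "M" => syntacticInterpretation L T

theorem obj_eq (A : Ty S.Base) : A.obj (C := SynCat S) (M).base = A := obj_base A

theorem ctx_eq (X : Ctx S) : (M).ctx X = X.tensor := obj_base X.tensor

theorem fn_heq (f : S.Fn) : (M).fn f ≍ ofEl (El.lam (.op f .var)) :=
  (eqToHom_comp_heq _ _).trans (comp_eqToHom_heq _ _)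

theorem split_heq {X Y Z : Ctx S} (p : Split X Y Z) : (M).split p ≍ ofEl (El.splitHom p) := by
  induction p with
  | nil => exact heq_of_eq El.splitHom_nil.symm
  | @left A X Y Z p ih =>
    refine HEq.trans ?_ (heq_of_eq (El.splitHom_left p).symm)
    have key : ∀ {A A' X X' Y Y' Z Z' : SynCat S} (hA : A = A') (hX : X = X') (hY : Y = Y')
        (hZ : Z = Z') {f : X ⟶ Y ⊗ Z} {f' : X' ⟶ Y' ⊗ Z'} (hf : f ≍ f'),
        A ◁ f ≫ (α_ A Y Z).inv ≍ A' ◁ f' ≫ (α_ A' Y' Z').inv := by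
      intro A A' X X' Y Y' Z Z' hA hX hY hZ f f' hf
      subst hA hX hY hZ; cases hf; rfl
    exact key (obj_eq L T A) (ctx_eq L T X) (ctx_eq L T Y) (ctx_eq L T Z) ih
  | @right A X Y Z p ih =>
    refine HEq.trans ?_ (heq_of_eq (El.splitHom_right p).symm)
    have key : ∀ {A A' X X' Y Y' Z Z' : SynCat S} (hA : A = A') (hX : X = X') (hY : Y = Y')
        (hZ : Z = Z') {f : X ⟶ Y ⊗ Z} {f' : X' ⟶ Y' ⊗ Z'} (hf : f ≍ f'),
        A ◁ f ≫ (α_ A Y Z).inv ≫ (β_ A Y).hom ▷ Z ≫ (α_ Y A Z).hom ≍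
          A' ◁ f' ≫ (α_ A' Y' Z').inv ≫ (β_ A' Y').hom ▷ Z' ≫ (α_ Y' A' Z').hom := by
      intro A A' X X' Y Y' Z Z' hA hX hY hZ f f' hf
      subst hA hX hY hZ; cases hf; rfl
    exact key (obj_eq L T A) (ctx_eq L T X) (ctx_eq L T Y) (ctx_eq L T Z) ih

/-- The interpretation of a term is the closed function that it defines. -/
theorem tm_heq {X : Ctx S} {A : Ty S.Base} (t : Tm X A) :
    (M).tm t ≍ ofEl (El.closure (El.mk t)) := by
  induction t with
  | @var A =>
    refine HEq.trans ?_ (heq_of_eq (El.closure_var (A := A)).symm)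
    have key : ∀ {A A' : SynCat S}, A = A' → (ρ_ A).hom ≍ (ρ_ A').hom := by
      rintro A _ rfl
      rfl
    exact key (obj_eq L T A)
  | @op X f t ih =>
    refine HEq.trans ?_ (heq_of_eq (El.closure_op f (El.mk t)).symm)
    exact comp_heq (ctx_eq L T X) (obj_eq L T _) (obj_eq L T _) ih (fn_heq L T f)
  | star => exact heq_of_eq (El.closure_tuple (X := [])).symm
  | @letStar X Y Z A p s t ih ih' =>
    refine HEq.trans ?_ (heq_of_eq (El.closure_letStar p (El.mk s) (El.mk t)).symm)
    have key : ∀ {X X' Y Y' Z Z' A A' : SynCat S} (hX : X = X') (hY : Y = Y') (hZ : Z = Z')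
        (hA : A = A') {f : X ⟶ Y ⊗ Z} {f' : X' ⟶ Y' ⊗ Z'} (hf : f ≍ f')
        {s : Y ⟶ 𝟙_ _} {s' : Y' ⟶ 𝟙_ _} (hs : s ≍ s') {t : Z ⟶ A} {t' : Z' ⟶ A'} (ht : t ≍ t'),
        f ≫ s ▷ Z ≫ (λ_ Z).hom ≫ t ≍ f' ≫ s' ▷ Z' ≫ (λ_ Z').hom ≫ t' := by
      intro X X' Y Y' Z Z' A A' hX hY hZ hA f f' hf s s' hs t t' ht
      subst hX hY hZ hA; cases hf; cases hs; cases ht; rfl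
    exact key (ctx_eq L T X) (ctx_eq L T Y) (ctx_eq L T Z) (obj_eq L T A) (split_heq L T p) ih ih'
  | @tens X Y Z A B p s t ih ih' =>
    refine HEq.trans ?_ (heq_of_eq (El.closure_tens p (El.mk s) (El.mk t)).symm)
    exact comp_heq (ctx_eq L T X) (congrArg₂ Ty.tensor (ctx_eq L T Y) (ctx_eq L T Z))
      (obj_eq L T (.tensor A B)) (split_heq L T p)
      (tensorHom_heq (ctx_eq L T Y) (obj_eq L T A) (ctx_eq L T Z) (obj_eq L T B) ih ih')
  | @letTens X Y Z A B D p s t ih ih' =>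
    refine HEq.trans ?_ (heq_of_eq (El.closure_letTens p (El.mk s) (El.mk t)).symm)
    have key : ∀ {X X' Y Y' Z Z' A A' B B' D D' : SynCat S} (hX : X = X') (hY : Y = Y')
        (hZ : Z = Z') (hA : A = A') (hB : B = B') (hD : D = D')
        {f : X ⟶ Y ⊗ Z} {f' : X' ⟶ Y' ⊗ Z'} (hf : f ≍ f')
        {s : Y ⟶ A ⊗ B} {s' : Y' ⟶ A' ⊗ B'} (hs : s ≍ s')
        {t : A ⊗ B ⊗ Z ⟶ D} {t' : A' ⊗ B' ⊗ Z' ⟶ D'} (ht : t ≍ t'),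
        f ≫ s ▷ Z ≫ (α_ A B Z).hom ≫ t ≍ f' ≫ s' ▷ Z' ≫ (α_ A' B' Z').hom ≫ t' := by
      intro X X' Y Y' Z Z' A A' B B' D D' hX hY hZ hA hB hD f f' hf s s' hs t t' ht
      subst hX hY hZ hA hB hD; cases hf; cases hs; cases ht; rfl
    exact key (ctx_eq L T X) (ctx_eq L T Y) (ctx_eq L T Z) (obj_eq L T A) (obj_eq L T B)
      (obj_eq L T D) (split_heq L T p) ih ih'
  | @lam X A B t ih =>
    refine HEq.trans ?_ (heq_of_eq (El.closure_lam (El.mk t)).symm)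
    -- The syntactic currying is traded for that of the closed structure, so that both sides are the
    -- same categorical expression.
    refine HEq.trans ?_ (heq_of_eq (curry_eq (A := A) (X := X.tensor) (Y := B)
      (El.closure (El.mk t))))
    exact curry_heq (obj_eq L T A) (ctx_eq L T X) (obj_eq L T B) ih
  | @app X Y Z A B p s t ih ih' =>
    refine HEq.trans ?_ (heq_of_eq (El.closure_app p (El.mk s) (El.mk t)).symm)
    -- Likewise the uncurried identity is replaced by the evaluation map.
    refine HEq.trans ?_ (heq_of_eq (congrArg (fun e => El.comp (El.splitHom p) (El.comp
      (El.tensHom (El.closure (El.mk s)) (El.closure (El.mk t))) (El.comp (El.swap _ _) e)))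
      (ev_eq A B)))
    have key : ∀ {X X' Y Y' Z Z' A A' B B' : SynCat S} (hX : X = X') (hY : Y = Y')
        (hZ : Z = Z') (hA : A = A') (hB : B = B')
        {f : X ⟶ Y ⊗ Z} {f' : X' ⟶ Y' ⊗ Z'} (hf : f ≍ f')
        {s : Y ⟶ (ihom A).obj B} {s' : Y' ⟶ (ihom A').obj B'} (hs : s ≍ s')
        {t : Z ⟶ A} {t' : Z' ⟶ A'} (ht : t ≍ t'),
        f ≫ (s ⊗ₘ t) ≫ (β_ ((ihom A).obj B) A).hom ≫ (ihom.ev A).app B ≍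
          f' ≫ (s' ⊗ₘ t') ≫ (β_ ((ihom A').obj B') A').hom ≫ (ihom.ev A').app B' := by
      intro X X' Y Y' Z Z' A A' B B' hX hY hZ hA hB f f' hf s s' hs t t' ht
      subst hX hY hZ hA hB; cases hf; cases hs; cases ht; rfl
    exact key (ctx_eq L T X) (ctx_eq L T Y) (ctx_eq L T Z) (obj_eq L T A) (obj_eq L T B)
      (split_heq L T p) ih ih'
  | @triv X =>
    refine HEq.trans ?_ (heq_of_eq (El.trivHom_unique _).symm)
    have key : ∀ {X X' : SynCat S}, X = X' →
        FiniteProducts.toOne X ≍ FiniteProducts.toOne X' := by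
      rintro A _ rfl
      rfl
    exact key (ctx_eq L T X)
  | @pair X A B s t ih ih' =>
    refine HEq.trans ?_ (heq_of_eq (El.closure_pair (El.mk s) (El.mk t)).symm)
    exact lift_heq (ctx_eq L T X) (obj_eq L T A) (obj_eq L T B) ih ih'
  | @fst X A B t ih =>
    refine HEq.trans ?_ (heq_of_eq (El.closure_fst (El.mk t)).symm)
    have key : ∀ {A A' B B' : SynCat S}, A = A' → B = B' →
        FiniteProducts.fst A B ≍ FiniteProducts.fst A' B' := by
      rintro A _ B _ rfl rfl
      rfl
    exact comp_heq (ctx_eq L T X) (obj_eq L T (.prod A B)) (obj_eq L T A) ih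
      (key (obj_eq L T A) (obj_eq L T B))
  | @snd X A B t ih =>
    refine HEq.trans ?_ (heq_of_eq (El.closure_snd (El.mk t)).symm)
    have key : ∀ {A A' B B' : SynCat S}, A = A' → B = B' →
        FiniteProducts.snd A B ≍ FiniteProducts.snd A' B' := by
      rintro A _ B _ rfl rfl
      rfl
    exact comp_heq (ctx_eq L T X) (obj_eq L T (.prod A B)) (obj_eq L T B) ih
      (key (obj_eq L T A) (obj_eq L T B))

end syntacticInterpretation

end LFSq

namespace LFSq

/-! ### The canonical interpretation of formulas satisfies exactly what is derivable -/

open SynCat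

variable {S : Signature.{u}}

namespace Lind

variable {L : QuantumLogic} {T : Set (Sequent S)} {X : Ctx S} {A : Ty S.Base}

/-- A formula in context as a formula in one variable. -/
def contract (a : Lind L T X) : Lind L T [X.tensor] := subst El.var a

/-- Substituting the generic tuple for the single variable undoes `contract`, so replacing a context
by its tensor product loses no information about derivability. -/
theorem contract_le_contract {a b : Lind L T X} : contract a ≤ contract b ↔ a ≤ b := by
  refine ⟨fun h => ?_, subst_mono _⟩
  have := subst_mono (El.single (El.tuple X)) h
  rwa [contract, contract, subst_subst, subst_subst, El.letIn_single_var, subst_tuple,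
    subst_tuple] at this

theorem reindex_closure (t : El X A) (a : Lind L T [A]) :
    reindex (El.closure t) a = contract (subst (El.single t) a) := by
  rw [reindex, contract, subst_subst, El.letIn_single_right]
  rfl

theorem subst_single_atom (R : S.Pred) (t : Tm X (S.arity R)) :
    subst (El.single (El.mk t)) (mk L T (.atom R .var)) = mk L T (.atom R t) := by
  rw [show El.single (El.mk t) = El.mk (Tm.single t) from (El.mk_single t).symm]
  refine sound_eqv (.atom R (El.mk_eq_mk.1 ?_))
  rw [El.mk_letIn, El.mk_single]
  exact El.letIn_single_var (El.mk t)

theorem reindex_rightUnitInv_contract (a : Lind L T [A]) :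
    reindex (El.rightUnitInv A) (contract a) = a := by
  refine (subst_subst _ _ a).trans ?_
  refine (congrArg (subst · a) (El.letIn_single_var _)).trans ?_
  refine (congrArg (subst · a) El.single_var).trans (subst_tuple a)

/-- The quantified formula in context and its one-variable form bind over the same product `A × (⊗
X)`, so the two substitutions into the body coincide. -/
theorem contract_all (a : Lind L T [.prod A X.tensor]) :
    contract (all A a) = allAlong A X.tensor a := by
  rw [contract, subst_all, allAlong, El.unitContract, El.liftCtx, El.letIn_eq, El.subst_var]

theorem contract_ex (a : Lind L T [.prod A X.tensor]) :
    contract (ex A a) = exAlong A X.tensor a := by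
  rw [contract, subst_ex, exAlong, El.unitContract, El.liftCtx, El.letIn_eq, El.subst_var]

end Lind

namespace syntacticInterpretation

variable (L : QuantumLogic) (T : Set (Sequent S))

local notation "M" => syntacticInterpretation L T

local notation "H" => syntacticHyperdoctrine (S := S) L T

/-- An element of the Lindenbaum algebra as an element of a fibre. -/
def fibre {A : Ty S.Base} (a : Lind L T [A]) :
    (CategoryTheory.Functor.obj (H).P (@op (SynCat S) A)).carrier := a

theorem pred_heq (R : S.Pred) : (M).pred R ≍ fibre L T (Lind.mk L T (.atom R .var)) :=
  QL.map_eqToHom_heq (H).P (obj_base (S.arity R)) _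

theorem atom_heq {X : Ctx S} (R : S.Pred) (t : Tm X (S.arity R)) :
    (CategoryTheory.Functor.map (H).P ((M).tm t).op).toFun ((M).pred R) ≍
      fibre L T (Lind.contract (Lind.mk L T (.atom R t))) := by
  refine (QL.map_heq (H).P (ctx_eq L T X) (obj_eq L T _) (tm_heq L T t) (pred_heq L T R)).trans
    (heq_of_eq ?_)
  refine (Lind.reindex_closure (El.mk t) (Lind.mk L T (.atom R .var))).trans ?_
  exact congrArg Lind.contract (Lind.subst_single_atom R t)

/-- The interpretation of a formula is its class. -/
theorem formula_heq {X : Ctx S} (φ : Formula X) :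
    (M).formula φ ≍ fibre L T (Lind.contract (Lind.mk L T φ)) := by
  induction φ with
  | atom R t => exact atom_heq L T R t
  | @natom X R t => exact QL.compl_heq (H).P (ctx_eq L T X) (atom_heq L T R t)
  | @top X =>
    have key : ∀ {X X' : SynCat S}, X = X' →
        (⊤ : (CategoryTheory.Functor.obj (H).P (op X)).carrier) ≍
          (⊤ : (CategoryTheory.Functor.obj (H).P (op X')).carrier) := by
      rintro X _ rfl
      rfl
    exact key (ctx_eq L T X)
  | @bot X =>
    have key : ∀ {X X' : SynCat S}, X = X' →
        (⊥ : (CategoryTheory.Functor.obj (H).P (op X)).carrier) ≍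
          (⊥ : (CategoryTheory.Functor.obj (H).P (op X')).carrier) := by
      rintro X _ rfl
      rfl
    exact key (ctx_eq L T X)
  | @and X φ ψ ih ih' => exact QL.inf_heq (H).P (ctx_eq L T X) ih ih'
  | @or X φ ψ ih ih' => exact QL.sup_heq (H).P (ctx_eq L T X) ih ih'
  | @all X A φ ih =>
    refine ((H).all_heq (obj_eq L T A) (ctx_eq L T X) ih).trans (heq_of_eq ?_)
    exact (congrArg (Lind.allAlong A X.tensor)
      (Lind.reindex_rightUnitInv_contract (Lind.mk L T φ))).trans
      (Lind.contract_all (Lind.mk L T φ)).symm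
  | @ex X A φ ih =>
    refine ((H).ex_heq (obj_eq L T A) (ctx_eq L T X) ih).trans (heq_of_eq ?_)
    exact (congrArg (Lind.exAlong A X.tensor)
      (Lind.reindex_rightUnitInv_contract (Lind.mk L T φ))).trans
      (Lind.contract_ex (Lind.mk L T φ)).symm

theorem inf_heq {X : Ctx S} (Γ : Multiset (Formula X)) :
    (Γ.map (M).formula).inf ≍ fibre L T (Lind.contract (Γ.map (Lind.mk L T)).inf) := by
  induction Γ using Multiset.induction with
  | empty => exact formula_heq L T (X := X) .top
  | cons φ Γ ih =>
    rw [Multiset.map_cons, Multiset.inf_cons, Multiset.map_cons, Multiset.inf_cons]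
    refine (QL.inf_heq (H).P (ctx_eq L T X) (formula_heq L T φ) ih).trans (heq_of_eq ?_)
    exact (Lind.subst_inf El.var (Lind.mk L T φ) (Γ.map (Lind.mk L T)).inf).symm

theorem sup_heq {X : Ctx S} (Γ : Multiset (Formula X)) :
    (Γ.map (M).formula).sup ≍ fibre L T (Lind.contract (Γ.map (Lind.mk L T)).sup) := by
  induction Γ using Multiset.induction with
  | empty => exact formula_heq L T (X := X) .bot
  | cons φ Γ ih =>
    rw [Multiset.map_cons, Multiset.sup_cons, Multiset.map_cons, Multiset.sup_cons]
    refine (QL.sup_heq (H).P (ctx_eq L T X) (formula_heq L T φ) ih).trans (heq_of_eq ?_)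
    exact (Lind.subst_sup El.var (Lind.mk L T φ) (Γ.map (Lind.mk L T)).sup).symm

/-- The syntactic interpretation satisfies exactly the derivable sequents. -/
theorem satisfies_iff (s : Sequent S) :
    (M).Satisfies s ↔ Derivable L T s.ctx s.ant s.suc :=
  (QL.le_iff_of_heq (H).P (ctx_eq L T s.ctx) (inf_heq L T s.ant) (sup_heq L T s.suc)).trans
    (Lind.contract_le_contract.trans Lind.derivable_iff.symm)

end syntacticInterpretation

end LFSq
theorem mainTheorem4 (L : LFSq.QuantumLogic) (S : LFSq.Signature.{u})
    (T : Set (LFSq.Sequent S)) (s : LFSq.Sequent S) :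
    (LFSq.Derivable L T s.ctx s.ant s.suc →
      ∀ (C : Type v) [Category.{w} C] [MonoidalCategory C] [SymmetricCategory C]
        [MonoidalClosed C] [LFSq.FiniteProducts C] (H : LFSq.Hyperdoctrine.{v, w, z} L C)
        (M : LFSq.Interpretation S H), (∀ a ∈ T, M.Satisfies a) → M.Satisfies s) ∧
    ((∀ (C : Type u) [Category.{u} C] [MonoidalCategory C] [SymmetricCategory C]
        [MonoidalClosed C] [LFSq.FiniteProducts C] (H : LFSq.Hyperdoctrine.{u, u, u} L C)
        (M : LFSq.Interpretation S H), (∀ a ∈ T, M.Satisfies a) → M.Satisfies s) →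
      LFSq.Derivable L T s.ctx s.ant s.suc) := by
  refine ⟨fun h C _ _ _ _ _ H M hT => M.soundness hT h, ?_⟩
  intro h
  -- The model depends on `T`, so the axioms hold in it because they are derivable by `hyp`.
  have := h (LFSq.SynCat S) (LFSq.syntacticHyperdoctrine L T) (LFSq.syntacticInterpretation L T)
    fun a ha => (LFSq.syntacticInterpretation.satisfies_iff L T a).2 (.hyp ha)
  exact (LFSq.syntacticInterpretation.satisfies_iff L T s).1 this
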